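/- Let $p$ be a prime, $K/\mathbb{Q}_p$ a finite extension with valuation ring $\mathcal{O}$ and uniformiser $\pi$, and let $\mathfrak{g}$ be a finite-dimensional nilpotent Lie algebra over $K$. Let $\mathcal{L}$ be an $\mathcal{O}$-Lie lattice in $\mathfrak{g}$, i.e. an $\mathcal{O}$-submodule closed under the Lie bracket with $\bigcap_n \pi^n\mathcal{L}=0$ and $\mathcal{L}\otimes_{\mathcal{O}}K=\mathfrak{g}$, and assume that $\mathcal{L}$ is powerful: $[\mathcal{L},\mathcal{L}]\subseteq p\mathcal{L}$. For an $\mathcal{O}$-Lie algebra $\mathcal{M}$ write $\widehat{U(\mathcal{M})}_K:=\big(\varprojlim_n U(\mathcal{M})/\pi^nU(\mathcal{M})\big)\otimes_{\mathcal{O}}K$. Let $\lambda:\mathfrak{g}\to K$ be a $K$-linear form with $\lambda(\mathcal{L})\subseteq\mathcal{O}$, and let $\mathfrak{b}$ be a polarisation of $\mathfrak{g}$ at $\lambda$, i.e. a solvable subalgebra such that, for all $u\in\mathfrak{g}$, $\lambda([u,\mathfrak{b}])=0$ if and only if $u\in\mathfrak{b}$. Let $r=\dim_K\mathfrak{g}/\mathfrak{b}$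 and $\mathcal{B}=\mathfrak{b}\cap\mathcal{L}$. Let $K_\lambda$ be the one-dimensional $\widehat{U(\mathcal{B})}_K$-module on which $\mathcal{B}$ acts through $\lambda$ (the character $U(\mathcal{B})\to\mathcal{O}$ induced by $\lambda$ extends to the completion because $\mathcal{O}$ is $\pi$-adically complete), let $$\widehat{D(\lambda)}_{\mathfrak{b}}:=\widehat{U(\mathcal{L})}_K\otimes_{\widehat{U(\mathcal{B})}_K}K_\lambda$$ be the affinoid Dixmier module, and let $I$ be its annihilator in $\widehat{U(\mathcal{L})}_K$. Let $A_r(K)$ be the Weyl algebra, i.e. the $K$-algebra on generators $x_1,\dots,x_r,y_1,\dots,y_r$ in which all pairs of generators commute except that $x_iy_i-y_ix_i=1$ for each $i$; let $A_r(\mathcal{O})$ be its $\mathcal{O}$-subalgebra generated by the $x_i$ and $y_i$; and let $\widehat{A_r(K)}:=\big(\varprojlim_n A_r(\mathcal{O})/\pi^nA_r(\mathcal{O})\big)\otimes_{\mathcal{O}}K$ be the $r$-th Tate–Weyl algebra. Then there is an injective homomorphism of $K$-algebras $\widehat{U(\mathcal{L})}_K/I\to\widehat{A_r(K)}$, and $\widehat{U(\mathcal{L})}_K/I$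 is a domain. -/

import Mathlib

open scoped TensorProduct

noncomputable section

namespace AffinoidDixmier

/-! ### The valuation ring of a finite extension of `ℚ_p` -/

section ValuationRing

variable (p : ℕ) [Fact p.Prime] (K : Type*) [Field K] [Algebra ℚ_[p] K] [FiniteDimensional ℚ_[p] K]

/-- The valuation ring `𝒪` of a finite extension `K` of `ℚ_p`: the elements of absolute value at
most one, for the unique extension of the `p`-adic absolute value to `K` (the spectral norm). -/
def integers : ValuationSubring K where
  carrier := {x | spectralNorm ℚ_[p] K x ≤ 1}
  mul_mem' {a b} ha hb := by
    let _ := spectralNorm.normedField ℚ_[p] K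
    have h := norm_mul a b
    change spectralNorm ℚ_[p] K (a * b) = spectralNorm ℚ_[p] K a * spectralNorm ℚ_[p] K b at h
    simp only [Set.mem_ofPred_eq] at ha hb ⊢
    rw [h]
    exact mul_le_one₀ ha (spectralNorm_nonneg _) hb
  one_mem' := by
    simp only [Set.mem_ofPred_eq]
    exact spectralNorm_one.le
  add_mem' {a b} ha hb := by
    simp only [Set.mem_ofPred_eq] at ha hb ⊢
    exact (isNonarchimedean_spectralNorm a b).trans (max_le ha hb)
  zero_mem' := by
    simp only [Set.mem_ofPred_eq, spectralNorm_zero, zero_le_one]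
  neg_mem' {a} ha := by
    simp only [Set.mem_ofPred_eq] at ha ⊢
    rw [spectralNorm_neg (Algebra.IsAlgebraic.isAlgebraic _)]
    exact ha
  mem_or_inv_mem' a := by
    let _ := spectralNorm.normedField ℚ_[p] K
    change ‖a‖ ≤ 1 ∨ ‖a⁻¹‖ ≤ 1
    rw [norm_inv]
    rcases le_total ‖a‖ 1 with h | h
    · exact Or.inl h
    · exact Or.inr (inv_le_one_of_one_le₀ h)

end ValuationRing

/-- A Lie algebra over a field is a Lie algebra over each of its valuation subrings. -/
instance instLieAlgebraValuationSubring {K : Type*} [Field K] (O : ValuationSubring K)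
    {g : Type*} [LieRing g] [LieAlgebra K g] : LieAlgebra O g where
  lie_smul t x y := lie_smul (t : K) x y

/-! ### `π`-adic completions -/

section Completion

variable {O : Type*} [CommRing O] (π : O)

/-- The two-sided ideal `πⁿ A` of an `𝒪`-algebra `A`. -/
def powIdeal (A : Type*) [Ring A] [Algebra O A] (n : ℕ) : Ideal A where
  carrier := {a | ∃ b : A, a = π ^ n • b}
  add_mem' := by
    rintro _ _ ⟨a, rfl⟩ ⟨b, rfl⟩
    exact ⟨a + b, (smul_add _ _ _).symm⟩
  zero_mem' := ⟨0, (smul_zero _).symm⟩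
  smul_mem' := by
    rintro c _ ⟨a, rfl⟩
    exact ⟨c * a, by simp⟩

instance (A : Type*) [Ring A] [Algebra O A] (n : ℕ) : (powIdeal π A n).IsTwoSided where
  mul_mem_of_left := by
    rintro _ c ⟨a, rfl⟩
    exact ⟨a * c, by simp⟩

lemma powIdeal_succ_le (A : Type*) [Ring A] [Algebra O A] (n : ℕ) :
    powIdeal π A (n + 1) ≤ powIdeal π A n := by
  rintro _ ⟨b, rfl⟩
  exact ⟨π • b, by rw [pow_succ, mul_smul]⟩

/-- The `π`-adic completion `lim A / πⁿ A` of a (not necessarily commutative) `𝒪`-algebra `A`. -/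
def PiCompletion (A : Type*) [Ring A] [Algebra O A] :
    Subalgebra O (∀ n, A ⧸ powIdeal π A n) where
  carrier := {x | ∀ n, Ideal.Quotient.factor (powIdeal_succ_le π A n) (x (n + 1)) = x n}
  mul_mem' ha hb n := by simp only [Pi.mul_apply, map_mul, ha n, hb n]
  add_mem' ha hb n := by simp only [Pi.add_apply, map_add, ha n, hb n]
  algebraMap_mem' _ _ := rfl

/-- The canonical map from `A` to its `π`-adic completion. -/
def PiCompletion.of (A : Type*) [Ring A] [Algebra O A] : A →ₐ[O] PiCompletion π A where
  toFun a := ⟨fun _ => Ideal.Quotient.mk _ a, fun _ => rfl⟩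
  map_one' := rfl
  map_mul' _ _ := rfl
  map_zero' := rfl
  map_add' _ _ := rfl
  commutes' _ := rfl

lemma powIdeal_le_comap {A B : Type*} [Ring A] [Algebra O A] [Ring B] [Algebra O B]
    (f : A →ₐ[O] B) (n : ℕ) : powIdeal π A n ≤ (powIdeal π B n).comap f := by
  rintro _ ⟨b, rfl⟩
  exact ⟨f b, map_smul f _ _⟩

/-- Functoriality of the `π`-adic completion. -/
def PiCompletion.map {A B : Type*} [Ring A] [Algebra O A] [Ring B] [Algebra O B]
    (f : A →ₐ[O] B) : PiCompletion π A →ₐ[O] PiCompletion π B where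
  toFun x := ⟨fun n => Ideal.quotientMapₐ (powIdeal π B n) f (powIdeal_le_comap π f n) (x.1 n), by
    intro n
    obtain ⟨a, ha⟩ := Ideal.Quotient.mk_surjective (x.1 (n + 1))
    have h := x.2 n
    rw [← ha] at h
    beta_reduce
    rw [← h, ← ha]
    rfl⟩
  map_one' := Subtype.ext (funext fun _ => map_one _)
  map_mul' _ _ := Subtype.ext (funext fun _ => map_mul _ _ _)
  map_zero' := Subtype.ext (funext fun _ => map_zero _)
  map_add' _ _ := Subtype.ext (funext fun _ => map_add _ _ _)
  commutes' _ := Subtype.ext (funext fun _ => AlgHom.commutes _ _)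

/-- `Â ⊗_𝒪 K`, for `Â` the `π`-adic completion of the `𝒪`-algebra `A`. If `A` is an `𝒪`-lattice
subalgebra of a `K`-algebra `R`, this is the completion of `R` with respect to `A`. -/
def CompletionK (K : Type*) [Field K] [Algebra O K] (A : Type*) [Ring A] [Algebra O A] : Type _ :=
  K ⊗[O] PiCompletion π A

instance (K : Type*) [Field K] [Algebra O K] (A : Type*) [Ring A] [Algebra O A] :
    Ring (CompletionK π K A) := inferInstanceAs (Ring (K ⊗[O] PiCompletion π A))

instance (K : Type*) [Field K] [Algebra O K] (A : Type*) [Ring A] [Algebra O A] :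
    Algebra K (CompletionK π K A) := inferInstanceAs (Algebra K (K ⊗[O] PiCompletion π A))

/-- The `K`-algebra homomorphism `Â ⊗ K → B̂ ⊗ K` induced by `A → B`. -/
def CompletionK.map (K : Type*) [Field K] [Algebra O K] {A B : Type*} [Ring A] [Algebra O A]
    [Ring B] [Algebra O B] (f : A →ₐ[O] B) : CompletionK π K A →ₐ[K] CompletionK π K B :=
  Algebra.TensorProduct.map (AlgHom.id K K) (PiCompletion.map π f)

end Completion

section Complete

variable {p : ℕ} [Fact p.Prime] {K : Type*} [Field K] [Algebra ℚ_[p] K]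
  [FiniteDimensional ℚ_[p] K]

/-- The valuation ring `𝒪` is `π`-adically complete and separated. -/
lemma of_bijective {π : integers p K} (hπ : Irreducible π) :
    Function.Bijective (PiCompletion.of π (integers p K)) := by
  let _ := spectralNorm.normedField ℚ_[p] K
  let _ : UniformSpace K := spectralNorm.uniformSpace ℚ_[p] K
  have hcomp : CompleteSpace K := spectralNorm.completeSpace ℚ_[p] K
  have hna : ∀ a b : K, ‖a + b‖ ≤ max ‖a‖ ‖b‖ := isNonarchimedean_spectralNorm
  have hle : ∀ x : integers p K, ‖(x : K)‖ ≤ 1 := fun x => x.2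
  have hπ0 : (π : K) ≠ 0 := fun h => hπ.ne_zero (Subtype.ext h)
  have hπ1 : ‖(π : K)‖ < 1 := by
    refine lt_of_le_of_ne (hle π) fun h => hπ.not_isUnit ?_
    refine IsUnit.of_mul_eq_one ⟨(π : K)⁻¹, ?_⟩ (Subtype.ext (mul_inv_cancel₀ hπ0))
    change ‖(π : K)⁻¹‖ ≤ 1
    rw [norm_inv, h, inv_one]
  have hmem : ∀ (n : ℕ) (y : integers p K),
      y ∈ powIdeal π (integers p K) n ↔ ‖(y : K)‖ ≤ ‖(π : K)‖ ^ n := by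
    intro n y
    constructor
    · rintro ⟨b, rfl⟩
      change ‖(π : K) ^ n * (b : K)‖ ≤ _
      rw [norm_mul, norm_pow]
      exact mul_le_of_le_one_right (by positivity) (hle b)
    · intro h
      refine ⟨⟨(y : K) / (π : K) ^ n, ?_⟩, ?_⟩
      · change ‖(y : K) / (π : K) ^ n‖ ≤ 1
        rw [norm_div, norm_pow]
        exact div_le_one_of_le₀ h (by positivity)
      · apply Subtype.ext
        change (y : K) = (π : K) ^ n * ((y : K) / (π : K) ^ n)
        field_simp
  constructor
  · rw [injective_iff_map_eq_zero]
    intro x hx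
    have h1 : ∀ n, ‖(x : K)‖ ≤ ‖(π : K)‖ ^ n := fun n =>
      (hmem n x).1 (Ideal.Quotient.eq_zero_iff_mem.1 (congrFun (congrArg Subtype.val hx) n))
    have h2 := ge_of_tendsto' (tendsto_pow_atTop_nhds_zero_of_lt_one (norm_nonneg _) hπ1) h1
    exact Subtype.ext (norm_le_zero_iff.1 h2)
  · intro y
    choose c hc using fun n => Ideal.Quotient.mk_surjective (y.1 n)
    have hstep : ∀ n, ‖(c (n + 1) : K) - c n‖ ≤ ‖(π : K)‖ ^ n := by
      intro n
      refine (hmem n (c (n + 1) - c n)).1 (Ideal.Quotient.eq.1 ?_)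
      have h := y.2 n
      rw [← hc, ← hc] at h
      exact h
    have hfar : ∀ n k, ‖(c (n + k) : K) - c n‖ ≤ ‖(π : K)‖ ^ n := by
      intro n k
      induction k with
      | zero => simp
      | succ k ih =>
        have h : (c (n + (k + 1)) : K) - c n
            = ((c (n + k + 1) : K) - c (n + k)) + ((c (n + k) : K) - c n) := by
          rw [add_assoc]; ring
        rw [h]
        refine (hna _ _).trans (max_le ((hstep _).trans ?_) ih)
        exact pow_le_pow_of_le_one (norm_nonneg _) hπ1.le (Nat.le_add_right _ _)
    have hcau : CauchySeq fun n => (c n : K) := by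
      refine cauchySeq_of_le_geometric ‖(π : K)‖ 1 hπ1 fun n => ?_
      rw [dist_comm, dist_eq_norm, one_mul]
      exact hstep n
    obtain ⟨x, hx⟩ := cauchySeq_tendsto_of_complete hcau
    have hlim : ∀ n, ‖x - c n‖ ≤ ‖(π : K)‖ ^ n := by
      intro n
      have h1 : Filter.Tendsto (fun k => ‖(c (n + k) : K) - c n‖) Filter.atTop
          (nhds ‖x - c n‖) := by
        have h2 := hx.comp (Filter.tendsto_add_atTop_nat n)
        have h3 := (h2.sub_const (c n : K)).norm
        simpa [Function.comp_def, add_comm] using h3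
      exact le_of_tendsto' h1 (hfar n)
    have hx1 : ‖x‖ ≤ 1 := by
      have h := hna (x - c 0) (c 0)
      rw [sub_add_cancel] at h
      exact h.trans (max_le (by simpa using hlim 0) (hle _))
    refine ⟨⟨x, hx1⟩, Subtype.ext (funext fun n => ?_)⟩
    rw [← hc]
    exact Ideal.Quotient.eq.2 ((hmem n _).2 (hlim n))

/-- A character `χ : A → 𝒪` of an `𝒪`-algebra extends to a character `Â → 𝒪` of its `π`-adic
completion, since `𝒪` is `π`-adically complete. -/
def extendCharacter {π : integers p K} (hπ : Irreducible π) {A : Type*} [Ring A]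
    [Algebra (integers p K) A] (χ : A →ₐ[integers p K] integers p K) :
    PiCompletion π A →ₐ[integers p K] integers p K :=
  (AlgEquiv.ofBijective (PiCompletion.of π (integers p K)) (of_bijective hπ)).symm.toAlgHom.comp
    (PiCompletion.map π χ)

/-- The resulting character `Â ⊗_𝒪 K → K`. -/
def characterK {π : integers p K} (hπ : Irreducible π) {A : Type*} [Ring A]
    [Algebra (integers p K) A] (χ : A →ₐ[integers p K] integers p K) :
    CompletionK π K A →ₐ[K] K :=
  Algebra.TensorProduct.lift (AlgHom.id K K)
    ((Algebra.ofId (integers p K) K).comp (extendCharacter hπ χ)) fun _ _ => Commute.all _ _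

end Complete

/-! ### Induced modules -/

section Induced

/-- The one-dimensional module `K v` on which a `K`-algebra `S` acts through a character. -/
def CharModule {K S : Type*} [Field K] [Ring S] [Algebra K S] (_χ : S →ₐ[K] K) : Type _ := K

instance {K S : Type*} [Field K] [Ring S] [Algebra K S] (χ : S →ₐ[K] K) :
    AddCommGroup (CharModule χ) := inferInstanceAs (AddCommGroup K)

instance {K S : Type*} [Field K] [Ring S] [Algebra K S] (χ : S →ₐ[K] K) :
    Module S (CharModule χ) := Module.compHom K (χ : S →+* K)

/-- The relations `(a s) ⊗ m = a ⊗ (s m)` defining the tensor product over `S`. -/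
def balancedRelations {S A : Type*} [Ring S] [Ring A] (f : S →+* A) (M : Type*) [AddCommGroup M]
    [Module S M] : Submodule A (A ⊗[ℤ] M) :=
  Submodule.span A {t | ∃ (a : A) (s : S) (m : M), t = (a * f s) ⊗ₜ[ℤ] m - a ⊗ₜ[ℤ] (s • m)}

/-- The induced left `A`-module `A ⊗_S M`, for a homomorphism `S → A` of (not necessarily
commutative) rings and a left `S`-module `M`. -/
def InducedModule {S A : Type*} [Ring S] [Ring A] (f : S →+* A) (M : Type*) [AddCommGroup M]
    [Module S M] : Type _ :=
  (A ⊗[ℤ] M) ⧸ balancedRelations f M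

instance {S A : Type*} [Ring S] [Ring A] (f : S →+* A) (M : Type*) [AddCommGroup M]
    [Module S M] : AddCommGroup (InducedModule f M) :=
  inferInstanceAs (AddCommGroup ((A ⊗[ℤ] M) ⧸ balancedRelations f M))

instance {S A : Type*} [Ring S] [Ring A] (f : S →+* A) (M : Type*) [AddCommGroup M]
    [Module S M] : Module A (InducedModule f M) :=
  inferInstanceAs (Module A ((A ⊗[ℤ] M) ⧸ balancedRelations f M))

end Induced

/-! ### Lattices and polarisations -/

section Lattices

/-- An `𝒪`-lattice in a `K`-vector space `V`, where `𝒪` is a valuation ring of `K` with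
uniformiser `π`: a `π`-adically separated `𝒪`-submodule that spans `V` over `K`. -/
structure IsLattice {K : Type*} [Field K] {O : ValuationSubring K} (π : O) {V : Type*}
    [AddCommGroup V] [Module K V] (N : Submodule O V) : Prop where
  separated : ∀ v : V, (∀ n : ℕ, ∃ w ∈ N, v = π ^ n • w) → v = 0
  span_eq_top : Submodule.span K (N : Set V) = ⊤

/-- A polarisation of `g` at a linear form `lam`: a solvable subalgebra `b` such that
`lam [u, b] = 0` if and only if `u ∈ b`. -/
structure IsPolarisation {K g : Type*} [Field K] [LieRing g] [LieAlgebra K g]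
    (lam : Module.Dual K g) (b : LieSubalgebra K g) : Prop where
  solvable : LieAlgebra.IsSolvable b
  mem_iff : ∀ u : g, (∀ v ∈ b, lam ⁅u, v⁆ = 0) ↔ u ∈ b

/-- The subalgebra `𝓑 = b ∩ L` of an `𝒪`-Lie lattice `L`. -/
def latticePart {K g : Type*} [Field K] [LieRing g] [LieAlgebra K g] {O : ValuationSubring K}
    (L : LieSubalgebra O g) (b : LieSubalgebra K g) : LieSubalgebra O L where
  carrier := {x | (x : g) ∈ b}
  add_mem' ha hb := b.add_mem ha hb
  zero_mem' := b.zero_mem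
  smul_mem' c _ hx := b.smul_mem (c : K) hx
  lie_mem' ha hb := b.lie_mem ha hb

end Lattices

/-! ### Affinoid enveloping algebras and affinoid Dixmier modules -/

section Dixmier

attribute [local instance 100] LieRing.ofAssociativeRing

/-- The affinoid enveloping algebra `Û(L)_K` of an `𝒪`-Lie algebra `L`. -/
abbrev AffinoidEnvelope {O : Type*} [CommRing O] (π : O) (K : Type*) [Field K] [Algebra O K]
    (L : Type*) [LieRing L] [LieAlgebra O L] :=
  CompletionK π K (UniversalEnvelopingAlgebra O L)

/-- The homomorphism of enveloping algebras `U(B) → U(L)` given by the inclusion of a subalgebra. -/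
def envelopeIncl {O L : Type*} [CommRing O] [LieRing L] [LieAlgebra O L] (B : LieSubalgebra O L) :
    UniversalEnvelopingAlgebra O B →ₐ[O] UniversalEnvelopingAlgebra O L :=
  UniversalEnvelopingAlgebra.lift O ((UniversalEnvelopingAlgebra.ι O).comp B.incl)

variable {p : ℕ} [Fact p.Prime] {K : Type*} [Field K] [Algebra ℚ_[p] K]
  [FiniteDimensional ℚ_[p] K] {g : Type*} [LieRing g] [LieAlgebra K g]

/-- The restriction of `lam` to `𝓑 = b ∩ L`, a homomorphism of `𝒪`-Lie algebras to the abelian Lie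
algebra `𝒪`. -/
def latticeCharacter {L : LieSubalgebra (integers p K) g} {lam : Module.Dual K g}
    (hlam : ∀ x ∈ L, lam x ∈ integers p K) {b : LieSubalgebra K g} (hb : IsPolarisation lam b) :
    latticePart L b →ₗ⁅integers p K⁆ integers p K where
  toFun x := ⟨lam ((x : L) : g), hlam _ (x : L).2⟩
  map_add' x y := Subtype.ext (map_add lam ((x : L) : g) ((y : L) : g))
  map_smul' c x := Subtype.ext (map_smul lam (c : K) ((x : L) : g))
  map_lie' {x y} := by
    apply Subtype.ext
    have h : lam ⁅((x : L) : g), ((y : L) : g)⁆ = 0 := (hb.mem_iff _).2 x.2 _ y.2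
    rw [LieRing.of_associative_ring_bracket, mul_comm, sub_self]
    exact h

/-- The one-dimensional `Û(𝓑)_K`-module `K_lam`. -/
abbrev OneDimensional {π : integers p K} (hπ : Irreducible π)
    {L : LieSubalgebra (integers p K) g} {lam : Module.Dual K g}
    (hlam : ∀ x ∈ L, lam x ∈ integers p K) {b : LieSubalgebra K g} (hb : IsPolarisation lam b) :=
  CharModule (characterK hπ
    (UniversalEnvelopingAlgebra.lift (integers p K) (latticeCharacter hlam hb)))

/-- The affinoid Dixmier module `Û(L)_K ⊗_{Û(𝓑)_K} K_lam`. -/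
abbrev DixmierModule {π : integers p K} (hπ : Irreducible π)
    {L : LieSubalgebra (integers p K) g} {lam : Module.Dual K g}
    (hlam : ∀ x ∈ L, lam x ∈ integers p K) {b : LieSubalgebra K g} (hb : IsPolarisation lam b) :=
  InducedModule (CompletionK.map π K (envelopeIncl (latticePart L b))).toRingHom
    (OneDimensional hπ hlam hb)

/-- The annihilator `I` of the affinoid Dixmier module in `Û(L)_K`. -/
def dixmierAnnihilator {π : integers p K} (hπ : Irreducible π)
    {L : LieSubalgebra (integers p K) g} {lam : Module.Dual K g}
    (hlam : ∀ x ∈ L, lam x ∈ integers p K) {b : LieSubalgebra K g} (hb : IsPolarisation lam b) :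
    Ideal (AffinoidEnvelope π K L) :=
  Module.annihilator (AffinoidEnvelope π K L) (DixmierModule hπ hlam hb)

instance {π : integers p K} (hπ : Irreducible π)
    {L : LieSubalgebra (integers p K) g} {lam : Module.Dual K g}
    (hlam : ∀ x ∈ L, lam x ∈ integers p K) {b : LieSubalgebra K g} (hb : IsPolarisation lam b) :
    (dixmierAnnihilator hπ hlam hb).IsTwoSided :=
  inferInstanceAs (Module.annihilator _ _).IsTwoSided

end Dixmier

/-! ### Tate–Weyl algebras -/

section Weyl

/-- The relations of the Weyl algebra on the generators `x i = inl i` and `y i = inr i`. -/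
inductive WeylRel (k : Type*) [CommRing k] (d : ℕ) :
    FreeAlgebra k (Fin d ⊕ Fin d) → FreeAlgebra k (Fin d ⊕ Fin d) → Prop
  | xx (i j : Fin d) : WeylRel k d
      (FreeAlgebra.ι k (.inl i) * FreeAlgebra.ι k (.inl j))
      (FreeAlgebra.ι k (.inl j) * FreeAlgebra.ι k (.inl i))
  | yy (i j : Fin d) : WeylRel k d
      (FreeAlgebra.ι k (.inr i) * FreeAlgebra.ι k (.inr j))
      (FreeAlgebra.ι k (.inr j) * FreeAlgebra.ι k (.inr i))
  | xy (i j : Fin d) : i ≠ j → WeylRel k d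
      (FreeAlgebra.ι k (.inl i) * FreeAlgebra.ι k (.inr j))
      (FreeAlgebra.ι k (.inr j) * FreeAlgebra.ι k (.inl i))
  | comm (i : Fin d) : WeylRel k d
      (FreeAlgebra.ι k (.inl i) * FreeAlgebra.ι k (.inr i))
      (FreeAlgebra.ι k (.inr i) * FreeAlgebra.ι k (.inl i) + 1)

/-- The `d`-th Weyl algebra `A_d(k)`. -/
abbrev WeylAlgebra (k : Type*) [CommRing k] (d : ℕ) := RingQuot (WeylRel k d)

/-- The generators of the Weyl algebra. -/
def WeylAlgebra.gen (k : Type*) [CommRing k] (d : ℕ) (s : Fin d ⊕ Fin d) : WeylAlgebra k d :=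
  RingQuot.mkAlgHom k (WeylRel k d) (FreeAlgebra.ι k s)

/-- The `𝒪`-subalgebra `A_d(𝒪)` of `A_d(K)` of polynomials in the generators with coefficients
in `𝒪`. -/
def weylLattice {K : Type*} [Field K] (O : ValuationSubring K) (d : ℕ) :
    Subalgebra O (WeylAlgebra K d) :=
  Algebra.adjoin O (Set.range (WeylAlgebra.gen K d))

/-- The `d`-th Tate–Weyl algebra: the completion of `A_d(K)` with respect to `A_d(𝒪)`. -/
abbrev TateWeylAlgebra {K : Type*} [Field K] {O : ValuationSubring K} (π : O) (d : ℕ) :=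
  CompletionK π K (weylLattice O d)

end Weyl

end AffinoidDixmier

end

/-! The Dixmier module is, before completion, a module of polynomials on which `L` acts by
differential operators with integral coefficients; once this is arranged over `𝒪`, its annihilator
becomes the kernel of a map into a Tate–Weyl algebra, which is a domain.

Integral realisation (`exists_dixmierRep`). The form `lam` restricts to a Lie character `χ` of the
saturated subalgebra `𝓑`. By induction on the corank `r` one builds a Lie homomorphism `ρ : L →
A_r(𝒪)` that turns `𝒪[t₁,…,t_r]`, with `y` acting as `t` and `x` as `∂/∂t`, into the module induced
from `χ`. If `𝓑 ≠ L`, nilpotency puts `𝓑` inside the kernel `M` of a surjective character `f` of `L`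
(`exists_functional`). Choose `e` with `f e = 1`. Powerfulness gives `ad e = p δ` on `M` for a
nilpotent derivation `δ`. Given `ρ` on `M`, put `e ↦ y₀` and `x ↦ exp(-p x₀ δ) x = ∑ (pᵏ/k!) (-x₀)ᵏ
ρ(δᵏ x)`. The coefficients `pᵏ/k!` are integral, and `[y₀, -x₀] = 1` makes `y₀` act on the
exponential as `p δ`. Since `x₀ = ∂/∂t₀` kills polynomials free of `t₀`, `eᵃ u` sends `1` to `t₀ᵃ (u
· 1)` for `u` in `U(M)`, and the `eᵃ U(M)` span `U(L)`.

Completed Weyl algebra. It acts on `𝒪[[t]]`, whose endomorphism ring is `π`-adically complete.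
Normal ordering identifies `A_r(𝒪)` with polynomial symbols, so `A_r(𝒪)/π` is a Weyl algebra over a
domain and has no zero divisors; dividing by powers of `π` carries this to the completion
(`mul_eq_zero_of_completion`). An element killing all polynomials vanishes (`eq_zero_of_hatRep`),
since commutators with the `yᵢ` differentiate its symbol.

Comparison. Successive approximation modulo `π` shows that the elements of the completed `U(L)`
killing `1` form the left ideal generated by finitely many `b - χ(b)` (`exists_eq_sum_of_hatAct`).
So after inverting `π` the generator of the Dixmier module and the polynomial `1` have the same
annihilator. Hence `a ∈ I` iff every `a c` kills `1`, iff `a` kills all polynomials, iff `a` maps to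
zero in the Tate–Weyl algebra. -/

noncomputable section

namespace AffinoidDixmier

/-! ### The Weyl algebra and its actions on polynomials and power series. -/

section WeylBasics

namespace WeylAlgebra

variable {R : Type*} [CommRing R] {r : ℕ}

lemma induction {motive : WeylAlgebra R r → Prop} (hgen : ∀ s, motive (gen R r s))
    (halg : ∀ a : R, motive (algebraMap R _ a))
    (hadd : ∀ P Q, motive P → motive Q → motive (P + Q))
    (hmul : ∀ P Q, motive P → motive Q → motive (P * Q)) (P : WeylAlgebra R r) : motive P := by
  obtain ⟨Q, rfl⟩ := RingQuot.mkAlgHom_surjective R (WeylRel R r) P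
  induction Q using FreeAlgebra.induction with
  | grade0 a => rw [AlgHom.commutes]; exact halg a
  | grade1 s => exact hgen s
  | mul a b ha hb => rw [map_mul]; exact hmul _ _ ha hb
  | add a b ha hb => rw [map_add]; exact hadd _ _ ha hb

lemma gen_xx (i j : Fin r) :
    gen R r (.inl i) * gen R r (.inl j) = gen R r (.inl j) * gen R r (.inl i) := by
  simp only [gen, ← map_mul]
  exact RingQuot.mkAlgHom_rel R (WeylRel.xx i j)

lemma gen_yy (i j : Fin r) :
    gen R r (.inr i) * gen R r (.inr j) = gen R r (.inr j) * gen R r (.inr i) := by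
  simp only [gen, ← map_mul]
  exact RingQuot.mkAlgHom_rel R (WeylRel.yy i j)

lemma gen_xy (i j : Fin r) : gen R r (.inl i) * gen R r (.inr j) =
    gen R r (.inr j) * gen R r (.inl i) + if i = j then 1 else 0 := by
  split_ifs with h
  · subst h
    have := RingQuot.mkAlgHom_rel R (WeylRel.comm (k := R) i)
    simpa only [gen, map_mul, map_add, map_one] using this
  · have := RingQuot.mkAlgHom_rel R (WeylRel.xy (k := R) i j h)
    simpa only [gen, map_mul, add_zero] using this

/-- The universal property of the Weyl algebra. -/
def lift {A : Type*} [Ring A] [Algebra R A] (x y : Fin r → A)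
    (hxx : ∀ i j, x i * x j = x j * x i) (hyy : ∀ i j, y i * y j = y j * y i)
    (hxy : ∀ i j, x i * y j = y j * x i + if i = j then 1 else 0) : WeylAlgebra R r →ₐ[R] A :=
  RingQuot.liftAlgHom R ⟨FreeAlgebra.lift R (Sum.elim x y), by
    intro a b h
    cases h with
    | xx i j => simpa using hxx i j
    | yy i j => simpa using hyy i j
    | xy i j h => simpa [h] using hxy i j
    | comm i => simpa using hxy i i⟩

section lift

variable {A : Type*} [Ring A] [Algebra R A] {x y : Fin r → A}
    {hxx : ∀ i j, x i * x j = x j * x i} {hyy : ∀ i j, y i * y j = y j * y i}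
    {hxy : ∀ i j, x i * y j = y j * x i + if i = j then 1 else 0}

@[simp] lemma lift_inl (i : Fin r) : lift (R := R) x y hxx hyy hxy (gen R r (.inl i)) = x i := by
  simp [lift, gen]

@[simp] lemma lift_inr (i : Fin r) : lift (R := R) x y hxx hyy hxy (gen R r (.inr i)) = y i := by
  simp [lift, gen]

end lift

/-- The action of the Weyl algebra on a commutative algebra on which `y i` acts as multiplication
by `t i` and `x i` as `D i + s i`. -/
def rep {C : Type*} [CommRing C] [Algebra R C] (D : Fin r → Derivation R C C) (t s : Fin r → C)
    (hD : ∀ i j c, D i (D j c) = D j (D i c)) (hs : ∀ i j, D i (s j) = 0)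
    (ht : ∀ i j, D i (t j) = if i = j then 1 else 0) : WeylAlgebra R r →ₐ[R] Module.End R C :=
  lift (fun i => (D i : C →ₗ[R] C) + LinearMap.mulLeft R (s i)) (fun i => LinearMap.mulLeft R (t i))
    (by
      intro i j
      ext c
      simp [hD i j, hs]
      ring)
    (by
      intro i j
      ext c
      simp only [Module.End.mul_apply, LinearMap.mulLeft_apply]
      ring)
    (by
      intro i j
      ext c
      by_cases h : i = j <;> simp [ht, h] <;> ring)

/-- An intertwining map for the generators is an intertwining map for the Weyl algebra. -/
lemma intertwine {M N : Type*} [AddCommGroup M] [Module R M] [AddCommGroup N] [Module R N]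
    (f : WeylAlgebra R r →ₐ[R] Module.End R M) (g : WeylAlgebra R r →ₐ[R] Module.End R N)
    (F : M →ₗ[R] N) (h : ∀ s m, F (f (gen R r s) m) = g (gen R r s) (F m))
    (P : WeylAlgebra R r) (m : M) : F (f P m) = g P (F m) := by
  induction P using WeylAlgebra.induction generalizing m with
  | hgen s => exact h s m
  | halg a => simp [Module.algebraMap_end_apply]
  | hadd P Q hP hQ => simp [hP, hQ]
  | hmul P Q hP hQ => simp [hP, hQ]

lemma mvPolynomial_pderiv_comm {σ : Type*} (i j : σ) (f : MvPolynomial σ R) :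
    MvPolynomial.pderiv i (MvPolynomial.pderiv j f) =
      MvPolynomial.pderiv j (MvPolynomial.pderiv i f) := by
  classical
  ext m
  simp only [MvPolynomial.coeff_pderiv, add_right_comm m (Finsupp.single i 1), Finsupp.add_apply]
  by_cases h : i = j
  · subst h; ring
  · simp [h, Ne.symm h]; ring

lemma mvPowerSeries_pderiv_comm {σ : Type*} (i j : σ) (f : MvPowerSeries σ R) :
    MvPowerSeries.pderiv R i (MvPowerSeries.pderiv R j f) =
      MvPowerSeries.pderiv R j (MvPowerSeries.pderiv R i f) := by
  classical
  ext m
  simp only [MvPowerSeries.coeff_pderiv, add_right_comm m (Finsupp.single i 1), Finsupp.add_apply]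
  by_cases h : i = j
  · subst h; ring
  · simp [h, Ne.symm h]; ring

variable (R r)

/-- The action on polynomials in `t` for which `y` is multiplication by `t` and `x` is `∂ / ∂ t`. -/
def polyRep : WeylAlgebra R r →ₐ[R] Module.End R (MvPolynomial (Fin r) R) :=
  rep (fun i => MvPolynomial.pderiv i) (fun i => MvPolynomial.X i) 0
    (fun _ _ _ => mvPolynomial_pderiv_comm _ _ _) (by simp)
    (fun i j => by by_cases h : i = j <;> simp [MvPolynomial.pderiv_X, h, Ne.symm])

/-- The action on polynomials in `t` and `ξ` for which `y` is multiplication by `t` and `x` is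
`∂ / ∂ t + ξ`. -/
def symbolRep : WeylAlgebra R r →ₐ[R] Module.End R (MvPolynomial (Fin r ⊕ Fin r) R) :=
  rep (fun i => MvPolynomial.pderiv (.inl i)) (fun i => MvPolynomial.X (.inl i))
    (fun i => MvPolynomial.X (.inr i))
    (fun _ _ _ => mvPolynomial_pderiv_comm _ _ _)
    (fun i j => by simp [MvPolynomial.pderiv_X])
    (fun i j => by by_cases h : i = j <;> simp [MvPolynomial.pderiv_X, h, Ne.symm])

/-- The action on power series in `t` for which `y` is multiplication by `t` and `x` is
`∂ / ∂ t`. -/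
def seriesRep : WeylAlgebra R r →ₐ[R] Module.End R (MvPowerSeries (Fin r) R) :=
  rep (fun i => MvPowerSeries.pderiv R i) (fun i => MvPowerSeries.X i) 0
    (fun _ _ _ => mvPowerSeries_pderiv_comm _ _ _) (by simp)
    (fun i j => by by_cases h : i = j <;> simp [h, Ne.symm])

/-- The action on power series in `t` and `ξ` for which `y` is multiplication by `t` and `x` is
`∂ / ∂ t + ξ`. -/
def seriesSymbolRep : WeylAlgebra R r →ₐ[R] Module.End R (MvPowerSeries (Fin r ⊕ Fin r) R) :=
  rep (fun i => MvPowerSeries.pderiv R (.inl i)) (fun i => MvPowerSeries.X (.inl i))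
    (fun i => MvPowerSeries.X (.inr i))
    (fun _ _ _ => mvPowerSeries_pderiv_comm _ _ _)
    (fun i j => by simp)
    (fun i j => by by_cases h : i = j <;> simp [h, Ne.symm])

variable {R r}

@[simp] lemma polyRep_x (i : Fin r) (f : MvPolynomial (Fin r) R) :
    polyRep R r (gen R r (.inl i)) f = MvPolynomial.pderiv i f := by
  simp [polyRep, rep]

@[simp] lemma polyRep_y (i : Fin r) (f : MvPolynomial (Fin r) R) :
    polyRep R r (gen R r (.inr i)) f = MvPolynomial.X i * f := by
  simp [polyRep, rep]

@[simp] lemma symbolRep_x (i : Fin r) (f : MvPolynomial (Fin r ⊕ Fin r) R) :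
    symbolRep R r (gen R r (.inl i)) f =
      MvPolynomial.pderiv (.inl i) f + MvPolynomial.X (.inr i) * f := by
  simp [symbolRep, rep]

@[simp] lemma symbolRep_y (i : Fin r) (f : MvPolynomial (Fin r ⊕ Fin r) R) :
    symbolRep R r (gen R r (.inr i)) f = MvPolynomial.X (.inl i) * f := by
  simp [symbolRep, rep]

@[simp] lemma seriesRep_x (i : Fin r) (f : MvPowerSeries (Fin r) R) :
    seriesRep R r (gen R r (.inl i)) f = MvPowerSeries.pderiv R i f := by
  simp [seriesRep, rep]

@[simp] lemma seriesRep_y (i : Fin r) (f : MvPowerSeries (Fin r) R) :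
    seriesRep R r (gen R r (.inr i)) f = MvPowerSeries.X i * f := by
  simp [seriesRep, rep]

@[simp] lemma seriesSymbolRep_x (i : Fin r) (f : MvPowerSeries (Fin r ⊕ Fin r) R) :
    seriesSymbolRep R r (gen R r (.inl i)) f =
      MvPowerSeries.pderiv R (.inl i) f + MvPowerSeries.X (.inr i) * f := by
  simp [seriesSymbolRep, rep]

@[simp] lemma seriesSymbolRep_y (i : Fin r) (f : MvPowerSeries (Fin r ⊕ Fin r) R) :
    seriesSymbolRep R r (gen R r (.inr i)) f = MvPowerSeries.X (.inl i) * f := by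
  simp [seriesSymbolRep, rep]

lemma seriesRep_coe (P : WeylAlgebra R r) (f : MvPolynomial (Fin r) R) :
    seriesRep R r P (f : MvPowerSeries (Fin r) R) = (polyRep R r P f : MvPolynomial (Fin r) R) :=
  (intertwine (polyRep R r) (seriesRep R r) (MvPolynomial.coeToMvPowerSeries.algHom R).toLinearMap
    (by rintro (i | i) m <;> simp [MvPowerSeries.pderiv_coe]) P f).symm

lemma seriesSymbolRep_coe (P : WeylAlgebra R r) (f : MvPolynomial (Fin r ⊕ Fin r) R) :
    seriesSymbolRep R r P (f : MvPowerSeries (Fin r ⊕ Fin r) R) =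
      (symbolRep R r P f : MvPolynomial (Fin r ⊕ Fin r) R) :=
  (intertwine (symbolRep R r) (seriesSymbolRep R r)
    (MvPolynomial.coeToMvPowerSeries.algHom R).toLinearMap
    (by rintro (i | i) m <;> simp [MvPowerSeries.pderiv_coe]) P f).symm

end WeylAlgebra

end WeylBasics

end AffinoidDixmier

/-! ### Normal ordering and symbols: a basis of the Weyl algebra. -/

namespace AffinoidDixmier

/-- Evaluation of a polynomial at pairwise commuting elements of an algebra. -/
def commAeval {R A ι : Type*} [CommRing R] [Ring A] [Algebra R A] (x : ι → A)
    (h : ∀ i j, x i * x j = x j * x i) : MvPolynomial ι R →ₐ[R] A :=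
  letI : CommRing (Algebra.adjoin R (Set.range x)) :=
    { (inferInstance : Ring (Algebra.adjoin R (Set.range x))) with
      mul_comm := (Algebra.isMulCommutative_adjoin R (s := Set.range x)
        (by rintro _ ⟨i, rfl⟩ _ ⟨j, rfl⟩; exact h i j)).is_comm.comm }
  (Algebra.adjoin R (Set.range x)).val.comp
    (MvPolynomial.aeval fun i => ⟨x i, Algebra.subset_adjoin ⟨i, rfl⟩⟩)

@[simp] lemma commAeval_X {R A ι : Type*} [CommRing R] [Ring A] [Algebra R A] (x : ι → A)
    (h : ∀ i j, x i * x j = x j * x i) (i : ι) :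
    commAeval (R := R) x h (MvPolynomial.X i) = x i := by
  let _ : CommRing (Algebra.adjoin R (Set.range x)) :=
    { (inferInstance : Ring (Algebra.adjoin R (Set.range x))) with
      mul_comm := (Algebra.isMulCommutative_adjoin R (s := Set.range x)
        (by rintro _ ⟨i, rfl⟩ _ ⟨j, rfl⟩; exact h i j)).is_comm.comm }
  exact congrArg Subtype.val (MvPolynomial.aeval_X (R := R)
    (fun i => (⟨x i, Algebra.subset_adjoin ⟨i, rfl⟩⟩ : Algebra.adjoin R (Set.range x))) i)

namespace WeylAlgebra

variable {R : Type*} [CommRing R] {r : ℕ}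

variable (R r) in
/-- Polynomials in the `x i`. -/
def polyX : MvPolynomial (Fin r) R →ₐ[R] WeylAlgebra R r :=
  commAeval (fun i => gen R r (.inl i)) gen_xx

variable (R r) in
/-- Polynomials in the `y i`. -/
def polyY : MvPolynomial (Fin r) R →ₐ[R] WeylAlgebra R r :=
  commAeval (fun i => gen R r (.inr i)) gen_yy

@[simp] lemma polyX_X (i : Fin r) : polyX R r (MvPolynomial.X i) = gen R r (.inl i) :=
  commAeval_X _ _ _

@[simp] lemma polyY_X (i : Fin r) : polyY R r (MvPolynomial.X i) = gen R r (.inr i) :=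
  commAeval_X _ _ _

/-- The defining relation says that `[xᵢ, ·]` is the derivation `∂/∂tᵢ` on polynomials in `y`. This
is the rule for moving `x` to the right when an operator is put in normal order. -/
lemma x_mul_polyY (i : Fin r) (f : MvPolynomial (Fin r) R) :
    gen R r (.inl i) * polyY R r f =
      polyY R r f * gen R r (.inl i) + polyY R r (MvPolynomial.pderiv i f) := by
  induction f using MvPolynomial.induction_on with
  | C a =>
    rw [MvPolynomial.pderiv_C, map_zero, add_zero, ← MvPolynomial.algebraMap_eq, AlgHom.commutes]
    exact (Algebra.commutes _ _).symm
  | add f g hf hg =>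
    simp only [map_add, mul_add, add_mul, hf, hg]
    abel
  | mul_X f j hf =>
    rw [map_mul, polyY_X, ← mul_assoc, hf, add_mul, mul_assoc, gen_xy, MvPolynomial.pderiv_mul,
      map_add, map_mul, map_mul, polyY_X, mul_add, MvPolynomial.pderiv_X]
    by_cases h : i = j
    · subst h; simp [mul_assoc]; abel
    · simp [h, Ne.symm h, mul_assoc]

variable (R r) in
/-- The normally ordered operator with a given symbol. -/
def normalOrder : MvPolynomial (Fin r ⊕ Fin r) R →ₗ[R] WeylAlgebra R r :=
  (MvPolynomial.basisMonomials (Fin r ⊕ Fin r) R).constr R fun m =>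
    polyY R r (MvPolynomial.monomial (m.comapDomain Sum.inl Sum.inl_injective.injOn) 1) *
      polyX R r (MvPolynomial.monomial (m.comapDomain Sum.inr Sum.inr_injective.injOn) 1)

lemma normalOrder_monomial (m : Fin r ⊕ Fin r →₀ ℕ) :
    normalOrder R r (MvPolynomial.monomial m 1) =
    polyY R r (MvPolynomial.monomial (m.comapDomain Sum.inl Sum.inl_injective.injOn) 1) *
      polyX R r (MvPolynomial.monomial (m.comapDomain Sum.inr Sum.inr_injective.injOn) 1) := by
  have := (MvPolynomial.basisMonomials (Fin r ⊕ Fin r) R).constr_basis R (fun m =>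
    polyY R r (MvPolynomial.monomial (m.comapDomain Sum.inl Sum.inl_injective.injOn) 1) *
      polyX R r (MvPolynomial.monomial (m.comapDomain Sum.inr Sum.inr_injective.injOn) 1)) m
  rwa [MvPolynomial.coe_basisMonomials] at this

lemma normalOrder_rename_mul (f g : MvPolynomial (Fin r) R) :
    normalOrder R r (MvPolynomial.rename Sum.inl f * MvPolynomial.rename Sum.inr g) =
      polyY R r f * polyX R r g := by
  have hsmul : ∀ (m : Fin r →₀ ℕ) (a : R), (MvPolynomial.monomial m a : MvPolynomial _ R) =
      a • MvPolynomial.monomial m 1 := fun m a => by simp [MvPolynomial.smul_monomial]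
  induction f using MvPolynomial.induction_on' with
  | add p q hp hq => simp only [map_add, add_mul, hp, hq]
  | monomial m a =>
    induction g using MvPolynomial.induction_on' with
    | add p q hp hq => simp only [map_add, mul_add, hp, hq]
    | monomial n b =>
      rw [hsmul m, hsmul n]
      simp only [map_smul, smul_mul_assoc, mul_smul_comm]
      congr 2
      rw [MvPolynomial.rename_monomial, MvPolynomial.rename_monomial, MvPolynomial.monomial_mul,
        mul_one, normalOrder_monomial]
      congr 3 <;> congr 1 <;> refine Finsupp.ext fun i => ?_
      · rw [Finsupp.comapDomain_apply, Finsupp.add_apply,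
          Finsupp.mapDomain_apply Sum.inl_injective,
          Finsupp.mapDomain_of_notMem_range _ _ (by simp), add_zero]
      · rw [Finsupp.comapDomain_apply, Finsupp.add_apply,
          Finsupp.mapDomain_apply Sum.inr_injective,
          Finsupp.mapDomain_of_notMem_range _ _ (by simp), zero_add]

/-- The image contains `1` and is stable under left multiplication by the generators: a `y` is
absorbed on the left, and an `x` is moved past the `y`'s at the cost of a derivative. -/
lemma normalOrder_surjective : Function.Surjective (normalOrder R r) := by
  rw [← LinearMap.range_eq_top, eq_top_iff]
  have key : ∀ P : WeylAlgebra R r, ∀ Q ∈ LinearMap.range (normalOrder R r),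
      P * Q ∈ LinearMap.range (normalOrder R r) := by
    have hspan : ∀ f g, polyY R r f * polyX R r g ∈ LinearMap.range (normalOrder R r) :=
      fun f g => ⟨_, normalOrder_rename_mul f g⟩
    intro P
    induction P using WeylAlgebra.induction with
    | hgen s =>
      rintro _ ⟨q, rfl⟩
      induction q using MvPolynomial.induction_on' with
      | add p q hp hq => rw [map_add, mul_add]; exact add_mem hp hq
      | monomial m a =>
        have : MvPolynomial.monomial m a = a • (MvPolynomial.monomial m 1 : MvPolynomial _ R) := by
          simp [MvPolynomial.smul_monomial]
        rw [this, map_smul, mul_smul_comm, normalOrder_monomial]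
        refine Submodule.smul_mem _ _ ?_
        rcases s with i | i
        · rw [← mul_assoc, x_mul_polyY, add_mul, mul_assoc, ← polyX_X, ← map_mul]
          exact add_mem (hspan _ _) (hspan _ _)
        · rw [← mul_assoc, ← polyY_X, ← map_mul]
          exact hspan _ _
    | halg a =>
      intro Q hQ
      rw [← Algebra.smul_def]
      exact Submodule.smul_mem _ _ hQ
    | hadd P Q hP hQ => intro S hS; rw [add_mul]; exact add_mem (hP _ hS) (hQ _ hS)
    | hmul P Q hP hQ => intro S hS; rw [mul_assoc]; exact hP _ (hQ _ hS)
  intro P _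
  have h1 : (1 : WeylAlgebra R r) ∈ LinearMap.range (normalOrder R r) :=
    ⟨1, by simpa using normalOrder_rename_mul (R := R) (r := r) 1 1⟩
  simpa using key P 1 h1

variable (R r) in
/-- The symbol of a differential operator. -/
def symbol : WeylAlgebra R r →ₗ[R] MvPolynomial (Fin r ⊕ Fin r) R :=
  LinearMap.applyₗ (1 : MvPolynomial (Fin r ⊕ Fin r) R) ∘ₗ (symbolRep R r).toLinearMap

lemma symbol_apply (P : WeylAlgebra R r) : symbol R r P = symbolRep R r P 1 := rfl

lemma symbolRep_polyY (f : MvPolynomial (Fin r) R) (g : MvPolynomial (Fin r ⊕ Fin r) R) :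
    symbolRep R r (polyY R r f) g = MvPolynomial.rename Sum.inl f * g := by
  induction f using MvPolynomial.induction_on generalizing g with
  | C a =>
    rw [← MvPolynomial.algebraMap_eq, AlgHom.commutes, AlgHom.commutes, AlgHom.commutes,
      Module.algebraMap_end_apply, Algebra.smul_def]
  | add f h hf hh => simp [hf, hh, add_mul]
  | mul_X f i hf => simp [hf, mul_assoc]

lemma symbolRep_polyX_rename (f g : MvPolynomial (Fin r) R) :
    symbolRep R r (polyX R r f) (MvPolynomial.rename Sum.inr g) =
      MvPolynomial.rename Sum.inr (f * g) := by
  induction f using MvPolynomial.induction_on generalizing g with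
  | C a =>
    rw [← MvPolynomial.algebraMap_eq, AlgHom.commutes, AlgHom.commutes,
      Module.algebraMap_end_apply, ← Algebra.smul_def, map_smul]
  | add f h hf hh => simp [hf, hh, add_mul]
  | mul_X f i hf =>
    have h0 : MvPolynomial.pderiv (R := R) (Sum.inl i : Fin r ⊕ Fin r)
        (MvPolynomial.rename Sum.inr g) = 0 := by
      apply MvPolynomial.pderiv_eq_zero_of_notMem_vars
      classical
      intro h
      have := MvPolynomial.vars_rename Sum.inr g h
      simp at this
    have : MvPolynomial.X (R := R) (Sum.inr i : Fin r ⊕ Fin r) * MvPolynomial.rename Sum.inr g =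
        MvPolynomial.rename Sum.inr (MvPolynomial.X i * g) := by simp
    rw [map_mul, map_mul, Module.End.mul_apply, polyX_X, symbolRep_x, h0, zero_add, this, hf,
      mul_assoc]

/-- Applied to `1`, the factor in `x` only ever meets polynomials in `ξ`, which `∂/∂t` kills, so it
multiplies by `ξ`; the factor in `y` then multiplies by `t`. With surjectivity this makes normally
ordered monomials a basis. -/
lemma symbol_normalOrder (q : MvPolynomial (Fin r ⊕ Fin r) R) :
    symbol R r (normalOrder R r q) = q := by
  suffices symbol R r ∘ₗ normalOrder R r = LinearMap.id from LinearMap.congr_fun this q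
  refine (MvPolynomial.basisMonomials _ R).ext fun m => ?_
  have h1 : (1 : MvPolynomial (Fin r ⊕ Fin r) R) = MvPolynomial.rename Sum.inr 1 := by simp
  rw [MvPolynomial.coe_basisMonomials, LinearMap.comp_apply, LinearMap.id_apply,
    normalOrder_monomial, symbol_apply, map_mul, Module.End.mul_apply, h1, symbolRep_polyX_rename,
    symbolRep_polyY, mul_one, MvPolynomial.rename_monomial, MvPolynomial.rename_monomial,
    MvPolynomial.monomial_mul, mul_one]
  congr 1
  refine congrArg _ (Finsupp.ext fun s => ?_)
  rcases s with i | i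
  · rw [Finsupp.add_apply, Finsupp.mapDomain_apply Sum.inl_injective,
      Finsupp.mapDomain_of_notMem_range _ _ (by simp)]
    simp
  · rw [Finsupp.add_apply, Finsupp.mapDomain_apply Sum.inr_injective,
      Finsupp.mapDomain_of_notMem_range _ _ (by simp)]
    simp

lemma normalOrder_symbol (P : WeylAlgebra R r) : normalOrder R r (symbol R r P) = P := by
  obtain ⟨q, rfl⟩ := normalOrder_surjective P
  rw [symbol_normalOrder]

lemma symbol_injective : Function.Injective (symbol R r) :=
  Function.LeftInverse.injective normalOrder_symbol

/-! ### Leading symbols: over a domain the Weyl algebra has no zero divisors. -/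

section Domain

/-- The polynomials of total degree less than `n`. -/
def lowDegree (σ : Type*) (R : Type*) [CommRing R] (n : ℕ) : Submodule R (MvPolynomial σ R) where
  carrier := {f | ∀ m, f.coeff m ≠ 0 → m.degree < n}
  zero_mem' := by simp
  add_mem' {f g} hf hg m hm := by
    by_cases h : f.coeff m = 0
    · exact hg m (by simpa [h] using hm)
    · exact hf m h
  smul_mem' a f hf m hm := hf m (by
    intro h
    simp [h] at hm)

variable {σ : Type*}

lemma lowDegree_mono {m n : ℕ} (h : m ≤ n) : lowDegree σ R m ≤ lowDegree σ R n :=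
  fun _ hf _ hs => (hf _ hs).trans_le h

lemma X_mul_mem_lowDegree {n : ℕ} {f : MvPolynomial σ R} (hf : f ∈ lowDegree σ R n) (i : σ) :
    MvPolynomial.X i * f ∈ lowDegree σ R (n + 1) := by
  classical
  intro m hm
  rw [MvPolynomial.coeff_X_mul'] at hm
  split_ifs at hm with hi
  · have := hf _ hm
    have h2 : m - Finsupp.single i 1 + Finsupp.single i 1 = m :=
      Finsupp.sub_add_single_one_cancel (Finsupp.mem_support_iff.1 hi)
    have h3 := congrArg Finsupp.degree h2
    rw [map_add, Finsupp.degree_single] at h3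
    omega
  · exact absurd rfl hm

lemma pderiv_mem_lowDegree {n : ℕ} {f : MvPolynomial σ R} (hf : f ∈ lowDegree σ R (n + 1)) (i : σ) :
    MvPolynomial.pderiv i f ∈ lowDegree σ R n := by
  intro m hm
  rw [MvPolynomial.coeff_pderiv] at hm
  have := hf _ (left_ne_zero_of_mul hm)
  rw [map_add, Finsupp.degree_single] at this
  omega

lemma mul_mem_lowDegree {m n : ℕ} {f g : MvPolynomial σ R} (hf : f ∈ lowDegree σ R (m + 1))
    (hg : g ∈ lowDegree σ R (n + 1)) : f * g ∈ lowDegree σ R (m + n + 1) := by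
  classical
  intro s hs
  rw [MvPolynomial.coeff_mul] at hs
  obtain ⟨⟨a, b⟩, hab, hne⟩ := Finset.exists_ne_zero_of_sum_ne_zero hs
  have h1 := hf a (left_ne_zero_of_mul hne)
  have h2 := hg b (right_ne_zero_of_mul hne)
  rw [Finset.HasAntidiagonal.mem_antidiagonal] at hab
  simp only at hab
  rw [← hab, map_add]
  omega

lemma mem_lowDegree_totalDegree (f : MvPolynomial σ R) :
    f ∈ lowDegree σ R (f.totalDegree + 1) := by
  intro m hm
  have := MvPolynomial.le_totalDegree (MvPolynomial.mem_support_iff.2 hm)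
  exact Nat.lt_succ_of_le this

variable (R r) in
/-- The operators whose symbol has degree at most `n` and which act on polynomials as
multiplication by the symbol up to terms of lower degree. -/
def leadingSymbol (n : ℕ) : Submodule R (WeylAlgebra R r) where
  carrier := {P | symbol R r P ∈ lowDegree _ R (n + 1) ∧ ∀ d, ∀ f ∈ lowDegree _ R (d + 1),
    symbolRep R r P f - symbol R r P * f ∈ lowDegree _ R (n + d)}
  zero_mem' := by simp
  add_mem' {P Q} hP hQ := by
    refine ⟨by rw [map_add]; exact add_mem hP.1 hQ.1, fun d f hf => ?_⟩
    have : symbolRep R r (P + Q) f - symbol R r (P + Q) * f = (symbolRep R r P f -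
        symbol R r P * f) + (symbolRep R r Q f - symbol R r Q * f) := by
      simp only [map_add, LinearMap.add_apply]; ring
    rw [this]
    exact add_mem (hP.2 d f hf) (hQ.2 d f hf)
  smul_mem' a P hP := by
    refine ⟨by rw [map_smul]; exact Submodule.smul_mem _ _ hP.1, fun d f hf => ?_⟩
    rw [map_smul, map_smul, LinearMap.smul_apply, smul_mul_assoc, ← smul_sub]
    exact Submodule.smul_mem _ _ (hP.2 d f hf)

lemma leadingSymbol_le_succ (n : ℕ) : leadingSymbol R r n ≤ leadingSymbol R r (n + 1) :=
  fun _ hP => ⟨lowDegree_mono (by omega) hP.1,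
    fun d f hf => lowDegree_mono (by omega) (hP.2 d f hf)⟩

lemma symbol_mul (P Q : WeylAlgebra R r) : symbol R r (P * Q) = symbolRep R r P (symbol R r Q) := by
  simp [symbol_apply]

/-- The generator `y` acts exactly as multiplication by `t`. The generator `x` acts as
multiplication by `ξ` up to `∂/∂t`, which lowers the degree, so the error stays one degree below the
product. -/
lemma gen_mul_mem_leadingSymbol {n : ℕ} {P : WeylAlgebra R r} (hP : P ∈ leadingSymbol R r n)
    (s : Fin r ⊕ Fin r) : gen R r s * P ∈ leadingSymbol R r (n + 1) := by
  rcases s with i | i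
  · refine ⟨?_, fun d f hf => ?_⟩
    · rw [symbol_mul, symbolRep_x]
      exact add_mem (lowDegree_mono (by omega) (pderiv_mem_lowDegree hP.1 _))
        (X_mul_mem_lowDegree hP.1 _)
    · have h0 := hP.2 d f hf
      have h1 : symbolRep R r P f ∈ lowDegree _ R (n + d + 1) := by
        have := add_mem (lowDegree_mono (Nat.le_succ _) h0) (mul_mem_lowDegree hP.1 hf)
        simpa using this
      have h2 := mul_mem_lowDegree (lowDegree_mono (Nat.le_succ _) (pderiv_mem_lowDegree hP.1
        (Sum.inl i))) hf
      have : symbolRep R r (gen R r (.inl i) * P) f - symbol R r (gen R r (.inl i) * P) * f =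
          MvPolynomial.X (.inr i) * (symbolRep R r P f - symbol R r P * f) +
            (MvPolynomial.pderiv (.inl i) (symbolRep R r P f) -
            MvPolynomial.pderiv (.inl i) (symbol R r P) * f) := by
        rw [symbol_mul, map_mul, Module.End.mul_apply, symbolRep_x, symbolRep_x]
        ring
      rw [this]
      refine add_mem (lowDegree_mono (by omega) (X_mul_mem_lowDegree h0 _))
        (sub_mem (lowDegree_mono (by omega) (pderiv_mem_lowDegree h1 _))
          (lowDegree_mono (by omega) h2))
  · refine ⟨?_, fun d f hf => ?_⟩
    · rw [symbol_mul, symbolRep_y]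
      exact X_mul_mem_lowDegree hP.1 _
    · have : symbolRep R r (gen R r (.inr i) * P) f - symbol R r (gen R r (.inr i) * P) * f =
          MvPolynomial.X (.inl i) * (symbolRep R r P f - symbol R r P * f) := by
        rw [symbol_mul, map_mul, Module.End.mul_apply, symbolRep_y, symbolRep_y]
        ring
      rw [this]
      exact lowDegree_mono (by omega) (X_mul_mem_lowDegree (hP.2 d f hf) _)

/-- Induction on the degree, one variable of a monomial at a time. Multiplying the operator of the
smaller monomial by the matching generator gives the right symbol up to terms of smaller degree,
which the induction hypothesis covers. -/
lemma mem_leadingSymbol (n : ℕ) : ∀ q ∈ lowDegree _ R (n + 1),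
    normalOrder R r q ∈ leadingSymbol R r n := by
  have hred : ∀ n, (∀ m : Fin r ⊕ Fin r →₀ ℕ, m.degree ≤ n →
      normalOrder R r (MvPolynomial.monomial m 1) ∈ leadingSymbol R r n) →
      ∀ q ∈ lowDegree _ R (n + 1), normalOrder R r q ∈ leadingSymbol R r n := by
    intro n h q hq
    rw [q.as_sum, map_sum]
    refine Submodule.sum_mem _ fun m hm => ?_
    have : MvPolynomial.monomial m (q.coeff m) = q.coeff m • MvPolynomial.monomial m 1 := by
      simp [MvPolynomial.smul_monomial]
    rw [this, map_smul]
    exact Submodule.smul_mem _ _ (h m (Nat.lt_succ_iff.1 (hq m (MvPolynomial.mem_support_iff.1 hm))))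
  have hone : normalOrder R r 1 = 1 := symbol_injective (by
    rw [symbol_normalOrder, symbol_apply, map_one (symbolRep R r), Module.End.one_apply])
  induction n with
  | zero =>
    refine hred 0 fun m hm => ?_
    obtain rfl : m = 0 := (Finsupp.degree_eq_zero_iff m).1 (Nat.le_zero.1 hm)
    rw [← MvPolynomial.C_apply, map_one, hone]
    refine ⟨?_, fun d f hf => ?_⟩
    · rw [symbol_apply, map_one (symbolRep R r), Module.End.one_apply]
      have := mem_lowDegree_totalDegree (1 : MvPolynomial (Fin r ⊕ Fin r) R)
      rwa [MvPolynomial.totalDegree_one] at this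
    · simp [symbol_apply]
  | succ n ih =>
    refine hred (n + 1) fun m hm => ?_
    by_cases h0 : m = 0
    · refine leadingSymbol_le_succ n (ih _ ?_)
      subst h0
      rw [← MvPolynomial.C_apply, map_one]
      exact lowDegree_mono (Nat.le_add_left 1 n) (by
        simpa using mem_lowDegree_totalDegree (1 : MvPolynomial (Fin r ⊕ Fin r) R))
    obtain ⟨s, hs⟩ := Finsupp.ne_iff.1 h0
    obtain ⟨m, rfl⟩ : ∃ m', m = m' + Finsupp.single s 1 :=
      ⟨_, (Finsupp.sub_add_single_one_cancel hs).symm⟩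
    rw [map_add, Finsupp.degree_single] at hm
    have hmem : (MvPolynomial.monomial m 1 : MvPolynomial _ R) ∈ lowDegree _ R (n + 1) := by
      classical
      intro k hk
      rw [MvPolynomial.coeff_monomial] at hk
      split_ifs at hk with h
      · subst h; omega
      · exact absurd rfl hk
    have hX : (MvPolynomial.monomial (m + Finsupp.single s 1) 1 : MvPolynomial _ R) =
        MvPolynomial.X s * MvPolynomial.monomial m 1 := by
      rw [add_comm, MvPolynomial.X, MvPolynomial.monomial_mul, one_mul]
    -- The swap matches symbol variables with generators: `t = inl` is the symbol of `y = inr`, and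
    -- `ξ = inr` that of `x = inl`.
    have h1 := gen_mul_mem_leadingSymbol (ih _ hmem) s.swap
    have h2 : normalOrder R r (MvPolynomial.monomial (m + Finsupp.single s 1) 1) =
        gen R r s.swap * normalOrder R r (MvPolynomial.monomial m 1) -
        normalOrder R r (symbol R r (gen R r s.swap * normalOrder R r (MvPolynomial.monomial m 1)) -
          MvPolynomial.monomial (m + Finsupp.single s 1) 1) := by
      rw [map_sub, normalOrder_symbol, sub_sub_cancel]
    rw [h2]
    refine sub_mem h1 (leadingSymbol_le_succ n (ih _ ?_))
    rw [symbol_mul, symbol_normalOrder, hX]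
    rcases s with i | i
    · simp
    · rw [Sum.swap_inr, symbolRep_x, add_sub_cancel_right]
      exact lowDegree_mono (Nat.le_succ n) (pderiv_mem_lowDegree hmem _)

/-- The symbol of `P * Q` agrees with the product of the symbols up to terms below the total degree
of that product. If `P * Q = 0`, the product of two nonzero polynomials would have degree below its
own total degree. -/
theorem noZeroDivisors [IsDomain R] : NoZeroDivisors (WeylAlgebra R r) := by
  refine ⟨fun {P Q} h => ?_⟩
  by_contra! hne
  have hP : symbol R r P ≠ 0 := fun h0 => hne.1 (symbol_injective (by rw [h0, map_zero]))
  have hQ : symbol R r Q ≠ 0 := fun h0 => hne.2 (symbol_injective (by rw [h0, map_zero]))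
  have h1 := mem_leadingSymbol _ _ (mem_lowDegree_totalDegree (symbol R r P))
  rw [normalOrder_symbol] at h1
  have h2 := h1.2 _ _ (mem_lowDegree_totalDegree (symbol R r Q))
  rw [← symbol_mul, h, map_zero, zero_sub, Submodule.neg_mem_iff,
    ← MvPolynomial.totalDegree_mul_of_isDomain hP hQ] at h2
  obtain ⟨m, hm, hm'⟩ := Finset.exists_mem_eq_sup _
    (MvPolynomial.support_nonempty.2 (mul_ne_zero hP hQ)) fun m => m.sum fun _ e => e
  exact (h2 m (MvPolynomial.mem_support_iff.1 hm)).ne hm'.symm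

end Domain

end WeylAlgebra
end AffinoidDixmier

namespace AffinoidDixmier
namespace WeylAlgebra

/-! ### Change of coefficients and reduction modulo a prime. -/

section BaseChange

variable (R S : Type*) [CommRing R] [CommRing S] [Algebra R S] (r : ℕ)

/-- Extension of scalars for Weyl algebras. -/
def baseChange : WeylAlgebra R r →ₐ[R] WeylAlgebra S r :=
  lift (fun i => gen S r (.inl i)) (fun i => gen S r (.inr i)) gen_xx gen_yy gen_xy

variable {R r}

@[simp] lemma baseChange_gen (s : Fin r ⊕ Fin r) : baseChange R S r (gen R r s) = gen S r s := by
  rcases s with i | i <;> simp [baseChange]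

lemma symbolRep_baseChange (P : WeylAlgebra R r) (f : MvPolynomial (Fin r ⊕ Fin r) R) :
    symbolRep S r (baseChange R S r P) (MvPolynomial.map (algebraMap R S) f) =
      MvPolynomial.map (algebraMap R S) (symbolRep R r P f) := by
  induction P using WeylAlgebra.induction generalizing f with
  | hgen s => rcases s with i | i <;> simp [MvPolynomial.pderiv_map]
  | halg a =>
    rw [AlgHom.commutes, AlgHom.commutes, IsScalarTower.algebraMap_apply R S (WeylAlgebra S r),
      AlgHom.commutes, Module.algebraMap_end_apply, Module.algebraMap_end_apply,
      MvPolynomial.smul_eq_C_mul, MvPolynomial.smul_eq_C_mul, map_mul, MvPolynomial.map_C]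
  | hadd P Q hP hQ => simp [hP, hQ]
  | hmul P Q hP hQ => simp [hP, hQ]

lemma symbol_baseChange (P : WeylAlgebra R r) :
    symbol S r (baseChange R S r P) = MvPolynomial.map (algebraMap R S) (symbol R r P) := by
  rw [symbol_apply, symbol_apply, ← symbolRep_baseChange, map_one (MvPolynomial.map _)]

lemma baseChange_injective (h : Function.Injective (algebraMap R S)) :
    Function.Injective (baseChange R S r) := fun P Q hPQ =>
  symbol_injective (MvPolynomial.map_injective _ h (by
    rw [← symbol_baseChange, ← symbol_baseChange, hPQ]))

lemma range_baseChange :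
    (baseChange R S r).range = Algebra.adjoin R (Set.range (gen S r)) := by
  apply le_antisymm
  · rintro _ ⟨P, rfl⟩
    change baseChange R S r P ∈ _
    induction P using WeylAlgebra.induction with
    | hgen s => exact Algebra.subset_adjoin ⟨s, (baseChange_gen S s).symm⟩
    | halg a => rw [AlgHom.commutes]; exact Subalgebra.algebraMap_mem _ a
    | hadd P Q hP hQ => rw [map_add]; exact add_mem hP hQ
    | hmul P Q hP hQ => rw [map_mul]; exact mul_mem hP hQ
  · rw [Algebra.adjoin_le_iff]
    rintro _ ⟨s, rfl⟩
    exact ⟨_, baseChange_gen S s⟩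

/-- The Weyl algebra over a valuation ring is the lattice in the Weyl algebra over the field. -/
def equivWeylLattice {K : Type*} [Field K] (O : ValuationSubring K) (r : ℕ) :
    WeylAlgebra O r ≃ₐ[O] weylLattice O r :=
  (AlgEquiv.ofInjective (baseChange O K r) (baseChange_injective K Subtype.val_injective)).trans
    (Subalgebra.equivOfEq _ _ (range_baseChange K))

lemma exists_eq_smul_of_symbol {π : R} {P : WeylAlgebra R r} {q : MvPolynomial (Fin r ⊕ Fin r) R}
    (h : symbol R r P = π • q) : ∃ Q, P = π • Q :=
  ⟨normalOrder R r q, by rw [← map_smul, ← h, normalOrder_symbol]⟩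

/-- A prime of `R` remains prime in the Weyl algebra. -/
lemma prime_smul {π : R} (hπ : (Ideal.span {π}).IsPrime) {P Q S : WeylAlgebra R r}
    (h : P * Q = π • S) : (∃ P', P = π • P') ∨ ∃ Q', Q = π • Q' := by
  have hker : ∀ a : R, algebraMap R (R ⧸ Ideal.span {π}) a = 0 ↔ π ∣ a := fun a => by
    rw [Ideal.Quotient.algebraMap_eq, Ideal.Quotient.eq_zero_iff_mem, Ideal.mem_span_singleton]
  -- The kernel of reduction modulo `π` is read off on symbols: all coefficients are divisible by
  -- `π`, and normal ordering the quotient symbol divides the operator.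
  have hz : ∀ P : WeylAlgebra R r, baseChange R (R ⧸ Ideal.span {π}) r P = 0 → ∃ P', P = π • P' := by
    intro P hP
    have := symbol_baseChange (R ⧸ Ideal.span {π}) P
    rw [hP, map_zero, eq_comm, ← MvPolynomial.C_dvd_iff_map_hom_eq_zero _ _ hker] at this
    obtain ⟨q, hq⟩ := this
    exact exists_eq_smul_of_symbol (hq.trans (MvPolynomial.smul_eq_C_mul _ _).symm)
  have := noZeroDivisors (R := R ⧸ Ideal.span {π}) (r := r)
  have h0 := congrArg (baseChange R (R ⧸ Ideal.span {π}) r) h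
  rw [map_mul, map_smul, ← algebraMap_smul (R ⧸ Ideal.span {π}) π, (hker π).2 dvd_rfl,
    zero_smul] at h0
  exact (mul_eq_zero.1 h0).imp (hz P) (hz Q)

end BaseChange

end WeylAlgebra
end AffinoidDixmier

namespace AffinoidDixmier

attribute [local instance 100] LieRing.ofAssociativeRing

/-! ### Generation of enveloping algebras. -/

section Enveloping

variable {O : Type*} [CommRing O] {L : Type*} [LieRing L] [LieAlgebra O L]

/-- The elements with the property form a subalgebra containing `L`; the universal property factors
the identity of `U(L)` through it. -/
lemma envelope_induction {motive : UniversalEnvelopingAlgebra O L → Prop}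
    (hι : ∀ x, motive (UniversalEnvelopingAlgebra.ι O x))
    (halg : ∀ a : O, motive (algebraMap O _ a))
    (hadd : ∀ u v, motive u → motive v → motive (u + v))
    (hmul : ∀ u v, motive u → motive v → motive (u * v))
    (u : UniversalEnvelopingAlgebra O L) : motive u := by
  let S : Subalgebra O (UniversalEnvelopingAlgebra O L) :=
    { carrier := {u | motive u}
      mul_mem' := fun ha hb => hmul _ _ ha hb
      add_mem' := fun ha hb => hadd _ _ ha hb
      algebraMap_mem' := halg }
  let j : L →ₗ⁅O⁆ S :=
    { toFun := fun x => ⟨UniversalEnvelopingAlgebra.ι O x, hι x⟩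
      map_add' := fun x y => Subtype.ext (map_add _ _ _)
      map_smul' := fun a x => Subtype.ext (map_smul _ _ _)
      map_lie' := fun {x y} => Subtype.ext (LieHom.map_lie _ _ _) }
  have h : S.val.comp (UniversalEnvelopingAlgebra.lift O j) = AlgHom.id O _ := by
    apply UniversalEnvelopingAlgebra.hom_ext
    ext x
    simp only [LieHom.coe_comp, Function.comp_apply, AlgHom.coe_toLieHom, AlgHom.comp_apply,
      UniversalEnvelopingAlgebra.lift_ι_apply, AlgHom.id_apply]
    rfl
  have h2 := DFunLike.congr_fun h u
  rw [AlgHom.id_apply, AlgHom.comp_apply] at h2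
  rw [← h2]
  exact (UniversalEnvelopingAlgebra.lift O j u).2

lemma envelope_submodule_eq_top (N : Submodule O (UniversalEnvelopingAlgebra O L)) (h1 : 1 ∈ N)
    (hι : ∀ x, ∀ u ∈ N, UniversalEnvelopingAlgebra.ι O x * u ∈ N) (u) : u ∈ N := by
  have key : ∀ v ∈ N, u * v ∈ N := by
    induction u using envelope_induction with
    | hι x => exact hι x
    | halg a => intro v hv; rw [← Algebra.smul_def]; exact N.smul_mem a hv
    | hadd u v hu hv => intro w hw; rw [add_mul]; exact add_mem (hu w hw) (hv w hw)
    | hmul u v hu hv => intro w hw; rw [mul_assoc]; exact hu _ (hv w hw)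
  simpa using key 1 h1

@[simp] lemma envelopeIncl_ι (M : LieSubalgebra O L) (x : M) :
    envelopeIncl M (UniversalEnvelopingAlgebra.ι O x) = UniversalEnvelopingAlgebra.ι O (x : L) := by
  simp only [envelopeIncl, UniversalEnvelopingAlgebra.lift_ι_apply, LieHom.comp_apply]
  rfl

lemma ι_lie (x y : L) : UniversalEnvelopingAlgebra.ι O ⁅x, y⁆ =
    UniversalEnvelopingAlgebra.ι O x * UniversalEnvelopingAlgebra.ι O y -
      UniversalEnvelopingAlgebra.ι O y * UniversalEnvelopingAlgebra.ι O x := by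
  rw [LieHom.map_lie, LieRing.of_associative_ring_bracket]

variable (M : LieSubalgebra O L) (e : L)

/-- The map `(uₐ)ₐ ↦ ∑ eᵃ uₐ`. -/
def powSum : (ℕ →₀ UniversalEnvelopingAlgebra O M) →ₗ[O] UniversalEnvelopingAlgebra O L :=
  Finsupp.lsum O fun a =>
    LinearMap.mulLeft O (UniversalEnvelopingAlgebra.ι O e ^ a) ∘ₗ (envelopeIncl M).toLinearMap

lemma powSum_single (a : ℕ) (u) : powSum M e (Finsupp.single a u) =
    UniversalEnvelopingAlgebra.ι O e ^ a * envelopeIncl M u := by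
  simp [powSum]

/-- The spanning half of a Poincaré–Birkhoff–Witt statement: powers of `e` collect on the left by `x
e = e x + [x, e]`, where `[x, e]` is again in `M`. Independence is not needed, since it is tested
later on polynomials. -/
lemma powSum_surjective (hM : ∀ x ∈ M, ⁅x, e⁆ ∈ M) (hspan : ∀ x, ∃ a : O, x - a • e ∈ M) :
    Function.Surjective (powSum M e) := by
  intro u
  have he : ∀ v ∈ LinearMap.range (powSum M e),
      UniversalEnvelopingAlgebra.ι O e * v ∈ LinearMap.range (powSum M e) := by
    rintro _ ⟨v, rfl⟩
    induction v using Finsupp.induction_linear with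
    | zero => simp
    | add f g hf hg => rw [map_add, mul_add]; exact add_mem hf hg
    | single a u => exact ⟨Finsupp.single (a + 1) u, by
        rw [powSum_single, powSum_single, pow_succ', mul_assoc]⟩
  have hm : ∀ (a : ℕ) (u) (x : M), UniversalEnvelopingAlgebra.ι O (x : L) *
      (UniversalEnvelopingAlgebra.ι O e ^ a * envelopeIncl M u) ∈ LinearMap.range (powSum M e) := by
    intro a u
    induction a with
    | zero =>
      intro x
      refine ⟨Finsupp.single 0 (UniversalEnvelopingAlgebra.ι O x * u), ?_⟩
      rw [powSum_single, map_mul, envelopeIncl_ι, pow_zero, one_mul, one_mul]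
    | succ a ih =>
      intro x
      have h1 := ih ⟨⁅(x : L), e⁆, hM x x.2⟩
      rw [ι_lie, sub_mul] at h1
      have := add_mem h1 (he _ (ih x))
      rw [pow_succ', mul_assoc, ← mul_assoc]
      rwa [mul_assoc (UniversalEnvelopingAlgebra.ι O e), sub_add_cancel] at this
  refine envelope_submodule_eq_top (LinearMap.range (powSum M e)) ⟨Finsupp.single 0 1, by
    rw [powSum_single]; simp⟩ ?_ u
  rintro x _ ⟨v, rfl⟩
  obtain ⟨a, ha⟩ := hspan x
  have hx : UniversalEnvelopingAlgebra.ι O x = a • UniversalEnvelopingAlgebra.ι O e +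
      UniversalEnvelopingAlgebra.ι O (((⟨_, ha⟩ : M) : L)) := by
    rw [← map_smul, ← map_add]; simp
  rw [hx, add_mul, smul_mul_assoc]
  refine add_mem (Submodule.smul_mem _ _ (he _ ⟨v, rfl⟩)) ?_
  induction v using Finsupp.induction_linear with
  | zero => simp
  | add f g hf hg => rw [map_add, mul_add]; exact add_mem hf hg
  | single b u => rw [powSum_single]; exact hm b u _

end Enveloping

/-! ### The exponential of a nilpotent derivation with divided powers. -/

section Exponential

variable {O : Type*} [CommRing O]

lemma sum_range_antidiagonal {A : Type*} [AddCommMonoid A] (N : ℕ) (F : ℕ → ℕ → A)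
    (h1 : ∀ i j, N ≤ i → F i j = 0) (h2 : ∀ i j, N ≤ j → F i j = 0) :
    ∑ n ∈ Finset.range (2 * N), ∑ ij ∈ Finset.HasAntidiagonal.antidiagonal n, F ij.1 ij.2 =
      ∑ i ∈ Finset.range N, ∑ j ∈ Finset.range N, F i j := by
  classical
  rw [← Finset.sum_product', ← Finset.sum_fiberwise_of_maps_to
    (s := Finset.range N ×ˢ Finset.range N) (t := Finset.range (2 * N)) (g := fun x => x.1 + x.2)
    (by simp only [Finset.mem_product, Finset.mem_range]; intro x hx; omega)]
  refine Finset.sum_congr rfl fun n _ => (Finset.sum_subset ?_ ?_).symm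
  · intro x hx
    simpa using (Finset.mem_filter.1 hx).2
  · intro x hx hx'
    rw [Finset.HasAntidiagonal.mem_antidiagonal] at hx
    simp only [Finset.mem_filter, Finset.mem_product, Finset.mem_range, hx, and_true,
      not_and_or, not_lt] at hx'
    exact hx'.elim (h1 _ _) (h2 _ _)

/-- The divided powers `pⁿ / n!`, characterised by `n! cₙ = pⁿ`. -/
def IsDividedPowers (p : ℕ) (c : ℕ → O) : Prop := ∀ n, (n.factorial : O) * c n = (p : O) ^ n

variable {p : ℕ} {c : ℕ → O}

lemma IsDividedPowers.zero (hc : IsDividedPowers p c) : c 0 = 1 := by simpa using hc 0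

variable [IsDomain O] [CharZero O]

lemma IsDividedPowers.succ (hc : IsDividedPowers p c) (n : ℕ) :
    ((n + 1 : ℕ) : O) * c (n + 1) = p * c n := by
  have h := hc (n + 1)
  rw [Nat.factorial_succ, pow_succ', ← hc n] at h
  apply mul_left_cancel₀ (Nat.cast_ne_zero.2 n.factorial_ne_zero : (n.factorial : O) ≠ 0)
  push_cast at h ⊢
  linear_combination h

/-- Factorials can be cancelled in a domain of characteristic zero. This identity absorbs the
binomial coefficients of the Leibniz formula, which is why the exponential respects brackets. -/
lemma IsDividedPowers.choose (hc : IsDividedPowers p c) (i j : ℕ) :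
    ((i + j).choose i : O) * c (i + j) = c i * c j := by
  have h := hc (i + j)
  rw [pow_add, ← hc i, ← hc j, ← Nat.add_choose_mul_factorial_mul_factorial,
    ← Nat.choose_symm_add] at h
  apply mul_left_cancel₀ (Nat.cast_ne_zero.2 (mul_ne_zero i.factorial_ne_zero j.factorial_ne_zero) :
    ((i.factorial * j.factorial : ℕ) : O) ≠ 0)
  push_cast at h ⊢
  linear_combination h

variable {M A : Type*} [LieRing M] [LieAlgebra O M] [Ring A] [Algebra O A]

/-- The homomorphism `x ↦ exp (p z δ) x` for a nilpotent derivation `δ`. -/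
def expHom (hc : IsDividedPowers p c) (δ : LieDerivation O M M) (N : ℕ)
    (hN : ∀ n, N ≤ n → ∀ x, δ^[n] x = 0) (z : A) (ρ : M →ₗ⁅O⁆ A)
    (hz : ∀ x, Commute z (ρ x)) : M →ₗ⁅O⁆ A where
  toLinearMap := ∑ k ∈ Finset.range N, c k • (LinearMap.mulLeft O (z ^ k) ∘ₗ (ρ : M →ₗ[O] A) ∘ₗ
    (δ : M →ₗ[O] M) ^ k)
  map_lie' := by
    intro x y
    have hpow : ∀ k, ∀ x, ((δ : M →ₗ[O] M) ^ k) x = δ^[k] x := fun k x => by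
      rw [Module.End.pow_apply]; rfl
    simp only [AddHom.toFun_eq_coe, LinearMap.coe_toAddHom, LinearMap.sum_apply,
      LinearMap.smul_apply, LinearMap.comp_apply, LinearMap.mulLeft_apply, hpow,
      LieHom.coe_toLinearMap]
    -- The extra terms vanish. The range `2 * N` is needed to contain every `i + j` with `i, j < N`.
    have h0 : ∑ k ∈ Finset.range N, c k • (z ^ k * ρ (δ^[k] ⁅x, y⁆)) =
        ∑ k ∈ Finset.range (2 * N), c k • (z ^ k * ρ (δ^[k] ⁅x, y⁆)) := by
      refine Finset.sum_subset (by simp; omega) fun k _ hk => ?_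
      rw [hN k (by simpa using hk)]
      simp
    have h1 : ∀ n, c n • (z ^ n * ρ (δ^[n] ⁅x, y⁆)) = ∑ ij ∈ Finset.HasAntidiagonal.antidiagonal n,
        (c ij.1 * c ij.2) • (z ^ (ij.1 + ij.2) * ⁅ρ (δ^[ij.1] x), ρ (δ^[ij.2] y)⁆) := by
      intro n
      rw [LieDerivation.iterate_apply_lie, map_sum, Finset.mul_sum, Finset.smul_sum]
      refine Finset.sum_congr rfl fun ij hij => ?_
      rw [Finset.HasAntidiagonal.mem_antidiagonal] at hij
      rw [← hc.choose, hij, map_nsmul, LieHom.map_lie, mul_smul_comm, ← Nat.cast_smul_eq_nsmul O,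
        smul_smul, mul_comm]
    rw [h0, Finset.sum_congr rfl fun n _ => h1 n, sum_range_antidiagonal N
      (fun i j => (c i * c j) • (z ^ (i + j) * ⁅ρ (δ^[i] x), ρ (δ^[j] y)⁆))
      (fun i j hi => by rw [hN i hi]; simp) (fun i j hj => by rw [hN j hj]; simp),
      LieRing.of_associative_ring_bracket, Finset.sum_mul_sum, Finset.sum_mul_sum,
      Finset.sum_comm (s := Finset.range N) (t := Finset.range N)
        (f := fun i j => c i • (z ^ i * ρ (δ^[i] y)) * c j • (z ^ j * ρ (δ^[j] x))),
      ← Finset.sum_sub_distrib]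
    refine Finset.sum_congr rfl fun i _ => ?_
    rw [← Finset.sum_sub_distrib]
    refine Finset.sum_congr rfl fun j _ => ?_
    have e1 : ∀ (i j : ℕ) (a b : M), z ^ i * ρ a * (z ^ j * ρ b) = z ^ (i + j) * (ρ a * ρ b) := by
      intro i j a b
      rw [pow_add, mul_assoc, ← mul_assoc (ρ a), ((hz a).pow_left j).eq.symm]
      simp only [mul_assoc]
    rw [smul_mul_smul_comm, smul_mul_smul_comm, e1, e1, LieRing.of_associative_ring_bracket,
      mul_comm (c j), add_comm j i, mul_sub, smul_sub]

lemma expHom_apply (hc : IsDividedPowers p c) (δ : LieDerivation O M M) (N : ℕ)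
    (hN : ∀ n, N ≤ n → ∀ x, δ^[n] x = 0) (z : A) (ρ : M →ₗ⁅O⁆ A)
    (hz : ∀ x, Commute z (ρ x)) (x : M) :
    expHom hc δ N hN z ρ hz x = ∑ k ∈ Finset.range N, c k • (z ^ k * ρ (δ^[k] x)) := by
  change (∑ k ∈ Finset.range N, c k • (LinearMap.mulLeft O (z ^ k) ∘ₗ (ρ : M →ₗ[O] A) ∘ₗ
    (δ : M →ₗ[O] M) ^ k)) x = _
  have hpow : ∀ k, ∀ x, ((δ : M →ₗ[O] M) ^ k) x = δ^[k] x := fun k x => by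
    rw [Module.End.pow_apply]; rfl
  simp only [LinearMap.sum_apply,
      LinearMap.smul_apply, LinearMap.comp_apply, LinearMap.mulLeft_apply, hpow,
      LieHom.coe_toLinearMap]

/-- Since `[y, z] = 1` and `y` commutes with the image of `ρ`, bracketing with `y` differentiates
the exponential with respect to `z`. The relation `k c_k = p c_{k-1}` then shifts the series by one
application of `δ`. -/
lemma expHom_commutator (hc : IsDividedPowers p c) (δ : LieDerivation O M M) (N : ℕ)
    (hN : ∀ n, N ≤ n → ∀ x, δ^[n] x = 0) (z : A) (ρ : M →ₗ⁅O⁆ A)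
    (hz : ∀ x, Commute z (ρ x)) {y : A} (hy : ∀ x, Commute y (ρ x)) (hyz : y * z = z * y + 1)
    (x : M) : y * expHom hc δ N hN z ρ hz x - expHom hc δ N hN z ρ hz x * y =
      p • expHom hc δ N hN z ρ hz (δ x) := by
  have hpow : ∀ k : ℕ, y * z ^ k = z ^ k * y + k • z ^ (k - 1) := by
    intro k
    induction k with
    | zero => simp
    | succ k ih =>
      rw [pow_succ, ← mul_assoc, ih, add_mul, mul_assoc, hyz, mul_add, mul_one, succ_nsmul,
        Nat.add_sub_cancel, mul_assoc, add_assoc, smul_mul_assoc]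
      rcases k with _ | k
      · simp
      · rw [Nat.add_sub_cancel, ← pow_succ, add_comm (z ^ (k + 1))]
  have hterm : ∀ k, y * (c k • (z ^ k * ρ (δ^[k] x))) - c k • (z ^ k * ρ (δ^[k] x)) * y =
      (k * c k) • (z ^ (k - 1) * ρ (δ^[k] x)) := by
    intro k
    rw [mul_smul_comm, smul_mul_assoc, ← smul_sub, ← mul_assoc, hpow, add_mul, mul_assoc,
      mul_assoc, (hy _).eq, add_sub_cancel_left, smul_mul_assoc, ← Nat.cast_smul_eq_nsmul O,
      smul_smul, mul_comm]
  -- Adding this zero term compensates for the term `k = 0` lost on differentiating, so both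
  -- truncated series have `N` terms.
  have hlast : (((N : ℕ) : O) * c N) • (z ^ (N - 1) * ρ (δ^[N] x)) = 0 := by
    rw [hN N le_rfl]; simp
  rw [expHom_apply, expHom_apply, Finset.mul_sum, Finset.sum_mul, ← Finset.sum_sub_distrib,
    Finset.sum_congr rfl fun k _ => hterm k, ← add_zero (∑ k ∈ Finset.range N, _), ← hlast,
    ← Finset.sum_range_succ (fun k => ((k : O) * c k) • (z ^ (k - 1) * ρ (δ^[k] x))),
    Finset.sum_range_succ', Nat.cast_zero, zero_mul, zero_smul, add_zero, Finset.smul_sum]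
  refine Finset.sum_congr rfl fun k _ => ?_
  rw [hc.succ, Nat.add_sub_cancel, Function.iterate_succ_apply, ← Nat.cast_smul_eq_nsmul O,
    smul_smul]

end Exponential

end AffinoidDixmier

namespace AffinoidDixmier

attribute [local instance 100] LieRing.ofAssociativeRing

/-! ### Characters of a nilpotent Lie lattice vanishing on a subalgebra. -/

section Functional

variable {O : Type*} [CommRing O] [IsDomain O] {L : Type*} [LieRing L] [LieAlgebra O L]

/-- The elements with a nonzero multiple in `N`. -/
def saturation {M : Type*} [AddCommGroup M] [Module O M] (N : Submodule O M) : Submodule O M where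
  carrier := {x | ∃ a : O, a ≠ 0 ∧ a • x ∈ N}
  zero_mem' := ⟨1, one_ne_zero, by simp⟩
  add_mem' := by
    rintro x y ⟨a, ha, hx⟩ ⟨b, hb, hy⟩
    refine ⟨a * b, mul_ne_zero ha hb, ?_⟩
    rw [smul_add]
    refine add_mem ?_ ?_
    · rw [mul_comm, mul_smul]; exact N.smul_mem _ hx
    · rw [mul_smul]; exact N.smul_mem _ hy
  smul_mem' := by
    rintro c x ⟨a, ha, hx⟩
    exact ⟨a, ha, by rw [smul_comm]; exact N.smul_mem _ hx⟩

lemma isTorsionFree_quotient {M : Type*} [AddCommGroup M] [Module O M] (N : Submodule O M)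
    (h : ∀ (a : O) (x : M), a ≠ 0 → a • x ∈ N → x ∈ N) : Module.IsTorsionFree O (M ⧸ N) := by
  refine Module.IsTorsionFree.of_smul_eq_zero fun a m => ?_
  obtain ⟨x, rfl⟩ := N.mkQ_surjective m
  rw [← map_smul, Submodule.mkQ_apply, Submodule.mkQ_apply, Submodule.Quotient.mk_eq_zero,
    Submodule.Quotient.mk_eq_zero]
  intro hx
  by_cases ha : a = 0
  · exact Or.inl ha
  · exact Or.inr (h a x ha hx)

/-- A subalgebra of a nilpotent Lie algebra generating it, up to torsion, modulo the derived
algebra, is the whole algebra up to torsion. -/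
lemma mem_saturation_of_nilpotent [LieRing.IsNilpotent L] (B : LieSubalgebra O L)
    (h : ∀ x, x ∈ saturation (B.toSubmodule ⊔ Submodule.span O {z | ∃ x y : L, ⁅x, y⁆ = z})) (x : L) :
    x ∈ saturation B.toSubmodule := by
  -- Descent along the lower central series: up to torsion `L = B + Cᵏ` for every `k`, and `Cᵏ` is
  -- eventually zero.
  have key : ∀ k, ∀ x, x ∈ saturation (B.toSubmodule ⊔
      (LieModule.lowerCentralSeries O L L k).toSubmodule) := by
    intro k
    induction k with
    | zero => exact fun x => ⟨1, one_ne_zero, by simp⟩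
    | succ k ih =>
      set T := B.toSubmodule ⊔ (LieModule.lowerCentralSeries O L L (k + 1)).toSubmodule with hT
      have hlow : ∀ u : L, ∀ z ∈ LieModule.lowerCentralSeries O L L k, ⁅u, z⁆ ∈ T := fun u z hz => by
        refine Submodule.mem_sup_right ?_
        rw [LieModule.lowerCentralSeries_succ]
        exact LieSubmodule.lie_mem_lie (LieSubmodule.mem_top u) hz
      -- After scaling, `u` and `v` lie in `B + Cᵏ`, so their bracket lies in `[B, B] + [L, Cᵏ] ⊆ B
      -- + Cᵏ⁺¹`. Together with `L = B + [L, L]` up to torsion this advances `k` by one.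
      have hbr : ∀ u v : L, ⁅u, v⁆ ∈ saturation T := by
        intro u v
        obtain ⟨a, ha, hu⟩ := ih u
        obtain ⟨b, hb, hv⟩ := ih v
        obtain ⟨b1, hb1, z1, hz1, h1⟩ := Submodule.mem_sup.1 hu
        obtain ⟨b2, hb2, z2, hz2, h2⟩ := Submodule.mem_sup.1 hv
        refine ⟨a * b, mul_ne_zero ha hb, ?_⟩
        have : (a * b) • ⁅u, v⁆ = ⁅b1, b2⁆ + ⁅b1, z2⁆ + ⁅b1 + z1, z2⁆ - ⁅b1, z2⁆ - ⁅b2, z1⁆ := by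
          rw [mul_smul, ← lie_smul b, ← smul_lie a, ← h1, ← h2]
          simp only [lie_add, add_lie, ← lie_skew z1 b2]
          abel
        rw [this]
        exact sub_mem (sub_mem (add_mem (add_mem (Submodule.mem_sup_left (B.lie_mem hb1 hb2))
          (hlow _ _ hz2)) (hlow _ _ hz2)) (hlow _ _ hz2)) (hlow _ _ hz1)
      intro x
      obtain ⟨a, ha, hx⟩ := h x
      have hle : B.toSubmodule ⊔ Submodule.span O {z | ∃ x y : L, ⁅x, y⁆ = z} ≤ saturation T := by
        refine sup_le (fun y hy => ⟨1, one_ne_zero, by rw [one_smul]; exact Submodule.mem_sup_left hy⟩)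
          (Submodule.span_le.2 ?_)
        rintro _ ⟨u, v, rfl⟩
        exact hbr u v
      obtain ⟨b, hb, hbx⟩ := hle hx
      exact ⟨b * a, mul_ne_zero hb ha, by rwa [mul_smul]⟩
  obtain ⟨k, hk⟩ := (LieModule.isNilpotent_iff O L L).1 inferInstance
  have := key k x
  rwa [hk, LieSubmodule.bot_toSubmodule, sup_bot_eq] at this

/-- A proper saturated subalgebra of a nilpotent Lie lattice lies in the kernel of a surjective
character. -/
lemma exists_functional [IsPrincipalIdealRing O] [Module.Finite O L] [LieRing.IsNilpotent L]
    (B : LieSubalgebra O L) (hsat : ∀ (a : O) (x : L), a ≠ 0 → a • x ∈ B → x ∈ B) (hB : B ≠ ⊤) :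
    ∃ f : L →ₗ[O] O, (∀ x ∈ B, f x = 0) ∧ (∀ x y : L, f ⁅x, y⁆ = 0) ∧ ∃ e, f e = 1 := by
  set T := B.toSubmodule ⊔ Submodule.span O {z | ∃ x y : L, ⁅x, y⁆ = z} with hT
  have hne : ∃ x, x ∉ saturation T := by
    by_contra! h
    refine hB (eq_top_iff.2 fun x _ => ?_)
    obtain ⟨a, ha, hx⟩ := mem_saturation_of_nilpotent B h x
    exact hsat a x ha hx
  obtain ⟨x0, hx0⟩ := hne
  -- This quotient is finite and torsion-free over a principal ideal domain, hence free, and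
  -- nonzero. A coordinate function takes the value `1` at its own basis vector, which is lifted to
  -- `e`.
  let M := L ⧸ saturation T
  have htf : Module.IsTorsionFree O M := isTorsionFree_quotient _ (by
    rintro a x ha ⟨b, hb, hx⟩
    exact ⟨b * a, mul_ne_zero hb ha, by rwa [mul_smul]⟩)
  have : Module.Free O M := inferInstance
  have : Nontrivial M := ⟨Submodule.Quotient.mk x0, 0,
    fun h => hx0 ((Submodule.Quotient.mk_eq_zero _).1 h)⟩
  let b := Module.Free.chooseBasis O M
  have hne : Nonempty (Module.Free.ChooseBasisIndex O M) := b.index_nonempty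
  obtain ⟨i⟩ := hne
  have hmem : ∀ x ∈ T, b.coord i ((saturation T).mkQ x) = 0 := fun x hx => by
    rw [Submodule.mkQ_apply, (Submodule.Quotient.mk_eq_zero (saturation T)).2 
      ⟨1, one_ne_zero, by rwa [one_smul]⟩, map_zero]
  refine ⟨b.coord i ∘ₗ (saturation T).mkQ, fun x hx => hmem x (Submodule.mem_sup_left hx),
    fun x y => hmem _ (Submodule.mem_sup_right (Submodule.subset_span ⟨x, y, rfl⟩)), ?_⟩
  obtain ⟨e, he⟩ := (saturation T).mkQ_surjective (b i)
  exact ⟨e, by rw [LinearMap.comp_apply, he]; simp⟩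

end Functional

/-! ### Splitting off the variable with index zero. -/

section PolynomialSplit

variable {R : Type*} [CommRing R] {r : ℕ}

namespace WeylAlgebra

variable (R r) in
/-- The inclusion of Weyl algebras that leaves out the variables with index `0`. -/
def succIncl : WeylAlgebra R r →ₐ[R] WeylAlgebra R (r + 1) :=
  lift (fun i => gen R (r + 1) (.inl i.succ)) (fun i => gen R (r + 1) (.inr i.succ))
    (fun _ _ => gen_xx _ _) (fun _ _ => gen_yy _ _) (fun i j => by simp [gen_xy])

@[simp] lemma succIncl_inl (i : Fin r) :
    succIncl R r (gen R r (.inl i)) = gen R (r + 1) (.inl i.succ) := by simp [succIncl]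

@[simp] lemma succIncl_inr (i : Fin r) :
    succIncl R r (gen R r (.inr i)) = gen R (r + 1) (.inr i.succ) := by simp [succIncl]

lemma commute_succIncl (s : Fin (r + 1) ⊕ Fin (r + 1)) (hs : s = .inl 0 ∨ s = .inr 0)
    (P : WeylAlgebra R r) : Commute (gen R (r + 1) s) (succIncl R r P) := by
  induction P using WeylAlgebra.induction with
  | hgen t =>
    rcases t with i | i <;> rcases hs with rfl | rfl
    · rw [succIncl_inl]; exact gen_xx _ _
    · rw [succIncl_inl]
      exact Commute.symm (by simpa [Fin.succ_ne_zero i, commute_iff_eq] using gen_xy (R := R) i.succ 0)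
    · rw [succIncl_inr]
      simpa [(Fin.succ_ne_zero i).symm, commute_iff_eq] using gen_xy (R := R) 0 i.succ
    · rw [succIncl_inr]; exact gen_yy _ _
  | halg a => rw [AlgHom.commutes]; exact Algebra.commute_algebraMap_right _ _
  | hadd P Q hP hQ => rw [map_add]; exact hP.add_right hQ
  | hmul P Q hP hQ => rw [map_mul]; exact hP.mul_right hQ

lemma polyRep_succIncl (P : WeylAlgebra R r) (f : MvPolynomial (Fin r) R) :
    polyRep R (r + 1) (succIncl R r P) (MvPolynomial.rename Fin.succ f) =
      MvPolynomial.rename Fin.succ (polyRep R r P f) :=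
  (intertwine (polyRep R r) ((polyRep R (r + 1)).comp (succIncl R r))
    (MvPolynomial.rename Fin.succ).toLinearMap (by
      rintro (i | i) m
      · simp [MvPolynomial.pderiv_rename (Fin.succ_injective r)]
      · simp) P f).symm

lemma pderiv_zero_rename_succ (f : MvPolynomial (Fin r) R) :
    MvPolynomial.pderiv 0 (MvPolynomial.rename Fin.succ f) = 0 := by
  apply MvPolynomial.pderiv_eq_zero_of_notMem_vars
  classical
  intro h
  have := MvPolynomial.vars_rename Fin.succ f h
  simp [Fin.succ_ne_zero] at this

end WeylAlgebra

/-- The polynomial `∑ X₀ᵃ gₐ(X₁, …, X_r)`. -/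
def consSum : (ℕ →₀ MvPolynomial (Fin r) R) →ₗ[R] MvPolynomial (Fin (r + 1)) R :=
  Finsupp.lsum R fun a =>
    LinearMap.mulLeft R (MvPolynomial.X 0 ^ a) ∘ₗ (MvPolynomial.rename Fin.succ).toLinearMap

lemma consSum_single (a : ℕ) (g : MvPolynomial (Fin r) R) :
    consSum (Finsupp.single a g) = MvPolynomial.X 0 ^ a * MvPolynomial.rename Fin.succ g := by
  simp [consSum]

lemma coeff_consSum (v : ℕ →₀ MvPolynomial (Fin r) R) (n : ℕ) :
    (MvPolynomial.finSuccEquiv R r (consSum v)).coeff n = v n := by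
  induction v using Finsupp.induction_linear with
  | zero => simp
  | add f g hf hg => simp [hf, hg]
  | single a g =>
    rw [consSum_single, map_mul, map_pow, MvPolynomial.finSuccEquiv_X_zero]
    have : MvPolynomial.finSuccEquiv R r (MvPolynomial.rename Fin.succ g) = Polynomial.C g := by
      induction g using MvPolynomial.induction_on with
      | C a => simp [MvPolynomial.finSuccEquiv_apply]
      | add p q hp hq => simp [hp, hq]
      | mul_X p i hp => simp [hp, MvPolynomial.finSuccEquiv_X_succ]
    rw [this, mul_comm, Polynomial.coeff_C_mul_X_pow, Finsupp.single_apply]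
    simp [eq_comm]

lemma consSum_injective : Function.Injective (consSum (R := R) (r := r)) := fun v w h =>
  Finsupp.ext fun n => by rw [← coeff_consSum, ← coeff_consSum, h]

lemma consSum_surjective : Function.Surjective (consSum (R := R) (r := r)) := fun q => by
  refine ⟨(MvPolynomial.finSuccEquiv R r q).toFinsupp.coeff, ?_⟩
  apply (MvPolynomial.finSuccEquiv R r).injective
  ext1 n
  rw [coeff_consSum]
  rfl

end PolynomialSplit

end AffinoidDixmier

namespace AffinoidDixmier

attribute [local instance 100] LieRing.ofAssociativeRing

/-! ### Realising the module induced from a character on polynomials. -/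

section DixmierRepresentation

open UniversalEnvelopingAlgebra (ι)

variable {O : Type*} [CommRing O] {L : Type*} [LieRing L] [LieAlgebra O L]

/-- The left ideal of `U(L)` generated by the elements `b - χ(b)`. -/
def characterIdeal (B : LieSubalgebra O L) (χ : B →ₗ⁅O⁆ O) : Ideal (UniversalEnvelopingAlgebra O L) :=
  Ideal.span (Set.range fun b : B => ι O (b : L) - algebraMap O _ (χ b))

/-- The value at `1` of the action of `U(L)` on polynomials through a homomorphism from `L` to the
Weyl algebra. -/
def polyAct {r : ℕ} (ρ : L →ₗ⁅O⁆ WeylAlgebra O r) :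
    UniversalEnvelopingAlgebra O L →ₗ[O] MvPolynomial (Fin r) O :=
  LinearMap.applyₗ (1 : MvPolynomial (Fin r) O) ∘ₗ (WeylAlgebra.polyRep O r).toLinearMap ∘ₗ
    (UniversalEnvelopingAlgebra.lift O ρ).toLinearMap

lemma polyAct_apply {r : ℕ} (ρ : L →ₗ⁅O⁆ WeylAlgebra O r) (u) :
    polyAct ρ u = WeylAlgebra.polyRep O r (UniversalEnvelopingAlgebra.lift O ρ u) 1 := rfl

/-- The homomorphism `ρ` realises the module `U(L) ⊗ O_χ` on the polynomials in `r` variables. -/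
structure IsDixmierRep (B : LieSubalgebra O L) (χ : B →ₗ⁅O⁆ O) {r : ℕ}
    (ρ : L →ₗ⁅O⁆ WeylAlgebra O r) : Prop where
  surjective : Function.Surjective (polyAct ρ)
  mem_ideal : ∀ u, polyAct ρ u = 0 → u ∈ characterIdeal B χ
  apply_char : ∀ b : B, polyAct ρ (ι O (b : L)) = MvPolynomial.C (χ b)

/-- Corank zero: `χ` is a character of all of `L`, and `L` acts on constants through it. -/
lemma exists_dixmierRep_zero (B : LieSubalgebra O L) (χ : B →ₗ⁅O⁆ O) (hB : B = ⊤) :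
    ∃ ρ : L →ₗ⁅O⁆ WeylAlgebra O 0, IsDixmierRep B χ ρ := by
  have hmem : ∀ x, x ∈ B := fun x => by rw [hB]; exact LieSubalgebra.mem_top x
  let ψ : L →ₗ⁅O⁆ O :=
    { toFun := fun x => χ ⟨x, hmem x⟩
      map_add' := fun x y => map_add χ (⟨x, hmem x⟩ : B) ⟨y, hmem y⟩
      map_smul' := fun a x => map_smul χ a (⟨x, hmem x⟩ : B)
      map_lie' := fun {x y} => LieHom.map_lie χ (⟨x, hmem x⟩ : B) ⟨y, hmem y⟩ }
  let ρ : L →ₗ⁅O⁆ WeylAlgebra O 0 := (Algebra.ofId O (WeylAlgebra O 0)).toLieHom.comp ψ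
  have hact : ∀ u, polyAct ρ u = MvPolynomial.C (UniversalEnvelopingAlgebra.lift O ψ u) := by
    intro u
    have h : UniversalEnvelopingAlgebra.lift O ρ =
        (Algebra.ofId O (WeylAlgebra O 0)).comp (UniversalEnvelopingAlgebra.lift O ψ) := by
      apply UniversalEnvelopingAlgebra.hom_ext
      ext x
      simp only [LieHom.coe_comp, Function.comp_apply, AlgHom.coe_toLieHom, AlgHom.comp_apply,
        UniversalEnvelopingAlgebra.lift_ι_apply]
      rfl
    rw [polyAct_apply, h, AlgHom.comp_apply, Algebra.ofId_apply, AlgHom.commutes,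
      Module.algebraMap_end_apply, MvPolynomial.smul_eq_C_mul, mul_one]
  refine ⟨ρ, fun q => ?_, fun u hu => ?_, fun b => ?_⟩
  · obtain ⟨a, rfl⟩ := MvPolynomial.C_surjective (Fin 0) q
    exact ⟨algebraMap O _ a, by rw [hact, AlgHom.commutes]; rfl⟩
  -- Every `u` is congruent to the scalar `ψ(u)` modulo the left ideal; the elements with this
  -- property contain `1` and are stable under left multiplication by `L`.
  · have key : u - algebraMap O _ (UniversalEnvelopingAlgebra.lift O ψ u) ∈ characterIdeal B χ := by
      refine envelope_submodule_eq_top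
        { carrier := {u | u - algebraMap O _ (UniversalEnvelopingAlgebra.lift O ψ u) ∈
            characterIdeal B χ}
          add_mem' := fun {u v} hu hv => ?_
          zero_mem' := by simp
          smul_mem' := fun a u hu => ?_ } ?_ ?_ u
      · have := (characterIdeal B χ).add_mem hu hv
        simp only [Set.mem_ofPred_eq, map_add]
        convert this using 1
        abel
      · have := (characterIdeal B χ).mul_mem_left (algebraMap O _ a) hu
        simp only [Set.mem_ofPred_eq, map_smul, smul_eq_mul, map_mul]
        rwa [Algebra.smul_def, ← mul_sub]
      · simp
      · intro x u hu
        have h1 := (characterIdeal B χ).mul_mem_left (ι O x) hu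
        have h2 := (characterIdeal B χ).mul_mem_left
          (algebraMap O _ (UniversalEnvelopingAlgebra.lift O ψ u))
          (Ideal.subset_span ⟨⟨x, hmem x⟩, rfl⟩)
        have h3 := add_mem h1 h2
        change ι O x * u - algebraMap O _ (UniversalEnvelopingAlgebra.lift O ψ (ι O x * u)) ∈
          characterIdeal B χ
        rw [map_mul, UniversalEnvelopingAlgebra.lift_ι_apply, map_mul]
        convert h3 using 1
        rw [mul_sub, mul_sub, ← Algebra.commutes _ (ι O x), sub_add_sub_cancel, ← map_mul, ← map_mul,
          mul_comm]
        rfl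
    rw [hact, map_eq_zero_iff _ (MvPolynomial.C_injective _ _)] at hu
    rwa [hu, map_zero, sub_zero] at key
  · rw [hact, UniversalEnvelopingAlgebra.lift_ι_apply]
    rfl

lemma mul_neg_eq_of_commutator {A : Type*} [Ring A] {x y : A} (h : x * y = y * x + 1) :
    y * (-x) = (-x) * y + 1 := by
  rw [neg_mul, h]
  simp

open WeylAlgebra in
/-- Extension of a realisation from an ideal of corank one. -/
lemma exists_dixmierRep_succ [IsDomain O] [CharZero O] {p : ℕ} {c : ℕ → O}
    (hc : IsDividedPowers p c) (B M : LieSubalgebra O L) (χ : B →ₗ⁅O⁆ O) (hBM : ∀ x ∈ B, x ∈ M)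
    (f : L →ₗ[O] O) (e : L) (hfe : f e = 1) (hf : ∀ x, f x = 0 ↔ x ∈ M)
    (hfl : ∀ x y : L, f ⁅x, y⁆ = 0) (δ : LieDerivation O M M) (N : ℕ)
    (hN : ∀ n, N ≤ n → ∀ x, δ^[n] x = 0) (hδ : ∀ x : M, ⁅e, (x : L)⁆ = p • (δ x : L))
    (B' : LieSubalgebra O M) (hB' : ∀ x : M, x ∈ B' ↔ (x : L) ∈ B) (χ' : B' →ₗ⁅O⁆ O)
    (hχ' : ∀ (x : B') (h : ((x : M) : L) ∈ B), χ' x = χ ⟨_, h⟩)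
    {r : ℕ} (ρ : M →ₗ⁅O⁆ WeylAlgebra O r) (hρ : IsDixmierRep B' χ' ρ) :
    ∃ ρ' : L →ₗ⁅O⁆ WeylAlgebra O (r + 1), IsDixmierRep B χ ρ' := by
  let ρ0 : M →ₗ⁅O⁆ WeylAlgebra O (r + 1) := (succIncl O r).toLieHom.comp ρ
  have hρ0 : ∀ x, ρ0 x = succIncl O r (ρ x) := fun _ => rfl
  set x0 := gen O (r + 1) (.inl 0) with hx0
  set y0 := gen O (r + 1) (.inr 0) with hy0
  -- The bound `N + 1` makes the sum over `range (N + 1)` nonempty, so that its zeroth term can be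
  -- split off below.
  have hN' : ∀ n, N + 1 ≤ n → ∀ x, δ^[n] x = 0 := fun n hn => hN n (by omega)
  have hz : ∀ x, Commute (-x0) (ρ0 x) := fun x =>
    (commute_succIncl _ (Or.inl rfl) _).neg_left
  have hy : ∀ x, Commute y0 (ρ0 x) := fun x => commute_succIncl _ (Or.inr rfl) _
  have hyz : y0 * (-x0) = (-x0) * y0 + 1 := by
    have := gen_xy (R := O) (0 : Fin (r + 1)) 0
    rw [if_pos rfl] at this
    exact mul_neg_eq_of_commutator this
  let E := expHom hc δ (N + 1) hN' (-x0) ρ0 hz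
  have hE : ∀ x, y0 * E x - E x * y0 = p • E (δ x) :=
    expHom_commutator hc δ (N + 1) hN' (-x0) ρ0 hz hy hyz
  -- The projection along the decomposition `L = O e ⊕ M` given by `f`.
  let pr : L →ₗ[O] M := LinearMap.codRestrict M.toSubmodule (LinearMap.id - f.smulRight e)
    (fun x => (hf _).1 (by simp [hfe]))
  have hpr : ∀ x, (pr x : L) = x - f x • e := fun x => rfl
  have hprM : ∀ x : M, pr x = x := fun x => Subtype.ext (by rw [hpr, (hf _).2 x.2]; simp)
  have hpe : pr e = 0 := Subtype.ext (by rw [hpr, hfe]; simp)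
  let ρ' : L →ₗ⁅O⁆ WeylAlgebra O (r + 1) :=
    { toLinearMap := f.smulRight y0 + (E : M →ₗ[O] WeylAlgebra O (r + 1)) ∘ₗ pr
      map_lie' := by
        intro x y
        have hx : x = f x • e + (pr x : L) := by rw [hpr]; abel
        have hy : y = f y • e + (pr y : L) := by rw [hpr]; abel
        -- The bracket of the semidirect sum of `O e` and `M`, on which `e` acts by `p δ`. Matching
        -- it in the Weyl algebra requires exactly the commutator identity `hE`.
        have hlie : pr ⁅x, y⁆ = ⁅pr x, pr y⁆ + (f x * p) • δ (pr y) - (f y * p) • δ (pr x) := by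
          apply Subtype.ext
          rw [hpr, hfl, zero_smul, sub_zero]
          conv_lhs => rw [hx, hy]
          simp only [add_lie, lie_add, smul_lie, lie_smul, lie_self, smul_zero, hδ, zero_add]
          rw [← lie_skew, hδ]
          push_cast
          simp only [mul_smul, Nat.cast_smul_eq_nsmul, smul_neg]
          abel
        change f ⁅x, y⁆ • y0 + E (pr ⁅x, y⁆) = ⁅f x • y0 + E (pr x), f y • y0 + E (pr y)⁆
        rw [hfl, hlie, zero_smul, zero_add, map_sub, map_add, LieHom.map_lie, map_smul, map_smul]
        simp only [LieRing.of_associative_ring_bracket, add_mul, mul_add, smul_mul_assoc,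
          mul_smul_comm, mul_smul, Nat.cast_smul_eq_nsmul, ← hE, smul_sub, smul_add]
        rw [smul_comm (f y) (f x) (y0 * y0)]
        abel }
  have hρe : ρ' e = y0 := by
    change f e • y0 + E (pr e) = y0
    rw [hfe, hpe, map_zero, one_smul, add_zero]
  have hρM : ∀ x : M, ρ' (x : L) = E x := fun x => by
    change f x • y0 + E (pr x) = E x
    rw [(hf _).2 x.2, hprM, zero_smul, zero_add]
  -- On polynomials without `t₀` all terms of the exponential with `k ≥ 1` vanish, because they end
  -- in `x₀ = ∂/∂t₀`; so `U(M)` acts there as through `ρ`.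
  have hact : ∀ (u : UniversalEnvelopingAlgebra O M) (q : MvPolynomial (Fin r) O),
      polyRep O (r + 1) (UniversalEnvelopingAlgebra.lift O ρ' (envelopeIncl M u))
        (MvPolynomial.rename Fin.succ q) = MvPolynomial.rename Fin.succ
        (polyRep O r (UniversalEnvelopingAlgebra.lift O ρ u) q) := by
    intro u
    induction u using envelope_induction with
    | halg a => intro q; simp [Module.algebraMap_end_apply]
    | hadd u v hu hv => intro q; simp [hu, hv]
    | hmul u v hu hv => intro q; simp [hu, hv]
    | hι x =>
      intro q
      rw [envelopeIncl_ι, UniversalEnvelopingAlgebra.lift_ι_apply,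
        UniversalEnvelopingAlgebra.lift_ι_apply, hρM, expHom_apply, Finset.sum_range_succ',
        map_add, map_sum, LinearMap.add_apply, LinearMap.sum_apply, Finset.sum_eq_zero, zero_add]
      · rw [hc.zero, one_smul, pow_zero, one_mul, Function.iterate_zero_apply, hρ0,
          polyRep_succIncl]
      · intro k _
        rw [map_smul, ((hz _).pow_left (k + 1)).eq, map_mul, pow_succ, map_mul, LinearMap.smul_apply,
          Module.End.mul_apply, Module.End.mul_apply, map_neg, LinearMap.neg_apply, polyRep_x,
          pderiv_zero_rename_succ]
        simp
  -- Since `e` acts as multiplication by `t₀`, the coefficient of `t₀ᵃ` records the action of the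
  -- `a`-th component. Surjectivity and the kernel can therefore be checked component by component.
  have hactpow : ∀ v, polyAct ρ' (powSum M e v) = consSum (Finsupp.mapRange.linearMap (polyAct ρ) v) := by
    intro v
    induction v using Finsupp.induction_linear with
    | zero => simp
    | add f g hf hg => rw [map_add, map_add, map_add, map_add, hf, hg]
    | single a u =>
      have h1 := hact u 1
      rw [map_one (MvPolynomial.rename Fin.succ)] at h1
      rw [powSum_single, polyAct_apply, map_mul, map_mul, Module.End.mul_apply, h1, map_pow, map_pow,
        UniversalEnvelopingAlgebra.lift_ι_apply, hρe, Finsupp.mapRange.linearMap_apply,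
        Finsupp.mapRange_single, consSum_single, polyAct_apply]
      generalize MvPolynomial.rename (R := O) Fin.succ _ = q
      induction a with
      | zero => simp
      | succ a ih => rw [pow_succ', Module.End.mul_apply, ih, polyRep_y, pow_succ', mul_assoc]
  have hspan : Function.Surjective (powSum M e) := powSum_surjective M e
    (fun x _ => (hf _).1 (hfl _ _)) (fun x => ⟨f x, (hf _).1 (by simp [hfe])⟩)
  refine ⟨ρ', fun q => ?_, fun u hu => ?_, fun b => ?_⟩
  · obtain ⟨v, rfl⟩ := consSum_surjective (R := O) q
    obtain ⟨w, rfl⟩ := Finsupp.mapRange_surjective (polyAct ρ) (map_zero (polyAct ρ)) hρ.surjective v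
    exact ⟨powSum M e w, by rw [hactpow, Finsupp.mapRange.linearMap_apply]⟩
  · obtain ⟨v, rfl⟩ := hspan u
    rw [hactpow, map_eq_zero_iff _ consSum_injective] at hu
    have hv : ∀ n, envelopeIncl M (v n) ∈ characterIdeal B χ := by
      intro n
      have h1 := hρ.mem_ideal (v n) (DFunLike.congr_fun hu n)
      have h2 : characterIdeal B' χ' ≤ (characterIdeal B χ).comap (envelopeIncl M) := by
        rw [characterIdeal, Ideal.span_le]
        rintro _ ⟨x, rfl⟩
        refine Ideal.subset_span ⟨⟨((x : M) : L), (hB' _).1 x.2⟩, ?_⟩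
        simp only [map_sub, envelopeIncl_ι, AlgHom.commutes]
        rw [hχ' x ((hB' _).1 x.2)]
      exact h2 h1
    rw [powSum, Finsupp.lsum_apply]
    exact Submodule.sum_mem _ fun n _ => (characterIdeal B χ).mul_mem_left (ι O e ^ n) (hv n)
  · have h1 := hact (ι O (⟨b, hBM b b.2⟩ : M)) 1
    have hb : (⟨b, hBM b b.2⟩ : M) ∈ B' := (hB' _).2 b.2
    rw [map_one (MvPolynomial.rename Fin.succ), envelopeIncl_ι, ← polyAct_apply, ← polyAct_apply,
      hρ.apply_char ⟨_, hb⟩, hχ' _ b.2, MvPolynomial.rename_C] at h1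
    exact h1

end DixmierRepresentation
end AffinoidDixmier

/-! ### Existence of the realisation, by induction on the corank. -/

namespace AffinoidDixmier

attribute [local instance 100] LieRing.ofAssociativeRing

universe u

/-- Every Lie character of a saturated subalgebra of a powerful nilpotent Lie lattice induces a
module that is realised by differential operators on polynomials. -/
theorem exists_dixmierRep {O : Type*} [CommRing O] [IsDomain O] [IsPrincipalIdealRing O] [CharZero O]
    {p : ℕ} (hp : p ≠ 0) {c : ℕ → O} (hc : IsDividedPowers p c) (r : ℕ) :
    ∀ {L : Type u} [LieRing L] [LieAlgebra O L] [Module.Finite O L] [Module.IsTorsionFree O L]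
      [LieRing.IsNilpotent L] (B : LieSubalgebra O L) (χ : B →ₗ⁅O⁆ O)
      (_ : ∀ (a : O) (x : L), a ≠ 0 → a • x ∈ B → x ∈ B) (_ : ∀ x y : L, ∃ z, ⁅x, y⁆ = p • z)
      (_ : Module.finrank O (L ⧸ B.toSubmodule) = r),
      ∃ ρ : L →ₗ⁅O⁆ WeylAlgebra O r, IsDixmierRep B χ ρ := by
  induction r with
  | zero =>
    intro L _ _ _ _ _ B χ hsat hpow hr
    apply exists_dixmierRep_zero
    have := isTorsionFree_quotient B.toSubmodule hsat
    have h0 := Module.finrank_zero_iff.1 hr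
    rw [Submodule.Quotient.subsingleton_iff] at h0
    exact LieSubalgebra.toSubmodule_injective h0
  | succ r ih =>
    intro L _ _ _ _ _ B χ hsat hpow hr
    have hB : B ≠ ⊤ := by
      rintro rfl
      have : Subsingleton (L ⧸ (⊤ : LieSubalgebra O L).toSubmodule) :=
        Submodule.Quotient.subsingleton_iff.2 rfl
      rw [Module.finrank_zero_of_subsingleton] at hr
      exact absurd hr (by omega)
    obtain ⟨f, hfB, hfl, e, hfe⟩ := exists_functional B hsat hB
    let M : LieSubalgebra O L := { LinearMap.ker f with lie_mem' := fun {x y} _ _ => hfl x y }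
    have hM : ∀ x, f x = 0 ↔ x ∈ M := fun x => Iff.rfl
    have hp0 : (p : O) ≠ 0 := Nat.cast_ne_zero.2 hp
    -- The quotient of a bracket by `p` stays in `M`: `f` kills brackets and `p` is not a zero
    -- divisor. This defines `δ = (ad e)/p` and shows that `M` is powerful again.
    have hdiv : ∀ x : M, ∀ y : L, ∃ z : M, ⁅y, (x : L)⁆ = p • (z : L) := fun x y => by
      obtain ⟨z, hz⟩ := hpow y x
      refine ⟨⟨z, (hM z).1 ?_⟩, hz⟩
      have := hfl y x
      rw [hz, map_nsmul, nsmul_eq_mul] at this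
      exact (mul_eq_zero.1 this).resolve_left hp0
    have hinj : ∀ x y : M, p • (x : L) = p • (y : L) → x = y := fun x y h => by
      rw [← Nat.cast_smul_eq_nsmul O, ← Nat.cast_smul_eq_nsmul O] at h
      exact Subtype.ext (smul_right_injective L hp0 h)
    choose d hd using fun x : M => hdiv x e
    let δ : LieDerivation O M M :=
      { toFun := d
        map_add' := fun x y => hinj _ _ (by
          rw [← hd]
          push_cast
          rw [smul_add, lie_add, ← hd, ← hd])
        map_smul' := fun a x => hinj _ _ (by
          rw [← hd]
          push_cast
          rw [lie_smul, smul_comm, ← hd]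
          rfl)
        leibniz' := fun x y => hinj _ _ (by
          change p • (d ⁅x, y⁆ : L) = p • ((⁅x, d y⁆ - ⁅y, d x⁆ : M) : L)
          rw [← hd]
          push_cast
          rw [smul_sub, ← lie_nsmul, ← lie_nsmul, ← hd, ← hd, leibniz_lie, ← lie_skew (⁅e, (x : L)⁆)]
          abel) }
    have hδ : ∀ x : M, ⁅e, (x : L)⁆ = p • (δ x : L) := hd
    obtain ⟨N, hN⟩ := LieModule.exists_forall_pow_toEnd_eq_zero O L L
    have hiter : ∀ n, ∀ x : M, ((LieModule.toEnd O L L e) ^ n) (x : L) = p ^ n • ((δ^[n] x : M) : L) := by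
      intro n
      induction n with
      | zero => intro x; simp
      | succ n ihn =>
        intro x
        rw [pow_succ, Module.End.mul_apply, LieModule.toEnd_apply_apply, hδ, map_nsmul, ihn, smul_smul,
          Function.iterate_succ_apply, pow_succ']
    have hN' : ∀ n, N ≤ n → ∀ x, δ^[n] x = 0 := fun n hn x => by
      have h1 := hiter n x
      rw [pow_eq_zero_of_le hn (hN e), LinearMap.zero_apply, ← Nat.cast_smul_eq_nsmul O] at h1
      refine Subtype.ext ((smul_eq_zero.1 h1.symm).resolve_left ?_)
      push_cast
      exact pow_ne_zero _ hp0
    let B' : LieSubalgebra O M := B.comap M.incl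
    have hB' : ∀ x : M, x ∈ B' ↔ (x : L) ∈ B := fun x => Iff.rfl
    let χ' : B' →ₗ⁅O⁆ O :=
      { toFun := fun x => χ ⟨((x : M) : L), (hB' _).1 x.2⟩
        map_add' := fun x y => map_add χ (⟨((x : M) : L), (hB' _).1 x.2⟩ : B)
          ⟨((y : M) : L), (hB' _).1 y.2⟩
        map_smul' := fun a x => map_smul χ a (⟨((x : M) : L), (hB' _).1 x.2⟩ : B)
        map_lie' := fun {x y} => LieHom.map_lie χ (⟨((x : M) : L), (hB' _).1 x.2⟩ : B)
          ⟨((y : M) : L), (hB' _).1 y.2⟩ }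
    have hnil : LieRing.IsNilpotent M :=
      Function.Injective.lieAlgebra_isNilpotent (f := M.incl) Subtype.val_injective
    have hfin : Module.Finite O M := inferInstanceAs (Module.Finite O M.toSubmodule)
    have htf : Module.IsTorsionFree O M := inferInstanceAs (Module.IsTorsionFree O M.toSubmodule)
    obtain ⟨ρ, hρ⟩ := ih B' χ' (fun a x ha hx => hsat a _ ha hx)
      (fun x y => by
        obtain ⟨z, hz⟩ := hdiv y x
        exact ⟨z, Subtype.ext hz⟩)
      -- The kernel of the surjection `f` has rank one less than `L` and contains `B`, so the corank
      -- of `B` drops by one.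
      (by
        have h1 := B.toSubmodule.finrank_quotient_add_finrank
        have h2 := B'.toSubmodule.finrank_quotient_add_finrank
        have h3 := f.quotKerEquivOfSurjective (fun a => ⟨a • e, by simp [hfe]⟩)
        have h4 := (LinearMap.ker f).finrank_quotient_add_finrank
        rw [h3.finrank_eq, Module.finrank_self] at h4
        have h5 : Module.finrank O B'.toSubmodule = Module.finrank O B.toSubmodule :=
          (Submodule.comapSubtypeEquivOfLe (p := B.toSubmodule) (q := M.toSubmodule)
            (fun x hx => hfB x hx)).finrank_eq
        change _ + Module.finrank O M = _ at h4
        omega)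
    exact exists_dixmierRep_succ hc B M χ (fun x hx => (hM x).1 (hfB x hx)) f e hfe hM hfl δ N hN' hδ
      B' hB' χ' (fun _ _ => rfl) ρ hρ

end AffinoidDixmier

namespace AffinoidDixmier

/-! ### Elements of `π`-adic completions as series. -/

section CompletionSeries

variable {O : Type*} [CommRing O] {π : O}

/-- Every element is determined by its residues modulo the powers of `π`. -/
def IsPiSeparated (π : O) (M : Type*) [AddCommGroup M] [Module O M] : Prop :=
  ∀ m : M, (∀ n : ℕ, ∃ m', m = π ^ n • m') → m = 0

namespace PiCompletion

variable {A : Type*} [Ring A] [Algebra O A]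

lemma ext_val {v w : PiCompletion π A} (h : ∀ n, v.1 n = w.1 n) : v = w := Subtype.ext (funext h)

lemma mk_eq_mk_iff {n : ℕ} {a b : A} : Ideal.Quotient.mk (powIdeal π A n) a =
    Ideal.Quotient.mk (powIdeal π A n) b ↔ ∃ d, a - b = π ^ n • d := Ideal.Quotient.eq

variable (π) in
/-- The element `∑ πᵏ cₖ` of the completion. -/
def series (c : ℕ → A) : PiCompletion π A :=
  ⟨fun n => Ideal.Quotient.mk _ (∑ k ∈ Finset.range n, π ^ k • c k), fun n => by
    change Ideal.Quotient.mk _ _ = _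
    rw [mk_eq_mk_iff, Finset.sum_range_succ, add_sub_cancel_left]
    exact ⟨_, rfl⟩⟩

lemma exists_series (v : PiCompletion π A) : ∃ c, v = series π c := by
  choose a ha using fun n => Ideal.Quotient.mk_surjective (v.1 n)
  have hstep : ∀ n, ∃ d, a (n + 1) - a n = π ^ n • d := fun n => by
    rw [← mk_eq_mk_iff, ha n, ← v.2 n, ← ha (n + 1)]
    rfl
  choose d hd using hstep
  -- The component at `n` is the partial sum over `k < n`, so the term at `0` must be a lift of the
  -- component at `1`; the later terms telescope.
  refine ⟨fun k => if k = 0 then a 1 else d k, ext_val fun n => ?_⟩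
  rw [← ha n]
  rcases n with _ | n
  · exact mk_eq_mk_iff.2 ⟨_, by rw [pow_zero, one_smul]⟩
  · change _ = Ideal.Quotient.mk _ _
    congr 1
    induction n with
    | zero => simp
    | succ n ih =>
      rw [Finset.sum_range_succ, ← ih]
      exact sub_eq_iff_eq_add'.1 (hd (n + 1))

lemma series_eq (c : ℕ → A) : series π c = of π A (c 0) + π • series π fun k => c (k + 1) := by
  refine ext_val fun n => ?_
  change Ideal.Quotient.mk _ _ = Ideal.Quotient.mk _ (_ + π • _)
  rw [mk_eq_mk_iff]
  refine ⟨-c n, ?_⟩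
  have h : c 0 + π • ∑ k ∈ Finset.range n, π ^ k • c (k + 1) =
      ∑ k ∈ Finset.range (n + 1), π ^ k • c k := by
    rw [Finset.sum_range_succ', Finset.smul_sum, pow_zero, one_smul, add_comm]
    simp only [smul_smul, pow_succ']
  rw [h, Finset.sum_range_succ, sub_add_cancel_left, smul_neg]

lemma series_add (c d : ℕ → A) : series π (c + d) = series π c + series π d :=
  ext_val fun n => by
    change Ideal.Quotient.mk _ _ = Ideal.Quotient.mk _ (_ + _)
    simp [Finset.sum_add_distrib]

lemma series_smul (a : O) (c : ℕ → A) : series π (a • c) = a • series π c :=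
  ext_val fun n => by
    change Ideal.Quotient.mk _ _ = Ideal.Quotient.mk _ (a • _)
    simp [Finset.smul_sum, smul_comm a]

lemma exists_of_add_smul (v : PiCompletion π A) : ∃ a w, v = of π A a + π • w := by
  obtain ⟨c, rfl⟩ := exists_series v
  exact ⟨_, _, series_eq c⟩

lemma exists_of_add_pow_smul (n : ℕ) (v : PiCompletion π A) : ∃ a w, v = of π A a + π ^ n • w := by
  induction n with
  | zero => exact ⟨0, v, by simp⟩
  | succ n ih =>
    obtain ⟨a, w, rfl⟩ := ih
    obtain ⟨b, z, rfl⟩ := exists_of_add_smul w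
    exact ⟨a + π ^ n • b, z, by rw [map_add, map_smul, smul_add, smul_smul, pow_succ, add_assoc]⟩

lemma isPiSeparated : IsPiSeparated π (PiCompletion π A) := by
  intro v hv
  refine ext_val fun n => ?_
  obtain ⟨w, rfl⟩ := hv n
  obtain ⟨a, ha⟩ := Ideal.Quotient.mk_surjective (w.1 n)
  change π ^ n • w.1 n = 0
  rw [← ha]
  exact Ideal.Quotient.eq_zero_iff_mem.2 ⟨a, rfl⟩

/-- Completion does not change the quotient modulo `π`; only the component at `1` has to be
compared. -/
lemma exists_eq_smul_of {a : A} {v : PiCompletion π A} (h : of π A a = π • v) :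
    ∃ b, a = π • b := by
  have h1 := congrFun (congrArg Subtype.val h) 1
  obtain ⟨b, hb⟩ := Ideal.Quotient.mk_surjective (v.1 1)
  change Ideal.Quotient.mk _ a = π • v.1 1 at h1
  rw [← hb] at h1
  obtain ⟨d, hd⟩ := mk_eq_mk_iff.1 (h1 : _ = Ideal.Quotient.mk _ (π • b))
  exact ⟨b + d, by rw [smul_add, ← pow_one π, ← hd, pow_one, add_sub_cancel]⟩

/-- The image of `A` is dense, and linear maps are automatically continuous because they preserve
divisibility by `πⁿ`. -/
lemma linear_ext {M : Type*} [AddCommGroup M] [Module O M] (hM : IsPiSeparated π M)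
    {f g : PiCompletion π A →ₗ[O] M} (h : ∀ a, f (of π A a) = g (of π A a)) (v) : f v = g v := by
  rw [← sub_eq_zero]
  refine hM _ fun n => ?_
  obtain ⟨a, w, rfl⟩ := exists_of_add_pow_smul n v
  exact ⟨f w - g w, by simp [h, smul_sub]⟩

/-- A set of elements that is stable under division by `π` contains at most the zero element. -/
lemma eq_zero_of_divisible {M : Type*} [AddCommGroup M] [Module O M] (hM : IsPiSeparated π M)
    (P : M → Prop) (hP : ∀ v, P v → ∃ w, P w ∧ v = π • w) {v : M} (hv : P v) : v = 0 := by
  refine hM _ fun n => ?_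
  suffices ∃ w, P w ∧ v = π ^ n • w from ⟨this.choose, this.choose_spec.2⟩
  induction n with
  | zero => exact ⟨v, hv, by simp⟩
  | succ n ih =>
    obtain ⟨w, hw, rfl⟩ := ih
    obtain ⟨z, hz, rfl⟩ := hP w hw
    exact ⟨z, hz, by rw [smul_smul, pow_succ]⟩

variable {C : Type*} [Ring C] [Algebra O C] (hC : Function.Bijective (of π C))

/-- A homomorphism to a `π`-adically complete algebra extends to the completion. -/
def extend (f : A →ₐ[O] C) : PiCompletion π A →ₐ[O] C :=
  (AlgEquiv.ofBijective (of π C) hC).symm.toAlgHom.comp (map π f)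

@[simp] lemma extend_of (f : A →ₐ[O] C) (a : A) : extend hC f (of π A a) = f a := by
  change (AlgEquiv.ofBijective (of π C) hC).symm (of π C (f a)) = f a
  rw [AlgEquiv.symm_apply_eq]
  rfl

end PiCompletion

/-! ### Endomorphisms of power series are `π`-adically complete. -/

section PowerSeriesEnd

open PiCompletion

variable {σ : Type*}

lemma isPiSeparated_of_injective {A : Type*} [Ring A] [Algebra O A]
    (h : Function.Injective (of π A)) : IsPiSeparated π A := by
  intro a ha
  refine h (ext_val fun n => ?_)
  rw [map_zero]
  exact Ideal.Quotient.eq_zero_iff_mem.2 (ha n)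

lemma isPiSeparated_mvPowerSeries (hO : IsPiSeparated π O) :
    IsPiSeparated π (MvPowerSeries σ O) := by
  intro f hf
  ext m
  refine hO _ fun n => ?_
  obtain ⟨g, rfl⟩ := hf n
  exact ⟨MvPowerSeries.coeff m g, by simp⟩

lemma isPiSeparated_end {M : Type*} [AddCommGroup M] [Module O M] (hM : IsPiSeparated π M) :
    IsPiSeparated π (Module.End O M) := by
  intro T hT
  ext f
  refine hM _ fun n => ?_
  obtain ⟨S, rfl⟩ := hT n
  exact ⟨S f, rfl⟩

variable (hO : Function.Bijective (of π O))

/-- The sum `∑ πᵏ cₖ` in a complete ring. -/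
def seriesSum : (ℕ → O) →ₗ[O] O where
  toFun c := (AlgEquiv.ofBijective (of π O) hO).symm (series π c)
  map_add' c d := by rw [series_add, map_add]
  map_smul' a c := by rw [series_smul, map_smul, RingHom.id_apply]

lemma seriesSum_eq (c : ℕ → O) : seriesSum hO c = c 0 + π • seriesSum hO fun k => c (k + 1) := by
  change (AlgEquiv.ofBijective (of π O) hO).symm (series π c) = _
  rw [AlgEquiv.symm_apply_eq, map_add, map_smul, series_eq]
  exact congrArg (fun z => of π O (c 0) + π • z)
    ((AlgEquiv.ofBijective (of π O) hO).apply_symm_apply (series π fun k => c (k + 1))).symm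

/-- The endomorphism `∑ πᵏ Tₖ` of a module of power series. -/
def endSum (T : ℕ → Module.End O (MvPowerSeries σ O)) : Module.End O (MvPowerSeries σ O) where
  toFun f := fun m => seriesSum hO fun k => MvPowerSeries.coeff m (T k f)
  map_add' f g := by
    ext m
    change seriesSum hO _ = seriesSum hO _ + seriesSum hO _
    rw [← map_add]
    congr 1
    ext k
    simp
  map_smul' a f := by
    ext m
    change seriesSum hO _ = a • seriesSum hO _
    rw [← map_smul]
    congr 1
    ext k
    simp

lemma endSum_eq (T : ℕ → Module.End O (MvPowerSeries σ O)) :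
    endSum hO T = T 0 + π • endSum hO fun k => T (k + 1) := by
  ext f m
  change seriesSum hO _ = MvPowerSeries.coeff m (T 0 f) + π • seriesSum hO _
  rw [seriesSum_eq]

/-- A series `∑ πᵏ Tₖ` is summed coefficient by coefficient in `O`. This supplies the complete
target through which actions of the Weyl algebra on power series extend to its completion. -/
lemma end_bijective (hO : Function.Bijective (of π O)) : Function.Bijective (of π (Module.End O (MvPowerSeries σ O))) := by
  have hsep := isPiSeparated_end (isPiSeparated_mvPowerSeries (σ := σ)
    (isPiSeparated_of_injective hO.1))
  constructor
  · rw [injective_iff_map_eq_zero]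
    intro T hT
    refine hsep T fun n => ?_
    exact Ideal.Quotient.eq_zero_iff_mem.1 (congrFun (congrArg Subtype.val hT) n)
  · intro v
    obtain ⟨T, rfl⟩ := exists_series v
    refine ⟨endSum hO T, ext_val fun n => ?_⟩
    refine mk_eq_mk_iff.2 ⟨endSum hO fun k => T (n + k), ?_⟩
    rw [sub_eq_iff_eq_add']
    induction n with
    | zero => simp
    | succ n ih =>
      rw [ih, endSum_eq, Finset.sum_range_succ, smul_add, smul_smul, ← pow_succ, add_zero, add_assoc]
      simp only [add_assoc, add_comm 1]

end PowerSeriesEnd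

end CompletionSeries

end AffinoidDixmier

namespace AffinoidDixmier

/-! ### The completed Weyl algebra and its symbols. -/

namespace WeylAlgebra

open PiCompletion

variable {O : Type*} [CommRing O] {π : O} (hO : Function.Bijective (PiCompletion.of π O)) (r : ℕ)

/-- The action of the completed Weyl algebra on power series in `t`. -/
def hatRep : PiCompletion π (WeylAlgebra O r) →ₐ[O] Module.End O (MvPowerSeries (Fin r) O) :=
  extend (end_bijective hO) (seriesRep O r)

/-- The action of the completed Weyl algebra on power series in `t` and `ξ`. -/
def hatSymbolRep :
    PiCompletion π (WeylAlgebra O r) →ₐ[O] Module.End O (MvPowerSeries (Fin r ⊕ Fin r) O) :=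
  extend (end_bijective hO) (seriesSymbolRep O r)

variable {r}

@[simp] lemma hatRep_of (P : WeylAlgebra O r) : hatRep hO r (of π _ P) = seriesRep O r P :=
  extend_of _ _ _

@[simp] lemma hatSymbolRep_of (P : WeylAlgebra O r) :
    hatSymbolRep hO r (of π _ P) = seriesSymbolRep O r P :=
  extend_of _ _ _

variable (r) in
/-- The symbol of an element of the completed Weyl algebra. -/
def hatSymbol : PiCompletion π (WeylAlgebra O r) →ₗ[O] MvPowerSeries (Fin r ⊕ Fin r) O :=
  LinearMap.applyₗ (1 : MvPowerSeries (Fin r ⊕ Fin r) O) ∘ₗ (hatSymbolRep hO r).toLinearMap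

lemma hatSymbol_apply (w : PiCompletion π (WeylAlgebra O r)) :
    hatSymbol hO r w = hatSymbolRep hO r w 1 := rfl

lemma hatSymbol_of (P : WeylAlgebra O r) :
    hatSymbol hO r (of π _ P) = (symbol O r P : MvPowerSeries (Fin r ⊕ Fin r) O) := by
  rw [hatSymbol_apply, hatSymbolRep_of, symbol_apply, ← seriesSymbolRep_coe, MvPolynomial.coe_one]

variable (O r) in
/-- Setting `ξ = 0`. -/
def evalZero : MvPowerSeries (Fin r ⊕ Fin r) O →ₗ[O] MvPowerSeries (Fin r) O where
  toFun f := fun a => MvPowerSeries.coeff (a.embDomain Function.Embedding.inl) f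
  map_add' f g := by ext a; exact map_add (MvPowerSeries.coeff _) f g
  map_smul' c f := by ext a; exact map_smul (MvPowerSeries.coeff (R := O) _) c f

lemma coeff_evalZero (f : MvPowerSeries (Fin r ⊕ Fin r) O) (a : Fin r →₀ ℕ) :
    MvPowerSeries.coeff a (evalZero O r f) =
      MvPowerSeries.coeff (a.embDomain Function.Embedding.inl) f := rfl

lemma coeff_X_mul_of_eq_zero {σ : Type*} (s : σ) (m : σ →₀ ℕ) (h : m s = 0)
    (f : MvPowerSeries σ O) : MvPowerSeries.coeff m (MvPowerSeries.X s * f) = 0 :=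
  MvPowerSeries.X_dvd_iff.1 (dvd_mul_right _ f) m h

lemma coeff_X_mul_add_single {σ : Type*} (s : σ) (m : σ →₀ ℕ)
    (f : MvPowerSeries σ O) : MvPowerSeries.coeff (m + Finsupp.single s 1) (MvPowerSeries.X s * f) =
      MvPowerSeries.coeff m f := by
  rw [add_comm, MvPowerSeries.X, MvPowerSeries.coeff_add_monomial_mul, one_mul]

lemma embDomain_add_single (a : Fin r →₀ ℕ) (i : Fin r) :
    (a + Finsupp.single i 1).embDomain Function.Embedding.inl =
      (a.embDomain Function.Embedding.inl + Finsupp.single (Sum.inl i) 1 : Fin r ⊕ Fin r →₀ ℕ) := by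
  rw [Finsupp.embDomain_add, Finsupp.embDomain_single]
  rfl

lemma embDomain_apply_inl (a : Fin r →₀ ℕ) (i : Fin r) :
    a.embDomain (Function.Embedding.inl (β := Fin r)) (Sum.inl i) = a i :=
  Finsupp.embDomain_apply_self Function.Embedding.inl a i

lemma embDomain_apply_inr (a : Fin r →₀ ℕ) (i : Fin r) :
    a.embDomain (Function.Embedding.inl (β := Fin r)) (Sum.inr i) = 0 :=
  Finsupp.embDomain_of_notMem_range _ _ _ (by simp)

/-- At `ξ = 0` the operator `∂/∂t + ξ` becomes `∂/∂t`. Hence the part of the symbol free of `ξ` is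
the value of the operator at `1`. -/
lemma evalZero_seriesSymbolRep (P : WeylAlgebra O r) (f : MvPowerSeries (Fin r ⊕ Fin r) O) :
    evalZero O r (seriesSymbolRep O r P f) = seriesRep O r P (evalZero O r f) := by
  refine intertwine _ _ _ ?_ P f
  rintro (i | i) m
  · rw [seriesSymbolRep_x, seriesRep_x]
    ext a
    rw [coeff_evalZero, map_add, coeff_X_mul_of_eq_zero _ _ (embDomain_apply_inr a i), add_zero,
      MvPowerSeries.coeff_pderiv, MvPowerSeries.coeff_pderiv, coeff_evalZero, embDomain_add_single,
      embDomain_apply_inl]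
  · rw [seriesSymbolRep_y, seriesRep_y]
    ext a
    rw [coeff_evalZero]
    by_cases h : a i = 0
    · rw [coeff_X_mul_of_eq_zero _ _ h, coeff_X_mul_of_eq_zero _ _ (by rwa [embDomain_apply_inl])]
    · obtain ⟨a, rfl⟩ : ∃ a', a = a' + Finsupp.single i 1 :=
        ⟨_, (Finsupp.sub_add_single_one_cancel h).symm⟩
      rw [embDomain_add_single, coeff_X_mul_add_single, coeff_X_mul_add_single, coeff_evalZero]

lemma evalZero_hatSymbol (w : PiCompletion π (WeylAlgebra O r)) :
    evalZero O r (hatSymbol hO r w) = hatRep hO r w 1 := by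
  refine linear_ext (isPiSeparated_mvPowerSeries (isPiSeparated_of_injective hO.1))
    (f := evalZero O r ∘ₗ hatSymbol hO r)
    (g := LinearMap.applyₗ (1 : MvPowerSeries (Fin r) O) ∘ₗ (hatRep hO r).toLinearMap)
    (fun P => ?_) w
  have h1 : evalZero O r 1 = 1 := by
    classical
    ext a
    rw [coeff_evalZero, MvPowerSeries.coeff_one, MvPowerSeries.coeff_one]
    simp only [Finsupp.embDomain_eq_zero]
  simp only [LinearMap.comp_apply, hatSymbol_apply, AlgHom.toLinearMap_apply, hatSymbolRep_of,
    hatRep_of, LinearMap.applyₗ_apply_apply]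
  rw [evalZero_seriesSymbolRep, h1]

/-- This gives access to the coefficients with positive `ξ`-degree: they are reached from the
`ξ`-free part by taking commutators with the `yᵢ`. -/
lemma hatSymbol_commutator (w : PiCompletion π (WeylAlgebra O r)) (i : Fin r) :
    hatSymbol hO r (w * of π _ (gen O r (.inr i)) - of π _ (gen O r (.inr i)) * w) =
      MvPowerSeries.pderiv O (.inr i) (hatSymbol hO r w) := by
  refine linear_ext (isPiSeparated_mvPowerSeries (isPiSeparated_of_injective hO.1))
    (f := hatSymbol hO r ∘ₗ (LinearMap.mulRight O (of π _ (gen O r (.inr i))) -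
      LinearMap.mulLeft O (of π _ (gen O r (.inr i)))))
    (g := (MvPowerSeries.pderiv O (Sum.inr i)).toLinearMap ∘ₗ hatSymbol hO r) (fun P => ?_) w
  -- The operator `∂/∂ξᵢ + tᵢ` commutes with `∂/∂tⱼ + ξⱼ` and with `tⱼ`, the two contributions for
  -- `i = j` cancelling. Evaluating at `1`, where `F 1 = tᵢ`, gives the formula.
  let F : MvPowerSeries (Fin r ⊕ Fin r) O →ₗ[O] MvPowerSeries (Fin r ⊕ Fin r) O :=
    (MvPowerSeries.pderiv O (Sum.inr i)).toLinearMap + LinearMap.mulLeft O (MvPowerSeries.X (.inl i))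
  have hF : ∀ f, F f = MvPowerSeries.pderiv O (.inr i) f + MvPowerSeries.X (.inl i) * f :=
    fun f => rfl
  have hcomm := intertwine (seriesSymbolRep O r) (seriesSymbolRep O r) F (by
    rintro (j | j) m
    · rw [seriesSymbolRep_x, seriesSymbolRep_x, hF, hF, map_add, map_add,
        mvPowerSeries_pderiv_comm (Sum.inr i)]
      by_cases h : i = j
      · subst h; simp; ring
      · simp [h, Ne.symm h]; ring
    · rw [seriesSymbolRep_y, seriesSymbolRep_y, hF, hF]
      simp
      ring) P 1
  rw [hF, hF] at hcomm
  simp only [LinearMap.comp_apply, LinearMap.sub_apply, LinearMap.mulRight_apply,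
    LinearMap.mulLeft_apply, ← map_mul, ← map_sub, hatSymbol_apply, hatSymbolRep_of]
  rw [map_sub, map_mul, map_mul, LinearMap.sub_apply, Module.End.mul_apply, Module.End.mul_apply,
    seriesSymbolRep_y, seriesSymbolRep_y]
  rw [MvPowerSeries.pderiv_one, zero_add] at hcomm
  rw [← hcomm, add_sub_cancel_right]
  rfl

/-! ### The completed Weyl algebra is torsion-free, without zero divisors, and faithful on
polynomials. -/

section Domain

variable [IsDomain O] (hπ : π ≠ 0)

include hπ in
-- Modulo `π` the element `w` is an honest operator `P`, whose polynomial symbol is then divisible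
-- by `π`; normal ordering divides `P` itself. Iterating with `f = 0` yields injectivity of the
-- symbol.
lemma exists_eq_smul_of_hatSymbol {w : PiCompletion π (WeylAlgebra O r)}
    {f : MvPowerSeries (Fin r ⊕ Fin r) O} (h : hatSymbol hO r w = π • f) :
    ∃ w', w = π • w' ∧ hatSymbol hO r w' = f := by
  obtain ⟨P, z, rfl⟩ := exists_of_add_smul w
  have hdvd : MvPolynomial.C π ∣ symbol O r P := by
    rw [MvPolynomial.C_dvd_iff_dvd_coeff]
    intro m
    rw [map_add, map_smul, hatSymbol_of] at h
    refine ⟨MvPowerSeries.coeff m f - MvPowerSeries.coeff m (hatSymbol hO r z), ?_⟩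
    have := congrArg (MvPowerSeries.coeff m) h
    simp only [map_add, MvPowerSeries.coeff_smul, MvPolynomial.coeff_coe] at this
    rw [mul_sub, ← this, add_sub_cancel_right]
  obtain ⟨q, hq⟩ := hdvd
  obtain ⟨Q, rfl⟩ := exists_eq_smul_of_symbol (hq.trans (MvPolynomial.smul_eq_C_mul _ _).symm)
  refine ⟨of π _ Q + z, by rw [smul_add, map_smul], ?_⟩
  rw [map_smul, ← smul_add, map_smul] at h
  ext m
  have := congrArg (MvPowerSeries.coeff m) h
  rw [MvPowerSeries.coeff_smul, MvPowerSeries.coeff_smul] at this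
  exact mul_left_cancel₀ hπ this

include hπ in
lemma hatSymbol_injective : Function.Injective (hatSymbol hO r) := by
  rw [injective_iff_map_eq_zero]
  intro w hw
  refine eq_zero_of_divisible isPiSeparated (fun w => hatSymbol hO r w = 0) (fun v hv => ?_) hw
  obtain ⟨w', h1, h2⟩ := exists_eq_smul_of_hatSymbol hO hπ (hv.trans (smul_zero π).symm)
  exact ⟨w', h2, h1⟩

include hO hπ in
lemma smul_eq_zero_of_completion {a : O} (ha : a ≠ 0) {w : PiCompletion π (WeylAlgebra O r)}
    (h : a • w = 0) : w = 0 := by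
  apply hatSymbol_injective hO hπ
  have := congrArg (hatSymbol hO r) h
  rw [map_smul, map_zero] at this
  rw [map_zero]
  ext m
  have hm := congrArg (MvPowerSeries.coeff m) this
  rw [MvPowerSeries.coeff_smul, map_zero] at hm
  exact (mul_eq_zero.1 hm).resolve_left ha

include hO hπ in
-- Divide both factors by the largest power of `π`. The remaining product is still zero, and modulo
-- `π` it is a product in a Weyl algebra over a domain, so one factor is divisible by `π` once more.
lemma mul_eq_zero_of_completion (hprime : (Ideal.span {π}).IsPrime)
    {v w : PiCompletion π (WeylAlgebra O r)} (h : v * w = 0) : v = 0 ∨ w = 0 := by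
  have hex : ∀ v : PiCompletion π (WeylAlgebra O r), v ≠ 0 →
      ∃ (n : ℕ) (z : _), v = π ^ n • z ∧ ¬ ∃ z', z = π • z' := by
    intro v hv
    by_contra! hcon
    refine hv (eq_zero_of_divisible isPiSeparated (fun z => ∃ n : ℕ, v = π ^ n • z) ?_
      (v := v) ⟨0, by simp⟩)
    rintro z ⟨n, hz⟩
    obtain ⟨z', rfl⟩ := hcon n z hz
    exact ⟨z', ⟨n + 1, by rw [hz, smul_smul, pow_succ]⟩, rfl⟩
  by_contra! hne
  obtain ⟨m, v, rfl, hv⟩ := hex v hne.1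
  obtain ⟨n, w, rfl, hw⟩ := hex w hne.2
  rw [smul_mul_smul_comm, ← pow_add] at h
  replace h := smul_eq_zero_of_completion hO hπ (pow_ne_zero _ hπ) h
  obtain ⟨P, v, rfl⟩ := exists_of_add_smul v
  obtain ⟨Q, w, rfl⟩ := exists_of_add_smul w
  have h2 : of π _ (P * Q) = π • (-(v * of π _ Q + of π _ P * w + v * (π • w))) := by
    rw [map_mul, smul_neg, eq_neg_iff_add_eq_zero, ← h]
    simp only [smul_add, mul_add, add_mul, smul_mul_assoc, mul_smul_comm]
    abel
  obtain ⟨S, hS⟩ := exists_eq_smul_of h2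
  rcases prime_smul hprime hS with ⟨P', rfl⟩ | ⟨Q', rfl⟩
  · exact hv ⟨of π _ P' + v, by rw [smul_add, map_smul]⟩
  · exact hw ⟨of π _ Q' + w, by rw [smul_add, map_smul]⟩

include hπ in
/-- The completed Weyl algebra acts faithfully on polynomials. -/
lemma eq_zero_of_hatRep [CharZero O] {w : PiCompletion π (WeylAlgebra O r)}
    (hw : ∀ q : MvPolynomial (Fin r) O, hatRep hO r w (q : MvPowerSeries (Fin r) O) = 0) :
    w = 0 := by
  apply hatSymbol_injective hO hπ
  rw [map_zero]
  -- Induction on the `ξ`-degree `n`, for all such `w` at once: the operators killing every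
  -- polynomial are stable under commutators with `yᵢ`. A commutator lowers the degree and
  -- multiplies the coefficient by a nonzero integer, which characteristic zero allows to cancel.
  suffices ∀ n, ∀ m : Fin r ⊕ Fin r →₀ ℕ, ∑ i, m (Sum.inr i) = n →
      ∀ w : PiCompletion π (WeylAlgebra O r),
      (∀ q : MvPolynomial (Fin r) O, hatRep hO r w (q : MvPowerSeries (Fin r) O) = 0) →
      MvPowerSeries.coeff m (hatSymbol hO r w) = 0 by
    ext m
    exact this _ m rfl w hw
  intro n
  induction n with
  | zero =>
    intro m hm w hw
    have h1 : m = (m.comapDomain Sum.inl Sum.inl_injective.injOn).embDomain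
        Function.Embedding.inl := by
      refine Finsupp.ext fun s => ?_
      rcases s with i | i
      · rw [embDomain_apply_inl, Finsupp.comapDomain_apply]
      · rw [embDomain_apply_inr]
        exact Finset.sum_eq_zero_iff.1 hm i (Finset.mem_univ i)
    rw [h1, ← coeff_evalZero, evalZero_hatSymbol, ← MvPolynomial.coe_one, hw, map_zero]
  | succ n ih =>
    intro m hm w hw
    obtain ⟨i, _, hi⟩ := Finset.exists_ne_zero_of_sum_ne_zero (hm.trans_ne n.succ_ne_zero)
    obtain ⟨m, rfl⟩ : ∃ m', m = m' + Finsupp.single (Sum.inr i) 1 :=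
      ⟨_, (Finsupp.sub_add_single_one_cancel hi).symm⟩
    have h1 := ih m (by
      simp only [Finsupp.add_apply, Finset.sum_add_distrib] at hm
      have h1 : ∑ j, (Finsupp.single (Sum.inr i : Fin r ⊕ Fin r) 1 : _ →₀ ℕ) (Sum.inr j) = 1 := by
        classical
        simp [Finsupp.single_apply]
      omega) (w * of π _ (gen O r (.inr i)) - of π _ (gen O r (.inr i)) * w) (fun q => by
        have := hw (MvPolynomial.X i * q)
        rw [map_sub, map_mul, map_mul, LinearMap.sub_apply, Module.End.mul_apply,
          Module.End.mul_apply, hw, map_zero, sub_zero, hatRep_of, seriesRep_coe, polyRep_y, this])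
    rw [hatSymbol_commutator, MvPowerSeries.coeff_pderiv] at h1
    refine (mul_eq_zero.1 h1).resolve_right ?_
    exact_mod_cast Nat.succ_ne_zero (m (Sum.inr i))

end Domain

end WeylAlgebra
end AffinoidDixmier

namespace AffinoidDixmier

/-! ### Separated modules of bounded rank are finite. -/

section LatticeFinite

open PiCompletion

variable {O : Type*} [CommRing O] [IsDomain O] {π : O}

/-- Over a complete valuation ring, a separated torsion-free module of bounded rank is finite. -/
theorem finite_of_isPiSeparated (hO : Function.Bijective (of π O)) (hπ : π ≠ 0)
    (hu : ∀ a : O, π ∣ a ∨ IsUnit a)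
    {M : Type*} [AddCommGroup M] [Module O M] [Module.IsTorsionFree O M] (hM : IsPiSeparated π M)
    (d : ℕ) (hd : ∀ n (v : Fin n → M), LinearIndependent O v → n ≤ d) : Module.Finite O M := by
  have hOs := isPiSeparated_of_injective hO.1
  -- Independence modulo `π`. It implies independence over `O` by repeated division, which bounds
  -- `n` by `d`.
  let Q : ∀ n, (Fin n → M) → Prop := fun n v =>
    ∀ c : Fin n → O, (∃ m, ∑ i, c i • v i = π • m) → ∀ i, π ∣ c i
  have hQ : ∀ n v, Q n v → n ≤ d := by
    intro n v hv
    refine hd n v (Fintype.linearIndependent_iff.2 fun c hc => ?_)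
    have hsep : IsPiSeparated π (Fin n → O) := fun c hc => funext fun i => hOs _ fun k => by
      obtain ⟨c', rfl⟩ := hc k
      exact ⟨c' i, rfl⟩
    refine congrFun (eq_zero_of_divisible hsep (fun c => ∑ i, c i • v i = 0) (fun c hc => ?_) hc)
    choose c' hc' using hv c ⟨0, by rw [hc, smul_zero]⟩
    obtain rfl : c = π • c' := funext hc'
    refine ⟨c', ?_, rfl⟩
    simp only [Pi.smul_apply, smul_assoc, ← Finset.smul_sum] at hc
    exact (smul_eq_zero.1 hc).resolve_left hπ
  classical
  have hex : ∃ n, ∃ v, Q n v := ⟨0, Fin.elim0, fun _ _ i => i.elim0⟩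
  let n := Nat.findGreatest (fun n => ∃ v, Q n v) d
  obtain ⟨v, hv⟩ : ∃ v, Q n v := by
    obtain ⟨k, v, hv⟩ := hex
    exact Nat.findGreatest_spec (P := fun n => ∃ v, Q n v) (hQ k v hv) ⟨v, hv⟩
  have hnot : ∀ w, ¬ Q (n + 1) w := fun w hw =>
    absurd (Nat.le_findGreatest (P := fun n => ∃ v, Q n v) (hQ _ w hw) ⟨w, hw⟩) (by omega)
  -- By maximality of `n`, adjoining `m` creates a relation modulo `π`; the coefficient of `m` is a
  -- unit, because otherwise the `v i` would already be dependent modulo `π`.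
  have hgen : ∀ m : M, ∃ (c : Fin n → O) (z : M), m = ∑ i, c i • v i + π • z := by
    intro m
    have h1 := hnot (Fin.cons m v)
    simp only [Q, not_forall] at h1
    obtain ⟨c, ⟨z, hz⟩, i, hi⟩ := h1
    rw [Fin.sum_univ_succ] at hz
    simp only [Fin.cons_zero, Fin.cons_succ] at hz
    have h0 : ¬ π ∣ c 0 := by
      rintro ⟨a, ha⟩
      have h2 := hv (fun i => c i.succ) ⟨z - a • m, by
        rw [smul_sub, ← hz, ha, smul_smul, add_sub_cancel_left]⟩
      refine hi (Fin.cases ⟨a, ha⟩ h2 i)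
    obtain ⟨u, hu⟩ := (hu (c 0)).resolve_left h0
    refine ⟨fun i => -((u⁻¹ : Oˣ) : O) * c i.succ, ((u⁻¹ : Oˣ) : O) • z, ?_⟩
    rw [smul_comm, ← hz, smul_add, ← hu, smul_smul, Units.inv_mul, one_smul, Finset.smul_sum]
    simp only [neg_mul, neg_smul, mul_smul, Finset.sum_neg_distrib]
    abel
  choose c z hcz using hgen
  -- The iterates of `z` produce the successive `π`-adic digits of the coordinates of `m`. The
  -- remainder is divisible by every power of `π`, hence zero.
  let R : M → M := fun m => m - ∑ i, (seriesSum hO fun k => c (z^[k] m) i) • v i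
  have hR : ∀ m, R m = π • R (z m) := by
    intro m
    have e : ∀ i, (seriesSum hO fun k => c (z^[k] m) i) =
        c m i + π • seriesSum hO fun k => c (z^[k] (z m)) i := fun i => seriesSum_eq hO _
    have h1 : m - ∑ i, c m i • v i = π • z m := sub_eq_iff_eq_add'.2 (hcz m)
    simp only [R, e, add_smul, Finset.sum_add_distrib]
    rw [← sub_sub, h1, smul_sub, Finset.smul_sum]
    simp only [smul_assoc]
  refine ⟨⟨Finset.univ.image v, eq_top_iff.2 fun m _ => ?_⟩⟩
  have h0 : R m = 0 := eq_zero_of_divisible hM (fun w => ∃ m, w = R m)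
    (by rintro _ ⟨m, rfl⟩; exact ⟨R (z m), ⟨_, rfl⟩, hR m⟩) ⟨m, rfl⟩
  rw [sub_eq_zero.1 h0]
  exact Submodule.sum_mem _ fun i _ => Submodule.smul_mem _ _ (Submodule.subset_span (by simp))

end LatticeFinite

/-! ### The valuation ring and Lie lattices over it. -/

section Integers

variable {p : ℕ} [Fact p.Prime] {K : Type*} [Field K] [Algebra ℚ_[p] K]
  [FiniteDimensional ℚ_[p] K] {π : integers p K} (hπ : Irreducible π)

include hπ

lemma dvd_or_isUnit (a : integers p K) : π ∣ a ∨ IsUnit a := by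
  rcases ValuationRing.dvd_total π a with h | ⟨w, hw⟩
  · exact Or.inl h
  · rcases hπ.isUnit_or_isUnit hw with h | h
    · exact Or.inr h
    · left
      obtain ⟨u, rfl⟩ := h
      exact ⟨((u⁻¹ : (integers p K)ˣ) : integers p K), by rw [hw, mul_assoc, Units.mul_inv, mul_one]⟩

/-- An element that is never a unit times a power of `π` could be divided by `π` indefinitely,
contradicting separatedness. -/
lemma isDiscreteValuationRing : IsDiscreteValuationRing (integers p K) := by
  refine IsDiscreteValuationRing.ofHasUnitMulPowIrreducibleFactorization ⟨π, hπ, fun {x} hx => ?_⟩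
  by_contra! hcon
  refine hx (PiCompletion.eq_zero_of_divisible (isPiSeparated_of_injective (of_bijective hπ).1)
    (fun y => ∃ n, π ^ n * y = x) ?_ ⟨0, by simp⟩)
  rintro y ⟨n, rfl⟩
  rcases dvd_or_isUnit hπ y with ⟨z, rfl⟩ | ⟨u, rfl⟩
  · exact ⟨z, ⟨n + 1, by ring⟩, rfl⟩
  · exact absurd ⟨u, rfl⟩ (hcon n)

lemma isPrime_span : (Ideal.span {π}).IsPrime := by
  have := isDiscreteValuationRing hπ
  exact (Ideal.span_singleton_prime hπ.ne_zero).2 hπ.prime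

end Integers

section Integers

variable {p : ℕ} [Fact p.Prime] {K : Type*} [Field K] [Algebra ℚ_[p] K]
  [FiniteDimensional ℚ_[p] K] {π : integers p K} (hπ : Irreducible π)

variable (p K) in
lemma charZero_integers : CharZero (integers p K) := by
  have : CharZero K := charZero_of_injective_algebraMap (algebraMap ℚ_[p] K).injective
  exact (algebraMap (integers p K) K).charZero

/-- Legendre's formula: `(p - 1) v_p(n!)` is `n` minus the digit sum of `n`, so `v_p(n!) ≤ n`, also
for `p = 2`. -/
lemma norm_pow_div_factorial_le (n : ℕ) : ‖((p : ℚ_[p]) ^ n / (n.factorial : ℚ_[p]))‖ ≤ 1 := by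
  have hp : 1 < p := (Fact.out : p.Prime).one_lt
  have hv : padicValNat p n.factorial ≤ n := by
    have h := sub_one_mul_padicValNat_factorial (p := p) n
    have h1 : 1 * padicValNat p n.factorial ≤ (p - 1) * padicValNat p n.factorial :=
      Nat.mul_le_mul_right _ (by omega)
    omega
  have h0 : (n.factorial : ℚ_[p]) ≠ 0 := Nat.cast_ne_zero.2 n.factorial_ne_zero
  rw [norm_div, Padic.norm_p_pow, Padic.norm_eq_zpow_neg_valuation h0, Padic.valuation_natCast,
    ← zpow_sub₀ (by positivity)]
  apply zpow_le_one_of_nonpos₀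
  · exact_mod_cast hp.le
  · omega

variable (p K) in
lemma exists_isDividedPowers : ∃ c : ℕ → integers p K, IsDividedPowers p c := by
  refine ⟨fun n => ⟨algebraMap ℚ_[p] K ((p : ℚ_[p]) ^ n / (n.factorial : ℚ_[p])), ?_⟩, fun n => ?_⟩
  · change spectralNorm ℚ_[p] K _ ≤ 1
    rw [spectralNorm_extends]
    exact norm_pow_div_factorial_le n
  · apply Subtype.ext
    have := charZero_of_injective_algebraMap (algebraMap ℚ_[p] K).injective
    have h0 : (n.factorial : K) ≠ 0 := Nat.cast_ne_zero.2 n.factorial_ne_zero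
    push_cast
    field_simp

variable {g : Type*} [LieRing g] [LieAlgebra K g]
  {L : LieSubalgebra (integers p K) g}

lemma isPiSeparated_lattice (hL : IsLattice π L.toSubmodule) : IsPiSeparated π L := fun x hx =>
  Subtype.ext (hL.separated _ fun n => by
    obtain ⟨y, rfl⟩ := hx n
    exact ⟨y, y.2, rfl⟩)

lemma isTorsionFree_lattice : Module.IsTorsionFree (integers p K) L := by
  refine Module.IsTorsionFree.of_smul_eq_zero fun a x h => ?_
  have h1 : (a : K) • (x : g) = 0 := congrArg Subtype.val h
  exact (smul_eq_zero.1 h1).imp (fun h => Subtype.ext h) fun h => Subtype.ext h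

variable [FiniteDimensional K g]

include hπ in
-- Vectors of `L` independent over `𝒪` remain independent over the fraction field `K`, so the rank
-- is bounded by `dim g`.
lemma finite_lattice (hL : IsLattice π L.toSubmodule) : Module.Finite (integers p K) L := by
  have := isTorsionFree_lattice (L := L)
  refine finite_of_isPiSeparated (of_bijective hπ) hπ.ne_zero (dvd_or_isUnit hπ)
    (isPiSeparated_lattice hL) (Module.finrank K g) fun n v hv => ?_
  have h1 : LinearIndependent (integers p K) (L.toSubmodule.subtype ∘ v) :=
    hv.map' L.toSubmodule.subtype L.toSubmodule.ker_subtype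
  have h2 := (LinearIndependent.iff_fractionRing (integers p K) K).1 h1
  simpa using h2.fintype_card_le_finrank

include hπ in
-- An `𝒪`-basis of `L/𝓑`, which is free because `𝓑` is saturated, becomes a `K`-basis of `g/b`: it
-- embeds because `𝓑` is the kernel of `L → g/b`, and spans because `L` spans `g`.
lemma finrank_quotient_latticePart (hL : IsLattice π L.toSubmodule) (b : LieSubalgebra K g) :
    Module.finrank (integers p K) (L ⧸ (latticePart L b).toSubmodule) =
      Module.finrank K (g ⧸ b.toSubmodule) := by
  have := isDiscreteValuationRing hπ
  have := finite_lattice hπ hL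
  have := isTorsionFree_quotient (latticePart L b).toSubmodule (by
    intro a x ha hx
    have h1 : (a : K) • (x : g) ∈ b.toSubmodule := hx
    exact (b.toSubmodule.smul_mem_iff (fun h => ha (Subtype.ext h))).1 h1)
  let β := Module.Free.chooseBasis (integers p K) (L ⧸ (latticePart L b).toSubmodule)
  let F : L →ₗ[integers p K] g ⧸ b.toSubmodule :=
    (b.toSubmodule.mkQ.restrictScalars (integers p K)) ∘ₗ L.toSubmodule.subtype
  have hker : LinearMap.ker F = (latticePart L b).toSubmodule := by
    ext x
    exact Submodule.Quotient.mk_eq_zero b.toSubmodule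
  let G : (L ⧸ (latticePart L b).toSubmodule) →ₗ[integers p K] g ⧸ b.toSubmodule :=
    (latticePart L b).toSubmodule.liftQ F hker.ge
  have hG : LinearMap.ker G = ⊥ := Submodule.ker_liftQ_eq_bot _ _ _ hker.le
  have h1 : LinearIndependent K (G ∘ β) :=
    (LinearIndependent.iff_fractionRing (integers p K) K).1 (β.linearIndependent.map' G hG)
  have h2 : ⊤ ≤ Submodule.span K (Set.range (G ∘ β)) := by
    have h3 : ∀ x, G x ∈ Submodule.span K (Set.range (G ∘ β)) := by
      intro x
      rw [← β.sum_repr x, map_sum]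
      refine Submodule.sum_mem _ fun i _ => ?_
      rw [map_smul]
      exact Submodule.smul_mem _ ((β.repr x i : integers p K) : K) (Submodule.subset_span ⟨i, rfl⟩)
    have h4 : Submodule.span K (L.toSubmodule : Set g) ≤
        (Submodule.span K (Set.range (G ∘ β))).comap b.toSubmodule.mkQ :=
      Submodule.span_le.2 fun x hx => h3 (Submodule.Quotient.mk ⟨x, hx⟩)
    rw [hL.span_eq_top] at h4
    rintro y -
    obtain ⟨x, rfl⟩ := b.toSubmodule.mkQ_surjective y
    exact h4 trivial
  rw [Module.finrank_eq_card_basis β, Module.finrank_eq_card_basis (Module.Basis.mk h1 h2)]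

end Integers

end AffinoidDixmier

namespace AffinoidDixmier

/-! ### Clearing denominators in the completion tensored with `K`. -/

section ToK

variable {O : Type*} [CommRing O] {π : O} (K : Type*) [Field K] [Algebra O K]
  {A B : Type*} [Ring A] [Algebra O A] [Ring B] [Algebra O B]

/-- The canonical map from `Â` to `Â ⊗ K`. -/
def toK : PiCompletion π A →+* CompletionK π K A :=
  (Algebra.TensorProduct.includeRight : PiCompletion π A →ₐ[O] K ⊗[O] PiCompletion π A).toRingHom

lemma smul_toK (s : O) (v : PiCompletion π A) : algebraMap O K s • toK K v = toK K (s • v) := by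
  change algebraMap O K s • ((1 : K) ⊗ₜ[O] v) = (1 : K) ⊗ₜ[O] (s • v)
  rw [TensorProduct.smul_tmul', TensorProduct.tmul_smul, TensorProduct.smul_tmul', smul_eq_mul,
    mul_one, Algebra.smul_def, mul_one]

lemma map_toK (f : A →ₐ[O] B) (v : PiCompletion π A) :
    CompletionK.map π K f (toK K v) = toK K (PiCompletion.map π f v) := by
  change Algebra.TensorProduct.map (AlgHom.id K K) (PiCompletion.map π f) ((1 : K) ⊗ₜ[O] v) = _
  rw [Algebra.TensorProduct.map_tmul]
  rfl

lemma algebraMap_smul_eq_zero [FaithfulSMul O K] {s : O} (hs : s ≠ 0) {a : CompletionK π K A}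
    (h : algebraMap O K s • a = 0) : a = 0 := by
  have h0 : algebraMap O K s ≠ 0 :=
    (map_ne_zero_iff _ (FaithfulSMul.algebraMap_injective O K)).2 hs
  exact (smul_eq_zero.1 h).resolve_left h0

variable [IsDomain O] [IsFractionRing O K]

lemma exists_smul_eq_toK (a : CompletionK π K A) :
    ∃ s : O, s ≠ 0 ∧ ∃ v, algebraMap O K s • a = toK K v := by
  have hadd : ∀ x y : CompletionK π K A,
      (∃ s : O, s ≠ 0 ∧ ∃ v, algebraMap O K s • x = toK K v) →
      (∃ s : O, s ≠ 0 ∧ ∃ v, algebraMap O K s • y = toK K v) →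
      ∃ s : O, s ≠ 0 ∧ ∃ v, algebraMap O K s • (x + y) = toK K v := by
    rintro x y ⟨s, hs, v, hv⟩ ⟨t, ht, w, hw⟩
    refine ⟨s * t, mul_ne_zero hs ht, t • v + s • w, ?_⟩
    rw [map_add (toK K), ← smul_toK, ← smul_toK, ← hv, ← hw, smul_smul, smul_smul, smul_add,
      ← map_mul, ← map_mul, mul_comm t]
  change K ⊗[O] PiCompletion π A at a
  induction a using TensorProduct.induction_on with
  | zero => exact ⟨1, one_ne_zero, 0, by
      rw [map_zero]; exact smul_zero (A := CompletionK π K A) (algebraMap O K 1)⟩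
  | tmul k v =>
    obtain ⟨a, s, hs, rfl⟩ := IsFractionRing.div_surjective (A := O) k
    refine ⟨s, nonZeroDivisors.ne_zero hs, a • v, ?_⟩
    rw [← smul_toK]
    change algebraMap O K s • ((algebraMap O K a / algebraMap O K s) ⊗ₜ[O] v) =
      algebraMap O K a • ((1 : K) ⊗ₜ[O] v)
    rw [TensorProduct.smul_tmul', TensorProduct.smul_tmul', smul_eq_mul, smul_eq_mul, mul_one,
      mul_div_cancel₀ _ ((map_ne_zero_iff _ (IsFractionRing.injective O K)).2
        (nonZeroDivisors.ne_zero hs))]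
  | add x y hx hy => exact hadd x y hx hy

/-- Tensoring with the fraction field is a localisation, so its kernel is the torsion. No
torsion-freeness of the completed enveloping algebra is assumed, hence the witness `s`. -/
lemma exists_smul_eq_zero_of_toK {v : PiCompletion π A} (h : toK K v = 0) :
    ∃ s : O, s ≠ 0 ∧ s • v = 0 := by
  have hloc : IsLocalizedModule (nonZeroDivisors O) (TensorProduct.mk O K (PiCompletion π A) 1) :=
    (isLocalizedModule_iff_isBaseChange (nonZeroDivisors O) K _).2
      (TensorProduct.isBaseChange O (PiCompletion π A) K)
  obtain ⟨s, hs⟩ := (IsLocalizedModule.eq_zero_iff (nonZeroDivisors O)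
    (TensorProduct.mk O K (PiCompletion π A) 1)).1 h
  exact ⟨s, nonZeroDivisors.ne_zero s.2, hs⟩

end ToK

/-! ### The Tate–Weyl algebra is a domain. -/

section TateWeyl

open PiCompletion

variable {O : Type*} [CommRing O] {π : O} {A B : Type*} [Ring A] [Algebra O A] [Ring B] [Algebra O B]

lemma map_of (f : A →ₐ[O] B) (a : A) : map π f (of π A a) = of π B (f a) := rfl

lemma map_equiv_injective (e : A ≃ₐ[O] B) : Function.Injective (map π e.toAlgHom) := by
  refine Function.LeftInverse.injective (g := map π e.symm.toAlgHom) fun v => ?_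
  refine linear_ext isPiSeparated
    (f := (map π e.symm.toAlgHom).toLinearMap ∘ₗ (map π e.toAlgHom).toLinearMap)
    (g := LinearMap.id) (fun a => ?_) v
  simp [map_of]

/-- The Tate–Weyl algebra over a complete discretely valued field is a domain. -/
theorem isDomain_tateWeylAlgebra {K : Type*} [Field K] {O : ValuationSubring K} {π : O}
    (hO : Function.Bijective (of π O)) (hπ : π ≠ 0) (hprime : (Ideal.span {π}).IsPrime) (r : ℕ) :
    IsDomain (TateWeylAlgebra π r) := by
  have hinj := map_equiv_injective (π := π) (A := weylLattice O r)
    (B := WeylAlgebra O r) (WeylAlgebra.equivWeylLattice O r).symm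
  have htf : ∀ v : PiCompletion π (weylLattice O r), toK K v = 0 → v = 0 := fun v hv => by
    obtain ⟨s, hs, h⟩ := exists_smul_eq_zero_of_toK K hv
    apply hinj
    rw [map_zero]
    exact WeylAlgebra.smul_eq_zero_of_completion hO hπ hs (by rw [← map_smul, h, map_zero])
  have hmul : NoZeroDivisors (TateWeylAlgebra π r) := by
    refine ⟨fun {a b} hab => ?_⟩
    obtain ⟨s, hs, v, hv⟩ := exists_smul_eq_toK K a
    obtain ⟨t, ht, w, hw⟩ := exists_smul_eq_toK K b
    have h1 : v * w = 0 := htf _ (by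
      rw [map_mul, ← hv, ← hw, smul_mul_smul_comm, hab, smul_zero])
    have h2 := WeylAlgebra.mul_eq_zero_of_completion hO hπ hprime
      (v := map π (WeylAlgebra.equivWeylLattice O r).symm.toAlgHom v)
      (w := map π (WeylAlgebra.equivWeylLattice O r).symm.toAlgHom w) (by rw [← map_mul, h1, map_zero])
    rw [map_eq_zero_iff _ hinj, map_eq_zero_iff _ hinj] at h2
    refine h2.imp (fun h => ?_) fun h => ?_
    · exact algebraMap_smul_eq_zero K hs (by rw [hv, h, map_zero])
    · exact algebraMap_smul_eq_zero K ht (by rw [hw, h, map_zero])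
  have hnt : Nontrivial (TateWeylAlgebra π r) := by
    refine ⟨1, 0, fun h => ?_⟩
    have h1 := htf 1 (by rw [map_one, h])
    have h2 := congrArg (WeylAlgebra.hatRep hO r)
      (congrArg (map π (WeylAlgebra.equivWeylLattice O r).symm.toAlgHom) h1)
    rw [map_one, map_one, map_zero, map_zero] at h2
    exact one_ne_zero (LinearMap.congr_fun h2 (1 : MvPowerSeries (Fin r) O))
  exact NoZeroDivisors.to_isDomain _

end TateWeyl

/-! ### The annihilator of `1` in the completed enveloping algebra. -/

section Kernel

attribute [local instance 100] LieRing.ofAssociativeRing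

open PiCompletion UniversalEnvelopingAlgebra

variable {O : Type*} [CommRing O] {π : O} (hO : Function.Bijective (of π O))
  {L : Type*} [LieRing L] [LieAlgebra O L] {r : ℕ} (ρ : L →ₗ⁅O⁆ WeylAlgebra O r)

/-- The value at `1` of the action of the completed enveloping algebra on power series. -/
def hatAct : PiCompletion π (UniversalEnvelopingAlgebra O L) →ₗ[O] MvPowerSeries (Fin r) O :=
  LinearMap.applyₗ (1 : MvPowerSeries (Fin r) O) ∘ₗ (WeylAlgebra.hatRep hO r).toLinearMap ∘ₗ
    (map π (lift O ρ)).toLinearMap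

lemma hatAct_apply (v) :
    hatAct hO ρ v = WeylAlgebra.hatRep hO r (map π (lift O ρ) v) 1 := rfl

lemma hatAct_mul (v w) : hatAct hO ρ (v * w) =
    WeylAlgebra.hatRep hO r (map π (lift O ρ) v) (hatAct hO ρ w) := by
  rw [hatAct_apply, map_mul, map_mul, Module.End.mul_apply, hatAct_apply]

lemma hatAct_of (u : UniversalEnvelopingAlgebra O L) :
    hatAct hO ρ (of π _ u) = (polyAct ρ u : MvPowerSeries (Fin r) O) := by
  rw [hatAct_apply, map_of, WeylAlgebra.hatRep_of, polyAct_apply, ← WeylAlgebra.seriesRep_coe,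
    MvPolynomial.coe_one]

variable {ρ} {B : LieSubalgebra O L} {χ : B →ₗ⁅O⁆ O} (hρ : IsDixmierRep B χ ρ)

lemma characterIdeal_eq_span {ι' : Type*} [Fintype ι'] (β : ι' → B)
    (hβ : Submodule.span O (Set.range β) = ⊤) : characterIdeal B χ =
      Ideal.span (Set.range fun j => ι O (β j : L) - algebraMap O _ (χ (β j))) := by
  refine le_antisymm (Ideal.span_le.2 ?_) (Ideal.span_mono ?_)
  · rintro _ ⟨x, rfl⟩
    have hx : x ∈ Submodule.span O (Set.range β) := by rw [hβ]; trivial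
    obtain ⟨c, rfl⟩ := (Submodule.mem_span_range_iff_exists_fun O).1 hx
    have : ι O ((∑ j, c j • β j : B) : L) - algebraMap O (UniversalEnvelopingAlgebra O L)
        (χ (∑ j, c j • β j)) = ∑ j, algebraMap O _ (c j) *
          (ι O (β j : L) - algebraMap O (UniversalEnvelopingAlgebra O L) (χ (β j))) := by
      have h1 : ((∑ j, c j • β j : B) : L) = ∑ j, c j • (β j : L) := by
        change B.toSubmodule.subtype _ = _
        rw [map_sum]
        rfl
      rw [h1, map_sum, map_sum, map_sum, ← Finset.sum_sub_distrib]
      refine Finset.sum_congr rfl fun j _ => ?_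
      rw [map_smul, map_smul, smul_eq_mul, map_mul, mul_sub, Algebra.smul_def]
    simp only [this]
    exact Submodule.sum_mem _ fun j _ => Ideal.mul_mem_left _ _ (Ideal.subset_span ⟨j, rfl⟩)
  · rintro _ ⟨j, rfl⟩
    exact ⟨β j, rfl⟩

variable [IsDomain O]

lemma mvPowerSeries_smul_eq_zero {σ : Type*} {a : O} (ha : a ≠ 0) {f : MvPowerSeries σ O}
    (h : a • f = 0) : f = 0 := by
  ext m
  have hm := congrArg (MvPowerSeries.coeff m) h
  rw [MvPowerSeries.coeff_smul, map_zero] at hm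
  exact (mul_eq_zero.1 hm).resolve_left ha

include hρ in
/-- The kernel of the action on `1` is generated by finitely many elements `b - χ(b)`. -/
lemma exists_eq_sum_of_hatAct (hπ : π ≠ 0) {ι' : Type*} [Fintype ι'] (β : ι' → B)
    (hβ : Submodule.span O (Set.range β) = ⊤) {v} (hv : hatAct hO ρ v = 0) :
    ∃ w : ι' → PiCompletion π (UniversalEnvelopingAlgebra O L),
      v = ∑ j, w j * of π _ (ι O (β j : L) - algebraMap O _ (χ (β j))) := by
  set y : ι' → UniversalEnvelopingAlgebra O L :=
    fun j => ι O (β j : L) - algebraMap O _ (χ (β j)) with hy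
  -- One step of approximation: write `v = u + π v'`. Then `u` sends `1` to `π q`, and `q` is the
  -- image of some `u'`, so `u - π u'` lies in the integral ideal. The rest `u' + v'` again kills
  -- `1` because power series are torsion-free.
  have hstep : ∀ v : {v // hatAct hO ρ v = 0}, ∃ (c : ι' → UniversalEnvelopingAlgebra O L)
      (z : {v // hatAct hO ρ v = 0}), v.1 = ∑ j, of π _ (c j) * of π _ (y j) + π • z.1 := by
    rintro ⟨v, hv⟩
    obtain ⟨u, v, rfl⟩ := exists_of_add_smul v
    rw [map_add, map_smul, hatAct_of] at hv
    have hdvd : MvPolynomial.C π ∣ polyAct ρ u := by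
      rw [MvPolynomial.C_dvd_iff_dvd_coeff]
      intro m
      have := congrArg (MvPowerSeries.coeff m) hv
      rw [map_add, MvPolynomial.coeff_coe, MvPowerSeries.coeff_smul, map_zero] at this
      exact ⟨-MvPowerSeries.coeff m (hatAct hO ρ v), by linear_combination this⟩
    obtain ⟨q, hq⟩ := hdvd
    obtain ⟨u', rfl⟩ := hρ.surjective q
    rw [← MvPolynomial.smul_eq_C_mul] at hq
    have hmem := hρ.mem_ideal (u - π • u') (by rw [map_sub, map_smul, hq, sub_self])
    rw [characterIdeal_eq_span β hβ, Ideal.span, Submodule.mem_span_range_iff_exists_fun] at hmem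
    obtain ⟨c, hc⟩ := hmem
    have hu : u = ∑ j, c j * y j + π • u' := by
      rw [← sub_eq_iff_eq_add, ← hc]
      rfl
    refine ⟨c, ⟨of π _ u' + v, mvPowerSeries_smul_eq_zero hπ ?_⟩, ?_⟩
    · rw [map_add, smul_add, hatAct_of, ← hv, hq]
      congr 1
    · simp only [← map_mul, ← map_sum]
      rw [smul_add, ← map_smul, ← add_assoc, ← map_add, ← hu]
  choose c z hcz using hstep
  -- The coefficients found at all steps are summed into one series for each of the finitely many
  -- generators, leaving a remainder divisible by every power of `π`.
  let R : {v // hatAct hO ρ v = 0} → PiCompletion π (UniversalEnvelopingAlgebra O L) :=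
    fun v => v.1 - ∑ j, series π (fun k => c (z^[k] v) j) * of π _ (y j)
  have hR : ∀ v, R v = π • R (z v) := by
    intro v
    have e : ∀ j, series π (fun k => c (z^[k] v) j) =
        of π _ (c v j) + π • series π fun k => c (z^[k] (z v)) j := fun j => series_eq _
    have h1 := sub_eq_iff_eq_add'.2 (hcz v)
    simp only [R, e, add_mul, Finset.sum_add_distrib]
    rw [← sub_sub, h1, smul_sub, Finset.smul_sum]
    simp only [smul_mul_assoc]
  have h0 : R ⟨v, hv⟩ = 0 := eq_zero_of_divisible isPiSeparated (fun w => ∃ m, w = R m)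
    (by rintro _ ⟨m, rfl⟩; exact ⟨R (z m), ⟨_, rfl⟩, hR m⟩) ⟨_, rfl⟩
  exact ⟨_, sub_eq_zero.1 h0⟩

end Kernel

end AffinoidDixmier

namespace AffinoidDixmier

/-! ### Annihilators in a module induced from a character. -/

section Induced

variable {K S A : Type*} [Field K] [Ring S] [Algebra K S] [Ring A] [Algebra K A]
  (f : S →ₐ[K] A) (χ : S →ₐ[K] K)

/-- The identification of the one-dimensional module with the field. -/
def charEquiv : CharModule χ ≃+ K := AddEquiv.refl K

lemma charEquiv_smul (s : S) (m : CharModule χ) : charEquiv χ (s • m) = χ s * charEquiv χ m := rfl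

/-- The map from `A` to the module induced from a character that sends `1` to the generator. -/
def inducedGen : A →ₗ[A] InducedModule f.toRingHom (CharModule χ) :=
  LinearMap.toSpanSingleton A _ (Submodule.Quotient.mk
    (p := balancedRelations f.toRingHom (CharModule χ)) ((1 : A) ⊗ₜ[ℤ] (charEquiv χ).symm 1))

lemma inducedGen_apply (a : A) : inducedGen f χ a =
    Submodule.Quotient.mk (p := balancedRelations f.toRingHom (CharModule χ))
      (a ⊗ₜ[ℤ] (charEquiv χ).symm 1) := by
  change a • (Submodule.Quotient.mk (p := balancedRelations f.toRingHom (CharModule χ)) _) = _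
  rw [← Submodule.Quotient.mk_smul, TensorProduct.smul_tmul', smul_eq_mul, mul_one]

lemma inducedGen_mul (a : A) (s : S) : inducedGen f χ (a * f s) =
    Submodule.Quotient.mk (p := balancedRelations f.toRingHom (CharModule χ))
      (a ⊗ₜ[ℤ] (charEquiv χ).symm (χ s)) := by
  rw [inducedGen_apply]
  have h : (charEquiv χ).symm (χ s) = s • (charEquiv χ).symm 1 := by
    rw [AddEquiv.symm_apply_eq, charEquiv_smul, AddEquiv.apply_symm_apply, mul_one]
  rw [h]
  exact (Submodule.Quotient.eq _).2 (Submodule.subset_span ⟨a, s, _, rfl⟩)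

lemma inducedGen_surjective : Function.Surjective (inducedGen f χ) := by
  intro d
  obtain ⟨t, rfl⟩ := Submodule.Quotient.mk_surjective _ d
  induction t using TensorProduct.induction_on with
  | zero => exact ⟨0, map_zero _⟩
  | tmul a m =>
    refine ⟨a * f (algebraMap K S (charEquiv χ m)), ?_⟩
    rw [inducedGen_mul, AlgHom.commutes, Algebra.algebraMap_self_apply, AddEquiv.symm_apply_apply]
  | add x y hx hy =>
    obtain ⟨a, ha⟩ := hx
    obtain ⟨b, hb⟩ := hy
    refine ⟨a + b, ?_⟩
    rw [map_add, ha, hb]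
    rfl

lemma inducedGen_mul_sub (a : A) (s : S) :
    inducedGen f χ (a * (f s - algebraMap K A (χ s))) = 0 := by
  rw [mul_sub, map_sub, sub_eq_zero, ← f.commutes, inducedGen_mul, inducedGen_mul, AlgHom.commutes,
    Algebra.algebraMap_self_apply]

/-- The induced module is cyclic, so annihilating it means that all `a * c` annihilate the
generator. -/
lemma mem_annihilator_iff (a : A) :
    a ∈ Module.annihilator A (InducedModule f.toRingHom (CharModule χ)) ↔
      ∀ c, inducedGen f χ (a * c) = 0 := by
  rw [Module.mem_annihilator]
  constructor
  · intro h c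
    rw [← smul_eq_mul, map_smul, h]
  · intro h d
    obtain ⟨c, rfl⟩ := inducedGen_surjective f χ d
    rw [← map_smul, smul_eq_mul, h]

variable {f χ} in
/-- The annihilator of the generator is the smallest left ideal containing all `s - χ(s)`. -/
lemma mem_of_inducedGen_eq_zero (J : Ideal A) (hJ : ∀ s, f s - algebraMap K A (χ s) ∈ J) {a : A}
    (ha : inducedGen f χ a = 0) : a ∈ J := by
  -- The map `a ⊗ m ↦ a m` modulo `J` kills the balanced relations, because each `f s - χ(s)` lies
  -- in `J`, and it sends the generator to the class of `1`.
  let T : A ⊗[ℤ] CharModule χ →+ A ⧸ J := TensorProduct.liftAddHom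
    (((AddMonoidHom.mul (R := A)).compr₂ J.mkQ.toAddMonoidHom).compl₂
      ((algebraMap K A : K →+ A).comp (charEquiv χ).toAddMonoidHom))
    (fun n a m => by
      change J.mkQ ((n • a) * algebraMap K A (charEquiv χ m)) =
        J.mkQ (a * algebraMap K A (charEquiv χ (n • m)))
      rw [map_zsmul (charEquiv χ), map_zsmul, smul_mul_assoc, mul_smul_comm])
  have hT : ∀ a m, T (a ⊗ₜ[ℤ] m) = J.mkQ (a * algebraMap K A (charEquiv χ m)) := fun a m => rfl
  have hlin : ∀ (c : A) t, T (c • t) = c • T t := by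
    intro c t
    induction t using TensorProduct.induction_on with
    | zero => rw [smul_zero, map_zero, smul_zero]
    | tmul a m =>
      rw [TensorProduct.smul_tmul', smul_eq_mul, hT, hT, mul_assoc, ← smul_eq_mul, map_smul]
    | add x y hx hy => rw [smul_add, map_add, map_add, hx, hy, smul_add]
  rw [inducedGen_apply] at ha
  have hmem := (Submodule.Quotient.mk_eq_zero (balancedRelations f.toRingHom (CharModule χ))).1 ha
  have hzero : ∀ t ∈ balancedRelations f.toRingHom (CharModule χ), T t = 0 := by
    intro t ht
    induction ht using Submodule.span_induction with
    | mem t ht =>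
      obtain ⟨a, s, m, rfl⟩ := ht
      rw [map_sub, hT, hT, ← map_sub, charEquiv_smul]
      refine (Submodule.Quotient.mk_eq_zero J).2 ?_
      have h3 := J.mul_mem_left (a * algebraMap K A (charEquiv χ m)) (hJ s)
      rwa [mul_sub, mul_assoc a _ (f s), Algebra.commutes, ← mul_assoc a (f s), mul_assoc a _
        (algebraMap K A (χ s)), ← map_mul, mul_comm (charEquiv χ m)] at h3
    | zero => exact map_zero T
    | add x y _ _ hx hy => rw [map_add, hx, hy, add_zero]
    | smul c x _ hx => rw [hlin, hx, smul_zero]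
  have h4 := hzero _ hmem
  rw [hT, AddEquiv.apply_symm_apply, map_one, mul_one] at h4
  exact (Submodule.Quotient.mk_eq_zero J).1 h4

end Induced

/-! ### Vectors killed by the affinoid enveloping algebra. -/

section Kernel

attribute [local instance 100] LieRing.ofAssociativeRing

open PiCompletion UniversalEnvelopingAlgebra

section General

variable {O : Type*} [CommRing O] {π : O} (hO : Function.Bijective (of π O))
  {L : Type*} [LieRing L] [LieAlgebra O L] {r : ℕ} (ρ : L →ₗ⁅O⁆ WeylAlgebra O r)

lemma polyAct_mul (u v : UniversalEnvelopingAlgebra O L) :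
    polyAct ρ (u * v) = WeylAlgebra.polyRep O r (lift O ρ u) (polyAct ρ v) := by
  rw [polyAct_apply, map_mul, map_mul, Module.End.mul_apply, polyAct_apply]

lemma polyAct_envelopeIncl {ρ : L →ₗ⁅O⁆ WeylAlgebra O r} {B : LieSubalgebra O L} {χ : B →ₗ⁅O⁆ O}
    (hρ : IsDixmierRep B χ ρ) (u : UniversalEnvelopingAlgebra O B) :
    polyAct ρ (envelopeIncl B u) = MvPolynomial.C (lift O χ u) := by
  induction u using envelope_induction with
  | hι x => rw [envelopeIncl_ι, hρ.apply_char, lift_ι_apply]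
  | halg a =>
    rw [AlgHom.commutes, AlgHom.commutes, polyAct_apply, AlgHom.commutes, AlgHom.commutes,
      Module.algebraMap_end_apply, MvPolynomial.smul_eq_C_mul, mul_one]
    rfl
  | hadd u v hu hv => simp only [map_add, hu, hv]
  | hmul u v hu hv =>
    rw [map_mul, polyAct_mul, hv, ← mul_one (MvPolynomial.C _), ← MvPolynomial.smul_eq_C_mul,
      map_smul, ← polyAct_apply, hu, map_mul, map_mul, MvPolynomial.smul_eq_C_mul, mul_comm]

variable [IsDomain O] (K : Type*) [Field K] [Algebra O K] [IsFractionRing O K]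

/-- The annihilator of `1` in the action of the affinoid enveloping algebra on power series. -/
def vectorAnnihilator : Ideal (AffinoidEnvelope π K L) where
  carrier := {a | ∃ s : O, s ≠ 0 ∧ ∃ v, algebraMap O K s • a = toK K v ∧ hatAct hO ρ v = 0}
  zero_mem' := ⟨1, one_ne_zero, 0, by rw [smul_zero, map_zero], map_zero _⟩
  add_mem' := by
    rintro a b ⟨s, hs, v, hv, hv0⟩ ⟨t, ht, w, hw, hw0⟩
    refine ⟨s * t, mul_ne_zero hs ht, t • v + s • w, ?_, ?_⟩
    · rw [map_add (toK K), ← smul_toK, ← smul_toK, ← hv, ← hw, smul_smul, smul_smul, smul_add,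
        ← map_mul, ← map_mul, mul_comm t]
    · rw [map_add, map_smul, map_smul, hv0, hw0, smul_zero, smul_zero, add_zero]
  smul_mem' := by
    rintro c a ⟨s, hs, v, hv, hv0⟩
    obtain ⟨t, ht, w, hw⟩ := exists_smul_eq_toK K c
    refine ⟨t * s, mul_ne_zero ht hs, w * v, ?_, ?_⟩
    · rw [map_mul (toK K), ← hv, ← hw, smul_mul_smul_comm, map_mul, smul_eq_mul]
    · rw [hatAct_mul, hv0, map_zero]

variable {K ρ} in
-- Denominators and torsion in the completed enveloping algebra do not matter, since the values lie
-- in the torsion-free module of power series.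
lemma hatAct_eq_zero_of_mem {v : PiCompletion π (UniversalEnvelopingAlgebra O L)}
    (h : toK K v ∈ vectorAnnihilator hO ρ K) : hatAct hO ρ v = 0 := by
  obtain ⟨s, hs, w, hw, hw0⟩ := h
  rw [smul_toK, ← sub_eq_zero, ← map_sub] at hw
  obtain ⟨t, ht, h1⟩ := exists_smul_eq_zero_of_toK K hw
  refine mvPowerSeries_smul_eq_zero hs (mvPowerSeries_smul_eq_zero ht ?_)
  have h2 := congrArg (hatAct hO ρ) h1
  rwa [map_smul, map_sub, hw0, sub_zero, map_smul, map_zero] at h2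

/-- An element of the completed enveloping algebra that kills all polynomials is mapped to zero
in the completed Weyl algebra. -/
lemma map_lift_eq_zero_iff [CharZero O] (hπ : π ≠ 0) {B : LieSubalgebra O L} {χ : B →ₗ⁅O⁆ O}
    {ρ : L →ₗ⁅O⁆ WeylAlgebra O r} (hρ : IsDixmierRep B χ ρ)
    (v : PiCompletion π (UniversalEnvelopingAlgebra O L)) :
    map π (lift O ρ) v = 0 ↔ ∀ w, hatAct hO ρ (v * w) = 0 := by
  constructor
  · intro h w
    rw [hatAct_mul, h, map_zero, LinearMap.zero_apply]
  · intro h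
    refine WeylAlgebra.eq_zero_of_hatRep hO hπ fun q => ?_
    obtain ⟨u, rfl⟩ := hρ.surjective q
    rw [← hatAct_of hO, ← hatAct_mul, h]

end General

end Kernel

end AffinoidDixmier

namespace AffinoidDixmier

/-! ### Values of the extended character. -/

section Character

open PiCompletion

variable {p : ℕ} [Fact p.Prime] {K : Type*} [Field K] [Algebra ℚ_[p] K]
  [FiniteDimensional ℚ_[p] K] {π : integers p K} (hπ : Irreducible π)
  {A : Type*} [Ring A] [Algebra (integers p K) A] (χ : A →ₐ[integers p K] integers p K)

lemma extendCharacter_of (a : A) : extendCharacter hπ χ (of π A a) = χ a := by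
  change (AlgEquiv.ofBijective (of π (integers p K)) (of_bijective hπ)).symm
    (of π (integers p K) (χ a)) = χ a
  rw [AlgEquiv.symm_apply_eq]
  rfl

lemma characterK_toK (v : PiCompletion π A) :
    characterK hπ χ (toK K v) = algebraMap (integers p K) K (extendCharacter hπ χ v) := by
  change Algebra.TensorProduct.lift _ _ _ ((1 : K) ⊗ₜ[integers p K] v) = _
  rw [Algebra.TensorProduct.lift_tmul, map_one, one_mul]
  rfl

end Character

/-! ### The Dixmier annihilator as a kernel. -/

section Dixmier

attribute [local instance 100] LieRing.ofAssociativeRing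

open PiCompletion UniversalEnvelopingAlgebra

variable {O : Type*} [CommRing O] {π : O} (hO : Function.Bijective (of π O))
  {K : Type*} [Field K] [Algebra O K]
  {L : Type*} [LieRing L] [LieAlgebra O L] {B : LieSubalgebra O L} {χ : B →ₗ⁅O⁆ O}
  {r : ℕ} {ρ : L →ₗ⁅O⁆ WeylAlgebra O r} (hρ : IsDixmierRep B χ ρ)
  {e : PiCompletion π (UniversalEnvelopingAlgebra O B) →ₐ[O] O}
  (he : ∀ u, e (of π _ u) = lift O χ u)
  {ψ : AffinoidEnvelope π K B →ₐ[K] K} (hψ : ∀ v, ψ (toK K v) = algebraMap O K (e v))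

include hρ he in
-- On `U(B)` this is multiplicativity of `χ`; the completed case follows by density.
lemma hatAct_map_envelopeIncl (v : PiCompletion π (UniversalEnvelopingAlgebra O B)) :
    hatAct hO ρ (map π (envelopeIncl B) v) = e v • (1 : MvPowerSeries (Fin r) O) := by
  refine linear_ext (isPiSeparated_mvPowerSeries (isPiSeparated_of_injective hO.1))
    (f := hatAct hO ρ ∘ₗ (map π (envelopeIncl B)).toLinearMap)
    (g := e.toLinearMap.smulRight (1 : MvPowerSeries (Fin r) O)) (fun u => ?_) v
  rw [LinearMap.comp_apply, LinearMap.smulRight_apply, AlgHom.toLinearMap_apply,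
    AlgHom.toLinearMap_apply, map_of, hatAct_of, polyAct_envelopeIncl hρ, he,
    MvPolynomial.coe_C, MvPowerSeries.smul_eq_C_mul, mul_one]

variable [IsDomain O] [IsFractionRing O K]

include hρ he hψ in
lemma sub_algebraMap_mem_vectorAnnihilator (s) :
    CompletionK.map π K (envelopeIncl B) s - algebraMap K _ (ψ s) ∈ vectorAnnihilator hO ρ K := by
  obtain ⟨t, ht, v, hv⟩ := exists_smul_eq_toK K s
  refine ⟨t, ht, map π (envelopeIncl B) v - e v • 1, ?_, ?_⟩
  · rw [smul_sub, ← map_smul, hv, map_toK, Algebra.algebraMap_eq_smul_one (ψ s), smul_smul, ← smul_eq_mul,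
      ← map_smul, hv, hψ, map_sub, ← smul_toK, map_one]
  · rw [map_sub, hatAct_map_envelopeIncl hO hρ he, map_smul, sub_eq_zero]
    congr 1
    rw [hatAct_apply, map_one (map π _), map_one (WeylAlgebra.hatRep _ _), Module.End.one_apply]

include hρ he hψ in
/-- The annihilators of the generators of the two modules coincide. -/
lemma inducedGen_eq_zero_iff [Module.Finite O B] (hπ : π ≠ 0) (a : AffinoidEnvelope π K L) :
    inducedGen (CompletionK.map π K (envelopeIncl B)) ψ a = 0 ↔ a ∈ vectorAnnihilator hO ρ K := by
  -- One inclusion holds because the annihilator of `1` is a left ideal containing all `s - ψ(s)`.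
  -- The other uses that, up to a scalar, an element killing `1` is a finite combination of the `b -
  -- χ(b)`, each of which kills the generator.
  refine ⟨mem_of_inducedGen_eq_zero _ (sub_algebraMap_mem_vectorAnnihilator hO hρ he hψ), ?_⟩
  rintro ⟨s, hs, v, hv, hv0⟩
  obtain ⟨n, β, hβ⟩ := Module.Finite.exists_fin (R := O) (M := B)
  obtain ⟨w, hw⟩ := exists_eq_sum_of_hatAct hO hρ hπ β hβ hv0
  have hgen : inducedGen (CompletionK.map π K (envelopeIncl B)) ψ (toK K v) = 0 := by
    rw [hw, map_sum, map_sum]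
    refine Finset.sum_eq_zero fun j _ => ?_
    have h1 := inducedGen_mul_sub (CompletionK.map π K (envelopeIncl B))
      ψ (toK K (w j)) (toK K (of π _ (ι O (β j) - algebraMap O _ (χ (β j)))))
    rw [hψ, he, map_toK, map_of, map_sub (lift _ _), lift_ι_apply,
      AlgHom.commutes, Algebra.algebraMap_self_apply, sub_self, map_zero, map_zero, sub_zero,
      ← map_mul, map_sub (envelopeIncl _), envelopeIncl_ι, AlgHom.commutes] at h1
    exact h1
  have hs0 : algebraMap O K s ≠ 0 :=
    (map_ne_zero_iff _ (IsFractionRing.injective O K)).2 hs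
  have ha : a = algebraMap K _ (algebraMap O K s)⁻¹ * toK K v := by
    rw [← hv, ← Algebra.smul_def, inv_smul_smul₀ hs0]
  rw [ha, ← smul_eq_mul, map_smul, hgen, smul_zero]

include hO hρ he hψ in
/-- The annihilator of the induced module is the kernel of the map to the completed Weyl algebra. -/
lemma completionK_map_eq_zero_iff [Module.Finite O B] [CharZero O] (hπ : π ≠ 0) {C : Type*} [Ring C]
    [Algebra O C] (E : WeylAlgebra O r ≃ₐ[O] C) (a : AffinoidEnvelope π K L) :
    CompletionK.map π K (E.toAlgHom.comp (lift O ρ)) a = 0 ↔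
      a ∈ Module.annihilator (AffinoidEnvelope π K L)
        (InducedModule (CompletionK.map π K (envelopeIncl B)).toRingHom (CharModule ψ)) := by
  have hinj := map_equiv_injective (π := π) E
  have hcomp : ∀ v : PiCompletion π (UniversalEnvelopingAlgebra O L),
      map π (E.toAlgHom.comp (lift O ρ)) v = map π E.toAlgHom (map π (lift O ρ) v) := fun v =>
    linear_ext isPiSeparated (f := (map π (E.toAlgHom.comp (lift O ρ))).toLinearMap)
      (g := (map π E.toAlgHom).toLinearMap ∘ₗ (map π (lift O ρ)).toLinearMap) (fun u => rfl) v
  refine Iff.trans ?_ (mem_annihilator_iff _ _ a).symm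
  have hiff := fun c => inducedGen_eq_zero_iff hO hρ he hψ hπ (a * c)
  rw [forall_congr' hiff]
  obtain ⟨s, hs, v, hv⟩ := exists_smul_eq_toK K a
  have hmap : algebraMap O K s • CompletionK.map π K (E.toAlgHom.comp (lift O ρ)) a =
      toK K (map π E.toAlgHom (map π (lift O ρ) v)) := by
    rw [← map_smul, hv, map_toK, hcomp]
  have hker := map_lift_eq_zero_iff hO hπ hρ v
  constructor
  · intro h c
    obtain ⟨t, ht, w, hw⟩ := exists_smul_eq_toK K c
    refine ⟨s * t, mul_ne_zero hs ht, v * w, ?_, hker.1 ?_ w⟩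
    · rw [map_mul (toK K), ← hv, ← hw, smul_mul_smul_comm, map_mul]
    · rw [h, smul_zero] at hmap
      obtain ⟨t, ht, h1⟩ := exists_smul_eq_zero_of_toK K hmap.symm
      rw [← map_smul, map_eq_zero_iff _ hinj] at h1
      exact WeylAlgebra.smul_eq_zero_of_completion hO hπ ht h1
  · intro h
    have h0 : map π (lift O ρ) v = 0 := hker.2 fun w => by
      refine hatAct_eq_zero_of_mem hO (K := K) ?_
      rw [map_mul, ← hv, smul_mul_assoc, Algebra.smul_def]
      exact Ideal.mul_mem_left _ _ (h _)
    rw [h0, map_zero, map_zero] at hmap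
    exact algebraMap_smul_eq_zero K hs hmap

end Dixmier

end AffinoidDixmier

end

open AffinoidDixmier

theorem mainTheorem12
    (p : ℕ) [Fact p.Prime]
    (K : Type*) [Field K] [Algebra ℚ_[p] K] [FiniteDimensional ℚ_[p] K]
    (π : AffinoidDixmier.integers p K) (hπ : Irreducible π)
    (g : Type*) [LieRing g] [LieAlgebra K g] [FiniteDimensional K g] [LieRing.IsNilpotent g]
    (L : LieSubalgebra (AffinoidDixmier.integers p K) g)
    (hL : AffinoidDixmier.IsLattice π L.toSubmodule)
    (hpow : ∀ x ∈ L, ∀ y ∈ L, ∃ z ∈ L, ⁅x, y⁆ = p • z)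
    (lam : Module.Dual K g) (hlam : ∀ x ∈ L, lam x ∈ AffinoidDixmier.integers p K)
    (b : LieSubalgebra K g) (hb : AffinoidDixmier.IsPolarisation lam b)
    (r : ℕ) (hr : Module.finrank K (g ⧸ b.toSubmodule) = r) :
    (∃ φ : (AffinoidDixmier.AffinoidEnvelope π K L ⧸
          AffinoidDixmier.dixmierAnnihilator hπ hlam hb) →ₐ[K]
        AffinoidDixmier.TateWeylAlgebra π r, Function.Injective φ) ∧
      IsDomain (AffinoidDixmier.AffinoidEnvelope π K L ⧸
        AffinoidDixmier.dixmierAnnihilator hπ hlam hb) := by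
  have := isDiscreteValuationRing hπ
  have := charZero_integers p K
  have := finite_lattice hπ hL
  have := isTorsionFree_lattice (L := L)
  have hnil : LieRing.IsNilpotent L :=
    Function.Injective.lieAlgebra_isNilpotent (f := L.incl) Subtype.val_injective
  obtain ⟨c, hc⟩ := exists_isDividedPowers p K
  obtain ⟨ρ, hρ⟩ := exists_dixmierRep (Fact.out : p.Prime).ne_zero hc r (latticePart L b)
    (latticeCharacter hlam hb)
    -- The intersection of `L` with a `K`-subspace is saturated.
    (fun a x ha hx => (b.toSubmodule.smul_mem_iff fun h => ha (Subtype.ext h)).1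
      (show (a : K) • (x : g) ∈ b.toSubmodule from hx))
    (fun x y => by
      obtain ⟨z, hz, h⟩ := hpow x x.2 y y.2
      exact ⟨⟨z, hz⟩, Subtype.ext h⟩)
    ((finrank_quotient_latticePart hπ hL b).trans hr)
  have hfin : Module.Finite (integers p K) (latticePart L b) :=
    inferInstanceAs (Module.Finite (integers p K) (latticePart L b).toSubmodule)
  have hker := completionK_map_eq_zero_iff (C := weylLattice (integers p K) r) (of_bijective hπ) hρ
    (extendCharacter_of hπ _) (characterK_toK hπ _) hπ.ne_zero
    (WeylAlgebra.equivWeylLattice (integers p K) r)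
  let φ : (AffinoidEnvelope π K L ⧸ dixmierAnnihilator hπ hlam hb) →ₐ[K] TateWeylAlgebra π r :=
    Ideal.Quotient.liftₐ (dixmierAnnihilator hπ hlam hb) (CompletionK.map π K
      ((WeylAlgebra.equivWeylLattice (integers p K) r).toAlgHom.comp
        (UniversalEnvelopingAlgebra.lift (integers p K) ρ))) fun a ha => (hker a).2 ha
  have hφ : Function.Injective φ := by
    rw [injective_iff_map_eq_zero]
    intro x hx
    obtain ⟨a, rfl⟩ := Ideal.Quotient.mk_surjective x
    exact Ideal.Quotient.eq_zero_iff_mem.2 ((hker a).1 hx)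
  have := isDomain_tateWeylAlgebra (of_bijective hπ) hπ.ne_zero (isPrime_span hπ) r
  exact ⟨⟨φ, hφ⟩, hφ.isDomain φ⟩
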